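/- Let $d\ge 1$, let $\Omega=[0,1]^d$ be the $d$-dimensional torus (opposite points identified), let $T>0$, and let $f\in C_c^\infty(\mathbb R)$. For $s\in\mathbb R$ let $H^s=H^s(\Omega)$ be the periodic $L^2$-Sobolev space with norm $\|h\|_{H^s}^2=\sum_{k\in\mathbb Z^d}(1+4\pi^2|k|^2)^s|\langle h,e_k\rangle|^2$, $e_k(x)=e^{2\pi i k\cdot x}$, so that $H^0=L^2=L^2(\Omega)$ and $H^{-1}=(H^1)^*$. For $\theta\in H^1$, a (weak) solution of $\partial_t u-\Delta u=f(u)$, $u(0)=\theta$, is a real-valued $u\in L^2([0,T],H^1)\cap C([0,T],L^2)$ whose weak time derivative $u'$ lies in $L^2([0,T],H^{-1})$, such that $u(0)=\theta$ and, for all $v\in H^1$ and a.e. $t\in(0,T]$, $$\langle u'(t),v\rangle+\langle\nabla u(t),\nabla v\rangle_{L^2}=\langle f(u(t)),v\rangle_{L^2}.$$ Let $\gamma\ge 0$ be a real number, and if $\gamma>2$ assume also $d\le 3$. For every $B$ there are finite constants $C,C'$ depending only on $B,f,\gamma,d,T$ such that, for every $\theta\in H^1$ with $\|\theta\|_{H^\gamma}\le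 B$ and every solution $u$ with initial condition $\theta$, $$\int_0^T\|u(t)\|_{H^{\gamma+1}}^2\,dt+\sup_{0\le t\le T}\|u(t)\|_{H^\gamma}\le C,$$ $$\int_0^T\|u'(t)\|_{H^{\gamma-1}}^2\,dt+\operatorname*{ess\,sup}_{0\le t\le T}\|u'(t)\|_{H^{\gamma-2}}\le C'.$$ Moreover $u\in C([0,T],H^\gamma)$, and if $\theta\in C^\infty(\Omega)$, then $u\in\bigcap_{b>0}C^1([0,T],C^b(\Omega))$. Here $C^b(\Omega)$ is the usual space of periodic $C^b$ functions (a Hölder space if $b\notin\mathbb N$), and $C^1([0,T],C^b(\Omega))$ is the space of weakly differentiable maps with $\sup_{t}\|u(t)\|_{C^b}+\operatorname{ess\,sup}_t\|u'(t)\|_{C^b}<\infty$. -/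

import Mathlib

open MeasureTheory Set Filter Topology
open scoped ENNReal NNReal ContDiff

noncomputable section

namespace PeriodicRD

/-! ### The torus and periodic functions -/

/-- The `d`-dimensional torus `Ω = (ℝ/ℤ)^d`, that is `[0,1]^d` with opposite points identified. -/
abbrev Torus (d : ℕ) : Type := UnitAddTorus (Fin d)

/-- The normalised Haar measure on the torus: Lebesgue measure on `[0,1]^d`. -/
def torusMeasure (d : ℕ) : Measure (Torus d) :=
  Measure.pi fun _ : Fin d => (AddCircle.haarAddCircle : Measure UnitAddCircle)

instance instIsProbabilityMeasureTorus (d : ℕ) : IsProbabilityMeasure (torusMeasure d) :=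
  inferInstanceAs (IsProbabilityMeasure
    (Measure.pi fun _ : Fin d => (AddCircle.haarAddCircle : Measure UnitAddCircle)))

instance instIsAddHaarMeasureTorus (d : ℕ) : (torusMeasure d).IsAddHaarMeasure :=
  inferInstanceAs ((Measure.pi fun _ : Fin d =>
    (AddCircle.haarAddCircle : Measure UnitAddCircle)).IsAddHaarMeasure)

/-- The quotient map `ℝ^d → Ω`. -/
def toTorus (d : ℕ) (y : EuclideanSpace ℝ (Fin d)) : Torus d := fun i => (y i : UnitAddCircle)

/-- The 1-periodic function on `ℝ^d` that corresponds to a function on the torus. -/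
def perLift {d : ℕ} (φ : Torus d → ℝ) : EuclideanSpace ℝ (Fin d) → ℝ := fun y => φ (toTorus d y)

/-- `φ ∈ C^∞(Ω)`. -/
def IsSmooth {d : ℕ} (φ : Torus d → ℝ) : Prop := ContDiff ℝ ∞ (perLift φ)

/-- The classical partial derivative `∂φ/∂x_i` of a function on the torus. -/
def partialDeriv {d : ℕ} (i : Fin d) (φ : Torus d → ℝ) (x : Torus d) : ℝ :=
  deriv (fun s : ℝ => φ (x + toTorus d (EuclideanSpace.single i s))) 0

/-! ### `L²(Ω)`, weak derivatives, `H¹(Ω)` and its dual -/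

/-- The Hilbert space `L²(Ω)` of real-valued functions. -/
abbrev L2 (d : ℕ) : Type := Lp ℝ 2 (torusMeasure d)

/-- `w ∈ L²(Ω)` is the weak partial derivative in direction `i` of `u ∈ L²(Ω)`. -/
def IsWeakPartial {d : ℕ} (i : Fin d) (u w : L2 d) : Prop :=
  ∀ φ : Torus d → ℝ, IsSmooth φ →
    ∫ x, u x * partialDeriv i φ x ∂torusMeasure d = -∫ x, w x * φ x ∂torusMeasure d

section Aux

variable {d : ℕ}

lemma toTorus_add (y z : EuclideanSpace ℝ (Fin d)) :
    toTorus d (y + z) = toTorus d y + toTorus d z := by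
  funext i
  simp [toTorus]

lemma isQuotientMap_toTorus (d : ℕ) : IsQuotientMap (toTorus d) := by
  have h1 : IsOpenQuotientMap (Pi.map (fun _ : Fin d => ((↑) : ℝ → UnitAddCircle))) :=
    IsOpenQuotientMap.piMap fun _ => QuotientAddGroup.isOpenQuotientMap_mk
  have h2 := h1.isQuotientMap.comp
    (EuclideanSpace.equiv (Fin d) ℝ).toHomeomorph.isQuotientMap
  exact h2

lemma perLift_line (φ : Torus d → ℝ) (i : Fin d) (y : EuclideanSpace ℝ (Fin d)) (s : ℝ) :
    φ (toTorus d y + toTorus d (EuclideanSpace.single i s))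
      = perLift φ (y + s • EuclideanSpace.single i (1 : ℝ)) := by
  rw [← toTorus_add, perLift]
  congr 3
  ext j
  by_cases h : j = i <;> simp [h]

lemma hasDerivAt_line {φ : Torus d → ℝ} (hφ : IsSmooth φ) (i : Fin d)
    (y : EuclideanSpace ℝ (Fin d)) (s : ℝ) :
    HasDerivAt (fun s : ℝ => φ (toTorus d y + toTorus d (EuclideanSpace.single i s)))
      (fderiv ℝ (perLift φ) (y + s • EuclideanSpace.single i (1 : ℝ))
        (EuclideanSpace.single i (1 : ℝ))) s := by
  simp_rw [perLift_line]
  have h1 : HasFDerivAt (perLift φ) (fderiv ℝ (perLift φ) (y + s • EuclideanSpace.single i (1 : ℝ)))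
      (y + s • EuclideanSpace.single i (1 : ℝ)) :=
    ((ContDiff.differentiable hφ (by simp)) _).hasFDerivAt
  have h2 : HasDerivAt (fun s : ℝ => y + s • EuclideanSpace.single i (1 : ℝ))
      (EuclideanSpace.single i (1 : ℝ)) s := by
    simpa using ((hasDerivAt_id s).smul_const (EuclideanSpace.single i (1 : ℝ))).const_add y
  exact h1.comp_hasDerivAt s h2

lemma perLift_partialDeriv {φ : Torus d → ℝ} (hφ : IsSmooth φ) (i : Fin d) :
    perLift (partialDeriv i φ)
      = fun y => fderiv ℝ (perLift φ) y (EuclideanSpace.single i (1 : ℝ)) := by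
  funext y
  have := (hasDerivAt_line hφ i y 0).deriv
  simpa [perLift, partialDeriv] using this

lemma IsSmooth.partialDeriv {φ : Torus d → ℝ} (hφ : IsSmooth φ) (i : Fin d) :
    IsSmooth (partialDeriv i φ) := by
  unfold IsSmooth
  rw [perLift_partialDeriv hφ]
  exact (ContDiff.fderiv_right (m := ∞) hφ (by simp)).clm_apply contDiff_const

lemma IsSmooth.continuous {φ : Torus d → ℝ} (hφ : IsSmooth φ) : Continuous φ :=
  (isQuotientMap_toTorus d).continuous_iff.2 (ContDiff.continuous hφ)

lemma IsSmooth.mul {φ ψ : Torus d → ℝ} (hφ : IsSmooth φ) (hψ : IsSmooth ψ) :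
    IsSmooth (fun x => φ x * ψ x) :=
  ContDiff.mul hφ hψ

lemma IsSmooth.hasDerivAt {φ : Torus d → ℝ} (hφ : IsSmooth φ) (i : Fin d) (x : Torus d) (s : ℝ) :
    HasDerivAt (fun s : ℝ => φ (x + toTorus d (EuclideanSpace.single i s)))
      (PeriodicRD.partialDeriv i φ (x + toTorus d (EuclideanSpace.single i s))) s := by
  obtain ⟨y, rfl⟩ := (isQuotientMap_toTorus d).surjective x
  have h := hasDerivAt_line hφ i y s
  rw [← congrFun (perLift_partialDeriv hφ i), ← perLift_line] at h
  exact h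

lemma partialDeriv_mul {φ ψ : Torus d → ℝ} (hφ : IsSmooth φ) (hψ : IsSmooth ψ) (i : Fin d)
    (x : Torus d) :
    partialDeriv i (fun x => φ x * ψ x) x = partialDeriv i φ x * ψ x + φ x * partialDeriv i ψ x := by
  have h0 : toTorus d (EuclideanSpace.single i (0 : ℝ)) = 0 := by
    funext j; simp [toTorus]
  have h1 := (hφ.hasDerivAt i x 0).mul (hψ.hasDerivAt i x 0)
  simp only [h0, add_zero] at h1
  exact h1.deriv

lemma integrable_continuous {φ : Torus d → ℝ} (hφ : Continuous φ) :
    Integrable φ (torusMeasure d) :=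
  hφ.integrable_of_hasCompactSupport (HasCompactSupport.of_compactSpace φ)

lemma memLp_continuous {φ : Torus d → ℝ} (hφ : Continuous φ) :
    MemLp φ 2 (torusMeasure d) := by
  exact (hφ.memLp_of_hasCompactSupport (HasCompactSupport.of_compactSpace φ))

lemma integrable_L2_mul (u : L2 d) {φ : Torus d → ℝ} (hφ : Continuous φ) :
    Integrable (fun x => u x * φ x) (torusMeasure d) :=
  (Lp.memLp u).integrable_mul (memLp_continuous hφ)

lemma integral_partialDeriv {φ : Torus d → ℝ} (hφ : IsSmooth φ) (i : Fin d) :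
    ∫ x, partialDeriv i φ x ∂torusMeasure d = 0 := by
  have hc := (hφ.partialDeriv i).continuous
  obtain ⟨K, hK⟩ := (isCompact_range hc).isBounded.exists_norm_le
  have hcont : ∀ s : ℝ, Continuous fun x : Torus d =>
      φ (x + toTorus d (EuclideanSpace.single i s)) := fun s =>
    hφ.continuous.comp (continuous_id.add continuous_const)
  have key := (hasDerivAt_integral_of_dominated_loc_of_deriv_le (μ := torusMeasure d)
    (F := fun (s : ℝ) x => φ (x + toTorus d (EuclideanSpace.single i s)))
    (F' := fun (s : ℝ) x => partialDeriv i φ (x + toTorus d (EuclideanSpace.single i s)))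
    (x₀ := 0) (s := univ) (bound := fun _ => K) univ_mem
    (Eventually.of_forall fun s => (hcont s).aestronglyMeasurable)
    (integrable_continuous (hcont 0))
    ((hc.comp (continuous_id.add continuous_const)).aestronglyMeasurable)
    (ae_of_all _ fun x s _ => hK _ (mem_range_self _))
    (integrable_const K)
    (ae_of_all _ fun x s _ => hφ.hasDerivAt i x s)).2
  simp only [integral_add_right_eq_self] at key
  exact (key.unique (hasDerivAt_const (0 : ℝ) _))

lemma isWeakPartial_of_smooth {φ : Torus d → ℝ} (hφ : IsSmooth φ) (i : Fin d) :
    IsWeakPartial i ((memLp_continuous hφ.continuous).toLp φ)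
      ((memLp_continuous (hφ.partialDeriv i).continuous).toLp (partialDeriv i φ)) := by
  intro ψ hψ
  have h1 : ∫ x, ((memLp_continuous hφ.continuous).toLp φ) x * partialDeriv i ψ x ∂torusMeasure d
      = ∫ x, φ x * partialDeriv i ψ x ∂torusMeasure d := by
    apply integral_congr_ae
    filter_upwards [(memLp_continuous hφ.continuous).coeFn_toLp] with x hx
    rw [hx]
  have h2 : ∫ x, ((memLp_continuous (hφ.partialDeriv i).continuous).toLp (partialDeriv i φ)) x
      * ψ x ∂torusMeasure d = ∫ x, partialDeriv i φ x * ψ x ∂torusMeasure d := by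
    apply integral_congr_ae
    filter_upwards [(memLp_continuous (hφ.partialDeriv i).continuous).coeFn_toLp] with x hx
    rw [hx]
  have h3 := integral_partialDeriv (hφ.mul hψ) i
  simp_rw [partialDeriv_mul hφ hψ] at h3
  have h4 := integral_add
    (integrable_continuous ((hφ.partialDeriv i).continuous.mul hψ.continuous))
    (integrable_continuous (hφ.continuous.mul (hψ.partialDeriv i).continuous))
  simp only [Pi.mul_apply] at h4
  rw [h1, h2]
  linarith

end Aux

/-- The pairs `(u, ∇u)` with `u ∈ L²(Ω)` whose weak partial derivatives `∂_i u` lie in `L²(Ω)`,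
inside the Hilbert space `L²(Ω) × L²(Ω)^d`. -/
def H1Submodule (d : ℕ) : Submodule ℝ (WithLp 2 (L2 d × PiLp 2 fun _ : Fin d => L2 d)) where
  carrier := {p | ∀ i, IsWeakPartial i p.fst (p.snd i)}
  zero_mem' := by
    intro i φ hφ
    simp
  add_mem' := by
    intro p q hp hq i φ hφ
    have key : ∀ (a b : L2 d) {ψ : Torus d → ℝ}, Continuous ψ →
        ∫ x, (a + b) x * ψ x ∂torusMeasure d
          = ∫ x, a x * ψ x ∂torusMeasure d + ∫ x, b x * ψ x ∂torusMeasure d := by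
      intro a b ψ hψ
      rw [← integral_add (integrable_L2_mul a hψ) (integrable_L2_mul b hψ)]
      apply integral_congr_ae
      filter_upwards [Lp.coeFn_add a b] with x hx
      rw [hx, Pi.add_apply, add_mul]
    have h1 := hp i φ hφ
    have h2 := hq i φ hφ
    simp only [WithLp.add_fst, WithLp.add_snd, PiLp.add_apply]
    rw [key _ _ (hφ.partialDeriv i).continuous, key _ _ hφ.continuous, h1, h2]
    ring
  smul_mem' := by
    intro c p hp i φ hφ
    have key : ∀ (a : L2 d) (ψ : Torus d → ℝ),
        ∫ x, (c • a) x * ψ x ∂torusMeasure d = c * ∫ x, a x * ψ x ∂torusMeasure d := by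
      intro a ψ
      rw [← integral_const_mul]
      apply integral_congr_ae
      filter_upwards [Lp.coeFn_smul c a] with x hx
      rw [hx, Pi.smul_apply, smul_eq_mul, mul_assoc]
    have h1 := hp i φ hφ
    simp only [WithLp.smul_fst, WithLp.smul_snd, PiLp.smul_apply]
    rw [key, key, h1]
    ring

/-- The Sobolev space `H¹(Ω)` of the `u ∈ L²(Ω)` with weak partial derivatives `∂_i u ∈ L²(Ω)`,
with norm `(‖u‖² + ∑ᵢ ‖∂_i u‖²)^(1/2)`. -/
def H1 (d : ℕ) : Type := ↥(H1Submodule d)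

instance instNormedAddCommGroupH1 (d : ℕ) : NormedAddCommGroup (H1 d) :=
  inferInstanceAs (NormedAddCommGroup ↥(H1Submodule d))

instance instInnerProductSpaceH1 (d : ℕ) : InnerProductSpace ℝ (H1 d) :=
  inferInstanceAs (InnerProductSpace ℝ ↥(H1Submodule d))

/-- The `L²` function underlying an element of `H¹(Ω)`. -/
def H1.toL2 {d : ℕ} (v : H1 d) : L2 d := (Subtype.val v).fst

/-- The weak partial derivative `∂_i v` of `v ∈ H¹(Ω)`. -/
def H1.grad {d : ℕ} (v : H1 d) (i : Fin d) : L2 d := (Subtype.val v).snd i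

/-- A smooth function as an element of `H¹(Ω)`. -/
def H1.ofSmooth {d : ℕ} (φ : Torus d → ℝ) (hφ : IsSmooth φ) : H1 d :=
  ⟨WithLp.toLp 2 ((memLp_continuous hφ.continuous).toLp φ,
      WithLp.toLp 2 fun i =>
        (memLp_continuous (hφ.partialDeriv i).continuous).toLp (partialDeriv i φ)),
    fun i => isWeakPartial_of_smooth hφ i⟩

/-- The dual space `H^{-1}(Ω) = (H¹(Ω))^*`. -/
abbrev HNeg1 (d : ℕ) : Type := StrongDual ℝ (H1 d)

/-! ### The Sobolev norms of real order -/

/-- The eigenvalue `λ_k = 4π²|k|²` of `-Δ` for the eigenfunction `e_k(x) = exp(2πi k·x)`. -/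
def eigenvalue {d : ℕ} (k : Fin d → ℤ) : ℝ := 4 * Real.pi ^ 2 * ∑ i, (k i : ℝ) ^ 2

/-- The `H^s` norm `(∑_k (1 + λ_k)^s |c_k|²)^(1/2)`, with values in `[0,∞]`, of the periodic
distribution with Fourier coefficients `c`, for any real order `s`. -/
def sobolevNorm {d : ℕ} (s : ℝ) (c : (Fin d → ℤ) → ℂ) : ℝ≥0∞ :=
  (∑' k, ENNReal.ofReal ((1 + eigenvalue k) ^ s) * ‖c k‖ₑ ^ 2) ^ (1 / 2 : ℝ)

/-- The Fourier coefficients `⟨w, e_k⟩ = ∫ w(x) exp(-2πi k·x) dx` of `w ∈ L²(Ω)`. -/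
def L2.coeff {d : ℕ} (w : L2 d) (k : Fin d → ℤ) : ℂ :=
  ∫ x, (w x : ℂ) * UnitAddTorus.mFourier (-k) x ∂torusMeasure d

/-- `x ↦ cos(2π k·x)`. -/
def cosMode {d : ℕ} (k : Fin d → ℤ) (x : Torus d) : ℝ := (UnitAddTorus.mFourier k x).re

/-- `x ↦ sin(2π k·x)`. -/
def sinMode {d : ℕ} (k : Fin d → ℤ) (x : Torus d) : ℝ := (UnitAddTorus.mFourier k x).im

lemma mFourier_toTorus {d : ℕ} (k : Fin d → ℤ) (y : EuclideanSpace ℝ (Fin d)) :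
    UnitAddTorus.mFourier k (toTorus d y)
      = ∏ i, Complex.exp (2 * Real.pi * Complex.I * k i * ((y i : ℝ) : ℂ)) := by
  simp [UnitAddTorus.mFourier, toTorus]

lemma contDiff_mFourier {d : ℕ} (k : Fin d → ℤ) :
    ContDiff ℝ ∞ fun y => UnitAddTorus.mFourier k (toTorus d y) := by
  simp_rw [mFourier_toTorus]
  refine contDiff_prod fun i _ => ContDiff.cexp (contDiff_const.mul ?_)
  exact Complex.ofRealCLM.contDiff.comp (EuclideanSpace.proj (𝕜 := ℝ) i).contDiff

lemma isSmooth_cosMode {d : ℕ} (k : Fin d → ℤ) : IsSmooth (cosMode k) :=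
  Complex.reCLM.contDiff.comp (contDiff_mFourier k)

lemma isSmooth_sinMode {d : ℕ} (k : Fin d → ℤ) : IsSmooth (sinMode k) :=
  Complex.imCLM.contDiff.comp (contDiff_mFourier k)

/-- The Fourier coefficients of `G ∈ H^{-1}(Ω)`: the action of `G`, extended complex-linearly, on
`exp(-2πi k·x) = cos(2π k·x) - i sin(2π k·x)`. -/
def HNeg1.coeff {d : ℕ} (G : HNeg1 d) (k : Fin d → ℤ) : ℂ :=
  (G (H1.ofSmooth (cosMode k) (isSmooth_cosMode k)) : ℂ)
    - Complex.I * (G (H1.ofSmooth (sinMode k) (isSmooth_sinMode k)) : ℂ)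

/-- `‖w‖_{H^s} ∈ [0,∞]` for `w ∈ L²(Ω)`; it is finite iff `w ∈ H^s(Ω)`. -/
def L2.hNorm {d : ℕ} (s : ℝ) (w : L2 d) : ℝ≥0∞ := sobolevNorm s (L2.coeff w)

/-- `‖G‖_{H^s} ∈ [0,∞]` for `G ∈ H^{-1}(Ω)`; it is finite iff `G ∈ H^s(Ω)`. -/
def HNeg1.hNorm {d : ℕ} (s : ℝ) (G : HNeg1 d) : ℝ≥0∞ := sobolevNorm s (HNeg1.coeff G)

/-! ### Weak solutions -/

/-- `u` (with time derivative `u'`) is a weak solution on `[0,T]` of the periodic problem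
`∂u/∂t - Δu = f(u)`, `u(0) = θ`: one has `u ∈ L²([0,T], H¹) ∩ C([0,T], L²)`, the weak time
derivative `u'` of `u` lies in `L²([0,T], H^{-1})`, and
`⟨u', v⟩ + ⟨∇u, ∇v⟩_{L²} = ⟨f(u), v⟩_{L²}` for all `v ∈ H¹` and a.e. `t`. -/
structure IsWeakSolution {d : ℕ} (f : ℝ → ℝ) (T : ℝ) (θ : H1 d)
    (u : ℝ → L2 d) (u' : ℝ → HNeg1 d) : Prop where
  continuousOn : ContinuousOn u (Icc 0 T)
  initial : u 0 = H1.toL2 θ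
  memLp_deriv : MemLp u' 2 (volume.restrict (Icc 0 T))
  weak_deriv : ∀ η : ℝ → ℝ, ContDiff ℝ ∞ η → HasCompactSupport η → tsupport η ⊆ Ioo 0 T →
    ∀ v : H1 d, ∫ t in Icc 0 T, deriv η t * inner ℝ (u t) (H1.toL2 v)
      = -∫ t in Icc 0 T, η t * u' t v
  equation : ∃ U : ℝ → H1 d, MemLp U 2 (volume.restrict (Icc 0 T)) ∧
    (∀ᵐ t ∂volume.restrict (Icc 0 T), H1.toL2 (U t) = u t) ∧
    ∀ v : H1 d, ∀ᵐ t ∂volume.restrict (Icc 0 T),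
      u' t v + ∑ i, inner ℝ (H1.grad (U t) i) (H1.grad v i)
        = ∫ x, f (u t x) * H1.toL2 v x ∂torusMeasure d

/-! ### The spaces `C^b(Ω)` and `C¹([0,T], C^b(Ω))` -/

/-- `h ∈ C^b(Ω)` with norm at most `K`, for real `b ≥ 0`: with `m` the integer part of `b`, the
derivatives up to order `m` exist, are continuous and bounded by `K`, and if `b` is not an
integer, the `m`-th derivative is Hölder continuous with exponent `b - m` and constant `K`. -/
def HolderBound {d : ℕ} (b K : ℝ) (h : Torus d → ℝ) : Prop :=
  ContDiff ℝ ⌊b⌋₊ (perLift h) ∧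
  (∀ j ≤ ⌊b⌋₊, ∀ y, ‖iteratedFDeriv ℝ j (perLift h) y‖ ≤ K) ∧
  ((⌊b⌋₊ : ℝ) < b → ∀ y z,
    ‖iteratedFDeriv ℝ ⌊b⌋₊ (perLift h) y - iteratedFDeriv ℝ ⌊b⌋₊ (perLift h) z‖
      ≤ K * ‖y - z‖ ^ (b - ⌊b⌋₊))

/-- The `L²` function `w` is, after a change on a null set, bounded by `K` in `C^b(Ω)`. -/
def L2.HolderBound {d : ℕ} (b K : ℝ) (w : L2 d) : Prop :=
  ∃ h : Torus d → ℝ, PeriodicRD.HolderBound b K h ∧ w =ᵐ[torusMeasure d] h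

/-- `G ∈ H^{-1}(Ω)` is given by integration against a function bounded by `K` in `C^b(Ω)`. -/
def HNeg1.HolderBound {d : ℕ} (b K : ℝ) (G : HNeg1 d) : Prop :=
  ∃ h : Torus d → ℝ, PeriodicRD.HolderBound b K h ∧
    ∀ v : H1 d, G v = ∫ x, h x * H1.toL2 v x ∂torusMeasure d

/-- `u`, with weak time derivative `u'`, lies in `C¹([0,T], C^b(Ω))`, the space of weakly
differentiable maps with `sup_t ‖u(t)‖_{C^b} + ess sup_t ‖u'(t)‖_{C^b} < ∞`. -/
def MemC1Holder {d : ℕ} (T b : ℝ) (u : ℝ → L2 d) (u' : ℝ → HNeg1 d) : Prop :=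
  ∃ K : ℝ, (∀ t ∈ Icc 0 T, L2.HolderBound b K (u t)) ∧
    ∀ᵐ t ∂volume.restrict (Icc 0 T), HNeg1.HolderBound b K (u' t)

/-- `w ∈ C^∞(Ω)`, after a change on a null set. -/
def L2.IsSmooth {d : ℕ} (w : L2 d) : Prop :=
  ∃ h : Torus d → ℝ, PeriodicRD.IsSmooth h ∧ w =ᵐ[torusMeasure d] h

end PeriodicRD

end

open PeriodicRD

noncomputable section

namespace PeriodicRD

open UnitAddTorus ComplexConjugate

variable {d : ℕ}

/-! On the torus the equation is diagonal in the Fourier basis apart from the source f(u). Testing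
with cosines and sines shows that each coefficient a_k of u solves a_k' = -λ_k a_k + F_k classically
on [0,T], where F_k is the k-th coefficient of f(u); it is continuous in time because f is Lipschitz
and u ∈ C([0,T], L²) (`IsWeakSolution.modeSolution`). Everything is read off from this system.

Sobolev bounds. A scalar energy estimate (`mode_energy`) controls |a_k(t)|² + (1+λ_k)∫|a_k|² by
|a_k(0)|² + (1+λ_k)⁻¹∫|F_k|², up to the factor e^{2T}. Weighted by (1+λ_k)^s and summed, it says
that a source in L²H^{s-1} and initial data in H^s give u ∈ L^∞H^s ∩ L²H^{s+1}; continuity in H^s is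
dominated convergence over the modes. The source is controlled by a bootstrap
(`exists_sobolevSq_source_le`): f is bounded, so f(u) is bounded in L²; a bound of f(u) in H^n with
n+1 ≤ γ bounds u in H^{n+1}, and composition with f maps bounded sets of H^{n+1} to bounded sets
(`sobolevSq_comp`). It suffices to reach an integer n ≥ γ-1. Composition costs nothing for n ≤ 1;
for n ≥ 2 it needs products of derivatives, estimated by Cauchy-Schwarz on the convolution, where
∑(1+λ_k)⁻² < ∞ requires d ≤ 3. The bounds on u' follow from the equation, coefficient by
coefficient.

Smooth data. Here no restriction on d is available, so the bootstrap runs in the sup norm. The heat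
semigroup averages against Gaussians coordinate by coordinate, hence contracts the sup norm and
gains one derivative at cost (2t)^{-1/2} (`abs_series_deriv_heatCoeff_le`). This singularity is
integrable in Duhamel's formula, so m bounded derivatives of the source yield m+1 of u
(`ModeSolution.exists_supBound_succ`), and composition with f loses none (`exists_supBound_comp`).
As u(t) is known only to lie in L², these bounds are proved for e^{εΔ}u(t), uniformly in ε. Bounds
on all derivatives give rapid decay of the coefficients, uniformly in time
(`IsWeakSolution.exists_weight_bound`), and hence all Hölder bounds; u' is represented by Δu + f(u).
-/

/-! ### Fourier coefficients, Parseval's identity and convolution -/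

/-- The Fourier coefficients of a real function on the torus. -/
def fcoeff (g : Torus d → ℝ) (k : Fin d → ℤ) : ℂ :=
  ∫ x, (g x : ℂ) * mFourier (-k) x ∂torusMeasure d

lemma L2.coeff_eq_fcoeff (w : L2 d) (k : Fin d → ℤ) : L2.coeff w k = fcoeff w k := rfl

lemma fcoeff_congr_ae {g h : Torus d → ℝ} (e : g =ᵐ[torusMeasure d] h) : fcoeff g = fcoeff h := by
  funext k
  refine integral_congr_ae ?_
  filter_upwards [e] with x hx
  rw [hx]

lemma fcoeff_toLp {g : Torus d → ℝ} (hg : MemLp g 2 (torusMeasure d)) :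
    L2.coeff (hg.toLp g) = fcoeff g :=
  fcoeff_congr_ae hg.coeFn_toLp

lemma norm_mFourier_apply (k : Fin d → ℤ) (x : Torus d) : ‖mFourier k x‖ = 1 := by
  simp only [mFourier, fourier_apply, ContinuousMap.coe_mk, norm_prod, Circle.norm_coe,
      Finset.prod_const_one]

lemma integrable_mul_mFourier {g : Torus d → ℝ} (hg : Integrable g (torusMeasure d))
    (k : Fin d → ℤ) : Integrable (fun x => (g x : ℂ) * mFourier k x) (torusMeasure d) := by
  refine hg.ofReal.mul_bdd (c := 1) (mFourier k).continuous.aestronglyMeasurable ?_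
  exact ae_of_all _ fun x => (norm_mFourier_apply k x).le

lemma L2.integrable (w : L2 d) : Integrable w (torusMeasure d) :=
  (Lp.memLp w).integrable (by norm_num)

lemma fcoeff_add {g h : Torus d → ℝ} (hg : Integrable g (torusMeasure d))
    (hh : Integrable h (torusMeasure d)) (k : Fin d → ℤ) :
    fcoeff (fun x => g x + h x) k = fcoeff g k + fcoeff h k := by
  unfold fcoeff
  rw [← integral_add (integrable_mul_mFourier hg _) (integrable_mul_mFourier hh _)]
  congr 1
  funext x
  push_cast
  ring

lemma fcoeff_sub {g h : Torus d → ℝ} (hg : Integrable g (torusMeasure d))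
    (hh : Integrable h (torusMeasure d)) (k : Fin d → ℤ) :
    fcoeff (fun x => g x - h x) k = fcoeff g k - fcoeff h k := by
  unfold fcoeff
  rw [← integral_sub (integrable_mul_mFourier hg _) (integrable_mul_mFourier hh _)]
  congr 1
  funext x
  push_cast
  ring

lemma L2.coeff_sub (v w : L2 d) (k : Fin d → ℤ) :
    L2.coeff (v - w) k = L2.coeff v k - L2.coeff w k := by
  rw [L2.coeff_eq_fcoeff, fcoeff_congr_ae (Lp.coeFn_sub v w)]
  exact fcoeff_sub v.integrable w.integrable k

lemma fcoeff_neg_index (g : Torus d → ℝ) (k : Fin d → ℤ) : fcoeff g (-k) = conj (fcoeff g k) := by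
  unfold fcoeff
  rw [← integral_conj]
  congr 1
  funext x
  rw [map_mul, Complex.conj_ofReal, ← mFourier_neg]

/-- A bounded function has bounded Fourier coefficients. -/
lemma norm_fcoeff_le {g : Torus d → ℝ} {K : ℝ} (hK : ∀ x, |g x| ≤ K) (k : Fin d → ℤ) :
    ‖fcoeff g k‖ ≤ K := by
  have := norm_integral_le_of_norm_le_const (μ := torusMeasure d) (C := K)
    (f := fun x => (g x : ℂ) * mFourier (-k) x) (ae_of_all _ fun x => by
      rw [norm_mul, norm_mFourier_apply, mul_one, Complex.norm_real]; exact hK x)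
  simpa [fcoeff] using this

/-- Parseval's identity for complex functions. -/
lemma hasSum_conj_mul_of_memLp {v w : Torus d → ℂ} (hv : MemLp v 2 (torusMeasure d))
    (hw : MemLp w 2 (torusMeasure d)) :
    HasSum (fun k => conj (∫ x, v x * mFourier (-k) x ∂torusMeasure d) *
      ∫ x, w x * mFourier (-k) x ∂torusMeasure d)
      (∫ x, conj (v x) * w x ∂torusMeasure d) := by
  have h : HasSum (fun k => conj (mFourierCoeff (hv.toLp v) k) * mFourierCoeff (hw.toLp w) k)
      (∫ x, conj (hv.toLp v x) * hw.toLp w x ∂torusMeasure d) :=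
    hasSum_prod_mFourierCoeff (d := Fin d) (hv.toLp v) (hw.toLp w)
  have e : ∀ {u : Torus d → ℂ} (hu : MemLp u 2 (torusMeasure d)) (k : Fin d → ℤ),
      mFourierCoeff (hu.toLp u) k = ∫ x, u x * mFourier (-k) x ∂torusMeasure d := by
    intro u hu k
    refine integral_congr_ae (μ := torusMeasure d) ?_
    filter_upwards [hu.coeFn_toLp] with x hx
    rw [hx, smul_eq_mul, mul_comm]
  have e2 : ∫ x, conj (hv.toLp v x) * hw.toLp w x ∂torusMeasure d
      = ∫ x, conj (v x) * w x ∂torusMeasure d := by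
    refine integral_congr_ae ?_
    filter_upwards [hv.coeFn_toLp, hw.coeFn_toLp] with x hx hy
    rw [hx, hy]
  rw [e2] at h
  simpa only [e] using h

lemma hasSum_conj_fcoeff_mul {v w : Torus d → ℝ} (hv : MemLp v 2 (torusMeasure d))
    (hw : MemLp w 2 (torusMeasure d)) :
    HasSum (fun k => conj (fcoeff v k) * fcoeff w k)
      ((∫ x, v x * w x ∂torusMeasure d : ℝ) : ℂ) := by
  have h := hasSum_conj_mul_of_memLp hv.ofReal hw.ofReal
  convert! h using 1
  rw [← integral_complex_ofReal]
  simp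

lemma hasSum_norm_fcoeff_sq {v : Torus d → ℝ} (hv : MemLp v 2 (torusMeasure d)) :
    HasSum (fun k => ‖fcoeff v k‖ ^ 2) (∫ x, v x ^ 2 ∂torusMeasure d) := by
  have h := Complex.hasSum_re (hasSum_conj_fcoeff_mul hv hv)
  simp only [Complex.ofReal_re, ← sq] at h
  convert! h using 2 with k
  rw [← Complex.normSq_eq_norm_sq, ← Complex.normSq_eq_conj_mul_self, Complex.ofReal_re]

lemma integral_sq_eq_norm_sq (w : L2 d) : ∫ x, w x ^ 2 ∂torusMeasure d = ‖w‖ ^ 2 := by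
  rw [← real_inner_self_eq_norm_sq, L2.inner_def]
  simp [sq]

lemma L2.hasSum_norm_coeff_sq (w : L2 d) : HasSum (fun k => ‖L2.coeff w k‖ ^ 2) (‖w‖ ^ 2) := by
  rw [← integral_sq_eq_norm_sq]
  exact hasSum_norm_fcoeff_sq (Lp.memLp w)

lemma L2.norm_coeff_le (w : L2 d) (k : Fin d → ℤ) : ‖L2.coeff w k‖ ≤ ‖w‖ := by
  have h := le_hasSum (L2.hasSum_norm_coeff_sq w) k fun j _ => sq_nonneg _
  exact (sq_le_sq₀ (norm_nonneg _) (norm_nonneg _)).1 h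

lemma L2.ext_coeff {v w : L2 d} (h : ∀ k, L2.coeff v k = L2.coeff w k) : v = w := by
  have h1 := L2.hasSum_norm_coeff_sq (v - w)
  simp only [L2.coeff_sub, h, sub_self, norm_zero, ne_eq, OfNat.ofNat_ne_zero, not_false_eq_true,
    zero_pow] at h1
  have := h1.unique hasSum_zero
  exact sub_eq_zero.1 (norm_eq_zero.1 (pow_eq_zero_iff (two_ne_zero) |>.1 this))

/-- The Fourier coefficients of a product are the convolution of the Fourier coefficients. -/
lemma hasSum_fcoeff_mul {v w : Torus d → ℝ} (hv : MemLp v 2 (torusMeasure d))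
    (hw : MemLp w 2 (torusMeasure d)) (k : Fin d → ℤ) :
    HasSum (fun l => fcoeff v l * fcoeff w (k - l)) (fcoeff (fun x => v x * w x) k) := by
  -- The modulated function w·e_{-k} is still in L², so Parseval for v against it produces the
  -- shifted coefficients of w.
  have hw' : MemLp (fun x => (w x : ℂ) * mFourier (-k) x) 2 (torusMeasure d) := by
    refine MemLp.of_le (g := w) hw ((Complex.continuous_ofReal.comp_aestronglyMeasurable hw.1).mul
      (mFourier (-k)).continuous.aestronglyMeasurable) (ae_of_all _ fun x => ?_)
    rw [norm_mul, norm_mFourier_apply, mul_one, Complex.norm_real]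
  have h := hasSum_conj_mul_of_memLp hv.ofReal hw'
  -- Parseval conjugates the coefficients of v; for real v this is l ↦ -l, undone by reindexing.
  rw [← (Equiv.neg (Fin d → ℤ)).hasSum_iff]
  convert! h using 1
  · funext l
    simp only [Function.comp, Equiv.neg_apply]
    rw [fcoeff_neg_index]
    congr 1
    unfold fcoeff
    congr 1
    funext x
    rw [mul_assoc, ← mFourier_add]
    congr 3
    abel
  · unfold fcoeff
    congr 1
    funext x
    simp
    ring

/-! ### Weights -/

lemma eigenvalue_nonneg (k : Fin d → ℤ) : 0 ≤ eigenvalue k := by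
  unfold eigenvalue; positivity

lemma one_le_weight (k : Fin d → ℤ) : 1 ≤ 1 + eigenvalue k := by
  linarith [eigenvalue_nonneg k]

lemma weight_pos (k : Fin d → ℤ) : 0 < 1 + eigenvalue k := by
  linarith [eigenvalue_nonneg k]

lemma eigenvalue_eq_sum (k : Fin d → ℤ) : eigenvalue k = ∑ i, (2 * Real.pi * k i) ^ 2 := by
  rw [eigenvalue, Finset.mul_sum]
  exact Finset.sum_congr rfl fun i _ => by ring

lemma eigenvalue_neg (k : Fin d → ℤ) : eigenvalue (-k) = eigenvalue k := by
  simp [eigenvalue]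

lemma sq_le_eigenvalue (k : Fin d → ℤ) (i : Fin d) : (2 * Real.pi * k i) ^ 2 ≤ eigenvalue k := by
  rw [eigenvalue_eq_sum]
  exact Finset.single_le_sum (f := fun i => (2 * Real.pi * (k i : ℝ)) ^ 2)
    (fun j _ => sq_nonneg _) (Finset.mem_univ i)

/-- The symbol `2πi k_i` of `∂/∂x_i`. -/
def derivSymbol (i : Fin d) (k : Fin d → ℤ) : ℂ := 2 * Real.pi * Complex.I * k i

lemma norm_derivSymbol_sq (i : Fin d) (k : Fin d → ℤ) :
    ‖derivSymbol i k‖ ^ 2 = (2 * Real.pi * k i) ^ 2 := by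
  have : derivSymbol i k = ((2 * Real.pi * k i : ℝ) : ℂ) * Complex.I := by
    simp [derivSymbol]; ring
  rw [this, norm_mul, Complex.norm_I, mul_one, Complex.norm_real, Real.norm_eq_abs, sq_abs]

/-- Deliberately crude, by x ≤ 1 + x²: against rapidly decaying coefficients only polynomial growth
of the symbol matters. -/
lemma norm_derivSymbol_le (i : Fin d) (k : Fin d → ℤ) : ‖derivSymbol i k‖ ≤ 1 + eigenvalue k := by
  have h1 := norm_derivSymbol_sq i k
  have h2 := sq_le_eigenvalue k i
  nlinarith [sq_nonneg (‖derivSymbol i k‖ - 1), norm_nonneg (derivSymbol i k)]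

lemma sum_norm_derivSymbol_sq (k : Fin d → ℤ) : ∑ i, ‖derivSymbol i k‖ ^ 2 = eigenvalue k := by
  simp_rw [norm_derivSymbol_sq, eigenvalue_eq_sum]

lemma derivSymbol_neg (i : Fin d) (k : Fin d → ℤ) :
    derivSymbol i (-k) = conj (derivSymbol i k) := by
  simp [derivSymbol, map_ofNat]

lemma sum_derivSymbol_sq (k : Fin d → ℤ) : ∑ i, derivSymbol i k ^ 2 = -(eigenvalue k : ℂ) := by
  rw [eigenvalue_eq_sum]
  push_cast
  rw [← Finset.sum_neg_distrib]
  refine Finset.sum_congr rfl fun i _ => ?_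
  simp only [derivSymbol, mul_pow, Complex.I_sq]
  ring

lemma norm_sq_le_eigenvalue (k : Fin d → ℤ) : ‖fun i => (k i : ℝ)‖ ^ 2 ≤ eigenvalue k := by
  have h : ‖fun i => (k i : ℝ)‖ ≤ √(eigenvalue k) := by
    refine (pi_norm_le_iff_of_nonneg (Real.sqrt_nonneg _)).2 fun i => ?_
    refine Real.le_sqrt_of_sq_le ?_
    have h1 := sq_le_eigenvalue k i
    have h2 := Real.pi_gt_three
    rw [Real.norm_eq_abs, sq_abs]
    have h3 : (k i : ℝ) ^ 2 ≤ (2 * Real.pi) ^ 2 * (k i : ℝ) ^ 2 :=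
      le_mul_of_one_le_left (sq_nonneg _) (by nlinarith)
    rw [mul_pow] at h1
    exact h3.trans h1
  calc _ ≤ (√(eigenvalue k)) ^ 2 := by gcongr
    _ = _ := Real.sq_sqrt (eigenvalue_nonneg k)

/-- Comparison with the lattice sum of ‖k‖^{-2N} over ℤ^d, realised as the span of the standard
basis; it converges for 2N > d. -/
lemma summable_weight_inv {N : ℕ} (hN : d < 2 * N) :
    Summable fun k : Fin d → ℤ => ((1 + eigenvalue k) ^ N)⁻¹ := by
  let b := Pi.basisFun ℝ (Fin d)
  let L := Submodule.span ℤ (Set.range b)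
  have hL : Module.finrank ℤ L = d := by
    have : Module.finrank ℤ L = Module.finrank ℝ (Fin d → ℝ) := ZLattice.rank ℝ L
    rw [this]; simp
  have hs := ZLattice.summable_norm_pow_inv L (2 * N) (by rw [hL]; exact hN)
  let e : (Fin d → ℤ) → L := fun k => ⟨fun i => (k i : ℝ), by
    have : (fun i => (k i : ℝ)) = ∑ i, k i • b i := by
      funext j
      simp [b, Finset.sum_apply, Pi.single_apply]
    rw [this]
    exact Submodule.sum_mem _ fun i _ => Submodule.smul_mem _ _ (Submodule.subset_span ⟨i, rfl⟩)⟩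
  have he : Function.Injective e := fun k l h => by
    funext i
    have := congrFun (congrArg Subtype.val h) i
    simpa [e] using this
  -- The comparison fails at k = 0, where the lattice term is 0 by the convention for inverses, so
  -- that single index is discarded.
  refine Summable.of_norm_bounded_eventually (hs.comp_injective he) ?_
  refine (Set.finite_singleton (0 : Fin d → ℤ)).subset fun k hk => ?_
  by_contra hk0
  refine hk ?_
  have hpos : 0 < ‖fun i => (k i : ℝ)‖ := norm_pos_iff.2 fun h => hk0 (by
    funext i; simpa using congrFun h i)
  have h1 : ‖e k‖ = ‖fun i => (k i : ℝ)‖ := rfl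
  change ‖((1 + eigenvalue k) ^ N)⁻¹‖ ≤ ‖e k‖⁻¹ ^ (2 * N)
  rw [h1, Real.norm_of_nonneg (inv_nonneg.2 (pow_nonneg (weight_pos k).le _)), inv_pow, pow_mul]
  gcongr
  linarith [norm_sq_le_eigenvalue k]

/-! ### Rapidly decaying coefficients and their Fourier series -/

/-- Coefficients decaying faster than any power. -/
def RapidDecay (c : (Fin d → ℤ) → ℂ) : Prop :=
  ∀ N : ℕ, ∃ K : ℝ, ∀ k, ‖c k‖ * (1 + eigenvalue k) ^ N ≤ K

/-- Coefficients of a real distribution. -/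
def Hermitian (c : (Fin d → ℤ) → ℂ) : Prop := ∀ k, c (-k) = conj (c k)

/-- The d+1 surplus powers of the weight pay for summation over ℤ^d, as d < 2(d+1). The explicit
constant is what makes the Hölder bounds uniform in time. -/
lemma summable_of_weight_bound {c : (Fin d → ℤ) → ℂ} {N : ℕ} {K : ℝ}
    (h : ∀ k, ‖c k‖ * (1 + eigenvalue k) ^ (N + (d + 1)) ≤ K) :
    Summable (fun k => ‖c k‖ * (1 + eigenvalue k) ^ N) ∧
    ∑' k, ‖c k‖ * (1 + eigenvalue k) ^ N
      ≤ K * ∑' k : Fin d → ℤ, ((1 + eigenvalue k) ^ (d + 1))⁻¹ := by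
  have hs := (summable_weight_inv (d := d) (N := d + 1) (by omega)).mul_left K
  have hle : ∀ k, ‖c k‖ * (1 + eigenvalue k) ^ N ≤ K * ((1 + eigenvalue k) ^ (d + 1))⁻¹ := by
    intro k
    rw [le_mul_inv_iff₀ (pow_pos (weight_pos k) _), mul_assoc, ← pow_add]
    exact h k
  have hs' : Summable (fun k => ‖c k‖ * (1 + eigenvalue k) ^ N) :=
    hs.of_nonneg_of_le (fun k => mul_nonneg (norm_nonneg _) (pow_nonneg (weight_pos k).le _)) hle
  exact ⟨hs', by rw [← tsum_mul_left]; exact hs'.tsum_le_tsum hle hs⟩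

lemma RapidDecay.summable_weight {c : (Fin d → ℤ) → ℂ} (hc : RapidDecay c) (N : ℕ) :
    Summable (fun k => ‖c k‖ * (1 + eigenvalue k) ^ N) := by
  obtain ⟨K, hK⟩ := hc (N + (d + 1))
  exact (summable_of_weight_bound hK).1

lemma RapidDecay.summable_norm {c : (Fin d → ℤ) → ℂ} (hc : RapidDecay c) :
    Summable (fun k => ‖c k‖) := by
  simpa using hc.summable_weight 0

lemma RapidDecay.mul {c m : (Fin d → ℤ) → ℂ} (hc : RapidDecay c) (C : ℝ) (M : ℕ)
    (hm : ∀ k, ‖m k‖ ≤ C * (1 + eigenvalue k) ^ M) : RapidDecay (fun k => m k * c k) := by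
  intro N
  obtain ⟨K, hK⟩ := hc (M + N)
  have hC : 0 ≤ C := by
    have := (norm_nonneg _).trans (hm 0)
    exact nonneg_of_mul_nonneg_left this (pow_pos (weight_pos _) _)
  refine ⟨C * K, fun k => ?_⟩
  have := hK k
  rw [norm_mul]
  calc ‖m k‖ * ‖c k‖ * (1 + eigenvalue k) ^ N
      ≤ (C * (1 + eigenvalue k) ^ M) * ‖c k‖ * (1 + eigenvalue k) ^ N := by
        have := weight_pos k
        gcongr
        exact hm k
    _ = C * (‖c k‖ * (1 + eigenvalue k) ^ (M + N)) := by rw [pow_add]; ring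
    _ ≤ C * K := mul_le_mul_of_nonneg_left this hC

lemma RapidDecay.of_norm_le {c e : (Fin d → ℤ) → ℂ} (hc : RapidDecay c)
    (h : ∀ k, ‖e k‖ ≤ ‖c k‖) : RapidDecay e := fun N => by
  obtain ⟨K, hK⟩ := hc N
  refine ⟨K, fun k => le_trans ?_ (hK k)⟩
  have := weight_pos k
  gcongr
  exact h k

lemma RapidDecay.derivSymbol_mul {c : (Fin d → ℤ) → ℂ} (hc : RapidDecay c) (i : Fin d) :
    RapidDecay (fun k => derivSymbol i k * c k) :=
  hc.mul 1 1 fun k => by simpa using norm_derivSymbol_le i k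

lemma Hermitian.derivSymbol_mul {c : (Fin d → ℤ) → ℂ} (hc : Hermitian c) (i : Fin d) :
    Hermitian (fun k => derivSymbol i k * c k) := fun k => by
  simp only [derivSymbol_neg, hc k, map_mul]

lemma Hermitian.real_mul {c : (Fin d → ℤ) → ℂ} (hc : Hermitian c) {m : (Fin d → ℤ) → ℝ}
    (hm : ∀ k, m (-k) = m k) : Hermitian (fun k => (m k : ℂ) * c k) := fun k => by
  simp only [hm, hc k, map_mul, Complex.conj_ofReal]

lemma hermitian_fcoeff (g : Torus d → ℝ) : Hermitian (fcoeff g) := fcoeff_neg_index g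

/-- The real part of the Fourier series with the given coefficients. -/
def series (c : (Fin d → ℤ) → ℂ) (x : Torus d) : ℝ := (∑' k, c k * mFourier k x).re

lemma summable_mul_mFourier {c : (Fin d → ℤ) → ℂ} (hc : Summable fun k => ‖c k‖) (x : Torus d) :
    Summable fun k => c k * mFourier k x := by
  refine Summable.of_norm ?_
  simpa [norm_mFourier_apply] using hc

lemma abs_series_le {c : (Fin d → ℤ) → ℂ} (hc : Summable fun k => ‖c k‖) (x : Torus d) :
    |series c x| ≤ ∑' k, ‖c k‖ := by
  refine (Complex.abs_re_le_norm _).trans ?_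
  refine (norm_tsum_le_tsum_norm ?_).trans_eq ?_
  · simpa [norm_mFourier_apply] using hc
  · simp [norm_mFourier_apply]

/-- The substitution k ↦ -k shows that the complex sum equals its conjugate, so taking the real part
in `series` loses nothing. -/
lemma Hermitian.ofReal_series {c : (Fin d → ℤ) → ℂ} (h : Hermitian c) (x : Torus d) :
    ((series c x : ℝ) : ℂ) = ∑' k, c k * mFourier k x := by
  unfold series
  refine Complex.conj_eq_iff_re.1 ?_
  rw [Complex.conj_tsum, ← (Equiv.neg (Fin d → ℤ)).tsum_eq]
  refine tsum_congr fun k => ?_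
  simp only [Equiv.neg_apply, map_mul, h k, Complex.conj_conj, ← mFourier_neg, neg_neg]

/-! ### Smoothness of the series -/

/-- The linear functional `y ↦ 2π k·y`. -/
def phase (k : Fin d → ℤ) : EuclideanSpace ℝ (Fin d) →L[ℝ] ℝ :=
  innerSL ℝ (WithLp.toLp 2 fun i => 2 * Real.pi * (k i : ℝ))

lemma norm_phase_le (k : Fin d → ℤ) : ‖phase k‖ ≤ 1 + eigenvalue k := by
  have h : ‖phase k‖ ^ 2 = eigenvalue k := by
    rw [phase, innerSL_apply_norm, EuclideanSpace.norm_sq_eq, eigenvalue_eq_sum]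
    simp only [Real.norm_eq_abs, sq_abs]
  nlinarith [sq_nonneg (‖phase k‖ - 1), norm_nonneg (phase k)]

lemma mFourier_toTorus_eq (k : Fin d → ℤ) (y : EuclideanSpace ℝ (Fin d)) :
    mFourier k (toTorus d y) = Complex.exp (Complex.I * (phase k y : ℝ)) := by
  rw [mFourier_toTorus, ← Complex.exp_sum]
  congr 1
  simp only [phase, innerSL_apply_apply, PiLp.inner_apply]
  simp [Finset.mul_sum]
  exact Finset.sum_congr rfl fun i _ => by ring

lemma iteratedDeriv_exp_I (j : ℕ) :
    iteratedDeriv j (fun s : ℝ => Complex.exp (Complex.I * s))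
      = fun s : ℝ => Complex.I ^ j * Complex.exp (Complex.I * s) := by
  induction j with
  | zero => simp
  | succ j ih =>
    rw [iteratedDeriv_succ, ih]
    funext s
    have h1 : HasDerivAt (fun s : ℝ => Complex.I * (s : ℂ)) (Complex.I * 1) s :=
      (Complex.ofRealCLM.hasDerivAt (x := s)).const_mul Complex.I
    rw [(h1.cexp.const_mul (Complex.I ^ j)).deriv]
    ring

lemma contDiff_exp_I : ContDiff ℝ ∞ (fun s : ℝ => Complex.exp (Complex.I * s)) :=
  (contDiff_const.mul Complex.ofRealCLM.contDiff).cexp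

/-- A mode is s ↦ e^{is} composed with the linear functional `phase k`. All derivatives of e^{is}
have modulus one, and each of the j slots contributes one factor ‖`phase k`‖. -/
lemma norm_iteratedFDeriv_mode_le (k : Fin d → ℤ) (c : ℂ) (j : ℕ)
    (y : EuclideanSpace ℝ (Fin d)) :
    ‖iteratedFDeriv ℝ j (fun y => c * mFourier k (toTorus d y)) y‖
      ≤ ‖c‖ * (1 + eigenvalue k) ^ j := by
  have e : (fun y => c * mFourier k (toTorus d y))
      = c • ((fun s : ℝ => Complex.exp (Complex.I * s)) ∘ phase k) := by
    funext y
    simp [mFourier_toTorus_eq]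
  have hcd : ContDiff ℝ j ((fun s : ℝ => Complex.exp (Complex.I * s)) ∘ phase k) :=
    (contDiff_exp_I.of_le (by exact_mod_cast le_top)).comp (phase k).contDiff
  rw [e, iteratedFDeriv_const_smul_apply hcd.contDiffAt, norm_smul]
  gcongr
  rw [(phase k).iteratedFDeriv_comp_right contDiff_exp_I _ (by exact_mod_cast le_top)]
  refine (ContinuousMultilinearMap.norm_compContinuousLinearMap_le _ _).trans ?_
  rw [norm_iteratedFDeriv_eq_norm_iteratedDeriv, iteratedDeriv_exp_I]
  have h1 : ‖Complex.exp (Complex.I * (phase k y : ℝ))‖ = 1 := by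
    rw [mul_comm]; exact Complex.norm_exp_ofReal_mul_I _
  rw [norm_mul, h1]
  simp only [norm_pow, Complex.norm_I, one_pow, mul_one, Finset.prod_const, Finset.card_univ,
    Fintype.card_fin, one_mul]
  gcongr
  exact norm_phase_le k

lemma contDiff_complexSeries {c : (Fin d → ℤ) → ℂ} (hc : RapidDecay c) :
    ContDiff ℝ ∞ (fun y : EuclideanSpace ℝ (Fin d) => ∑' k, c k * mFourier k (toTorus d y)) := by
  refine contDiff_tsum (N := (⊤ : ℕ∞)) (v := fun j k => ‖c k‖ * (1 + eigenvalue k) ^ j)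
    (fun k => contDiff_const.mul (contDiff_mFourier k)) (fun j _ => hc.summable_weight j)
    (fun j k y _ => norm_iteratedFDeriv_mode_le k (c k) j y)

lemma isSmooth_series {c : (Fin d → ℤ) → ℂ} (hc : RapidDecay c) : IsSmooth (series c) :=
  Complex.reCLM.contDiff.comp (contDiff_complexSeries hc)

lemma norm_iteratedFDeriv_series_le {c : (Fin d → ℤ) → ℂ} (hc : RapidDecay c) (j : ℕ)
    (y : EuclideanSpace ℝ (Fin d)) :
    ‖iteratedFDeriv ℝ j (perLift (series c)) y‖ ≤ ∑' k, ‖c k‖ * (1 + eigenvalue k) ^ j := by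
  have e : perLift (series c)
      = Complex.reCLM ∘ (fun y => ∑' k, c k * mFourier k (toTorus d y)) := rfl
  rw [e, Complex.reCLM.iteratedFDeriv_comp_left
    ((contDiff_complexSeries hc).contDiffAt.of_le (by exact_mod_cast le_top)) le_rfl]
  refine (ContinuousLinearMap.norm_compContinuousMultilinearMap_le _ _).trans ?_
  rw [Complex.reCLM_norm, one_mul, iteratedFDeriv_tsum_apply (N := (⊤ : ℕ∞))
    (v := fun j k => ‖c k‖ * (1 + eigenvalue k) ^ j)
    (fun k => contDiff_const.mul (contDiff_mFourier k)) (fun j _ => hc.summable_weight j)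
    (fun j k y _ => norm_iteratedFDeriv_mode_le k (c k) j y) le_top]
  exact tsum_of_norm_bounded (hc.summable_weight j).hasSum
    fun k => norm_iteratedFDeriv_mode_le k (c k) j y

lemma mFourier_add_apply (k : Fin d → ℤ) (x y : Torus d) :
    mFourier k (x + y) = mFourier k x * mFourier k y := by
  simp [mFourier, fourier_apply, smul_add, AddCircle.toCircle_add, Finset.prod_mul_distrib]

lemma mFourier_shift (k : Fin d → ℤ) (x : Torus d) (i : Fin d) (s : ℝ) :
    mFourier k (x + toTorus d (EuclideanSpace.single i s))
      = mFourier k x * Complex.exp (derivSymbol i k * s) := by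
  rw [mFourier_add_apply, mFourier_toTorus, Finset.prod_eq_single i]
  · simp [derivSymbol]
  · intro j _ hj
    simp [hj]
  · simp

/-! ### Fourier coefficients of smooth functions -/

/-- The bridge between complex coefficients and the weak formulation, whose test functions are real.
-/
lemma fcoeff_eq_cos_sin {g : Torus d → ℝ} (hg : Integrable g (torusMeasure d)) (k : Fin d → ℤ) :
    fcoeff g k = ((∫ x, g x * cosMode k x ∂torusMeasure d : ℝ) : ℂ)
      - Complex.I * ((∫ x, g x * sinMode k x ∂torusMeasure d : ℝ) : ℂ) := by
  have hi := integrable_mul_mFourier hg (-k)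
  apply Complex.ext
  · have := integral_re hi
    simp only [RCLike.re_to_complex] at this
    rw [fcoeff, ← this]
    simp [cosMode, sinMode, mFourier_neg]
  · have := integral_im hi
    simp only [RCLike.im_to_complex] at this
    rw [fcoeff, ← this]
    simp [cosMode, sinMode, mFourier_neg, integral_neg]

lemma hasDerivAt_mode (k : Fin d → ℤ) (x : Torus d) (i : Fin d) :
    HasDerivAt (fun s : ℝ => mFourier k (x + toTorus d (EuclideanSpace.single i s)))
      (derivSymbol i k * mFourier k x) 0 := by
  simp_rw [mFourier_shift]
  have h1 : HasDerivAt (fun s : ℝ => derivSymbol i k * (s : ℂ)) (derivSymbol i k * 1) 0 :=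
    (Complex.ofRealCLM.hasDerivAt (x := (0 : ℝ))).const_mul _
  have h2 := h1.cexp.const_mul (mFourier k x)
  simp only [Complex.ofReal_zero, mul_zero, Complex.exp_zero, mul_one, one_mul] at h2
  rwa [mul_comm]

lemma partialDeriv_cosMode (k : Fin d → ℤ) (i : Fin d) (x : Torus d) :
    partialDeriv i (cosMode k) x = -(2 * Real.pi * k i) * sinMode k x := by
  have h := (Complex.reCLM.hasFDerivAt.comp_hasDerivAt (0 : ℝ) (hasDerivAt_mode k x i)).deriv
  refine Eq.trans h ?_
  simp [derivSymbol, sinMode]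

lemma partialDeriv_sinMode (k : Fin d → ℤ) (i : Fin d) (x : Torus d) :
    partialDeriv i (sinMode k) x = 2 * Real.pi * k i * cosMode k x := by
  have h := (Complex.imCLM.hasFDerivAt.comp_hasDerivAt (0 : ℝ) (hasDerivAt_mode k x i)).deriv
  refine Eq.trans h ?_
  simp [derivSymbol, cosMode]

lemma integral_partialDeriv_mul {φ ψ : Torus d → ℝ} (hφ : IsSmooth φ) (hψ : IsSmooth ψ)
    (i : Fin d) : ∫ x, partialDeriv i φ x * ψ x ∂torusMeasure d
      = -∫ x, φ x * partialDeriv i ψ x ∂torusMeasure d := by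
  have h3 := integral_partialDeriv (hφ.mul hψ) i
  simp_rw [partialDeriv_mul hφ hψ] at h3
  have h4 := integral_add
    (integrable_continuous ((hφ.partialDeriv i).continuous.mul hψ.continuous))
    (integrable_continuous (hφ.continuous.mul (hψ.partialDeriv i).continuous))
  simp only [Pi.mul_apply] at h4
  linarith

/-- The effect of a weak derivative on the Fourier coefficients. -/
lemma fcoeff_of_forall_mode {g h : Torus d → ℝ} (hg : Integrable g (torusMeasure d))
    (hh : Integrable h (torusMeasure d)) (i : Fin d)
    (H : ∀ φ : Torus d → ℝ, IsSmooth φ →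
      ∫ x, g x * partialDeriv i φ x ∂torusMeasure d = -∫ x, h x * φ x ∂torusMeasure d)
    (k : Fin d → ℤ) : fcoeff h k = derivSymbol i k * fcoeff g k := by
  have hc := H _ (isSmooth_cosMode k)
  have hs := H _ (isSmooth_sinMode k)
  simp_rw [partialDeriv_cosMode] at hc
  simp_rw [partialDeriv_sinMode] at hs
  have e1 : ∫ x, g x * (-(2 * Real.pi * k i) * sinMode k x) ∂torusMeasure d
      = -(2 * Real.pi * k i) * ∫ x, g x * sinMode k x ∂torusMeasure d := by
    rw [← integral_const_mul]; congr 1; funext x; ring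
  have e2 : ∫ x, g x * (2 * Real.pi * k i * cosMode k x) ∂torusMeasure d
      = (2 * Real.pi * k i) * ∫ x, g x * cosMode k x ∂torusMeasure d := by
    rw [← integral_const_mul]; congr 1; funext x; ring
  rw [e1] at hc
  rw [e2] at hs
  rw [fcoeff_eq_cos_sin hg, fcoeff_eq_cos_sin hh]
  have hc' : ∫ x, h x * cosMode k x ∂torusMeasure d
    = (2 * Real.pi * k i) * ∫ x, g x * sinMode k x ∂torusMeasure d := by linarith
  have hs' : ∫ x, h x * sinMode k x ∂torusMeasure d
    = -((2 * Real.pi * k i) * ∫ x, g x * cosMode k x ∂torusMeasure d) := by linarith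
  rw [hc', hs', derivSymbol]
  push_cast
  linear_combination (2 * Real.pi * (k i : ℂ) *
    ((∫ x, g x * sinMode k x ∂torusMeasure d : ℝ) : ℂ)) * Complex.I_sq

lemma fcoeff_partialDeriv {φ : Torus d → ℝ} (hφ : IsSmooth φ) (i : Fin d) (k : Fin d → ℤ) :
    fcoeff (partialDeriv i φ) k = derivSymbol i k * fcoeff φ k := by
  refine fcoeff_of_forall_mode (integrable_continuous hφ.continuous)
    (integrable_continuous (hφ.partialDeriv i).continuous) i (fun ψ hψ => ?_) k
  rw [integral_partialDeriv_mul hφ hψ, neg_neg]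

lemma IsSmooth.add {φ ψ : Torus d → ℝ} (hφ : IsSmooth φ) (hψ : IsSmooth ψ) :
    IsSmooth (fun x => φ x + ψ x) :=
  ContDiff.add hφ hψ

lemma IsSmooth.sub {φ ψ : Torus d → ℝ} (hφ : IsSmooth φ) (hψ : IsSmooth ψ) :
    IsSmooth (fun x => φ x - ψ x) :=
  ContDiff.sub hφ hψ

/-- The Laplacian of a function on the torus. -/
def laplacian (φ : Torus d → ℝ) (x : Torus d) : ℝ := ∑ i, partialDeriv i (partialDeriv i φ) x

lemma IsSmooth.laplacian {φ : Torus d → ℝ} (hφ : IsSmooth φ) :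
    IsSmooth (PeriodicRD.laplacian φ) :=
  ContDiff.sum (f := fun i => perLift (PeriodicRD.partialDeriv i (PeriodicRD.partialDeriv i φ)))
    (s := Finset.univ) fun i _ => (hφ.partialDeriv i).partialDeriv i

lemma fcoeff_laplacian {φ : Torus d → ℝ} (hφ : IsSmooth φ) (k : Fin d → ℤ) :
    fcoeff (laplacian φ) k = -(eigenvalue k : ℂ) * fcoeff φ k := by
  have h : fcoeff (laplacian φ) k = ∑ i, fcoeff (partialDeriv i (partialDeriv i φ)) k := by
    unfold fcoeff
    rw [← integral_finsetSum _ fun i _ => integrable_mul_mFourier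
      (integrable_continuous ((hφ.partialDeriv i).partialDeriv i).continuous) _]
    congr 1
    funext x
    rw [laplacian]
    push_cast
    rw [Finset.sum_mul]
  rw [h, ← sum_derivSymbol_sq, Finset.sum_mul]
  refine Finset.sum_congr rfl fun i _ => ?_
  rw [fcoeff_partialDeriv (hφ.partialDeriv i), fcoeff_partialDeriv hφ]
  ring

/-- Passing from φ to φ - Δφ multiplies the k-th coefficient by exactly 1 + λ_k, so each power of
the weight costs one application of 1 - Δ to a function that stays smooth, hence bounded. -/
lemma rapidDecay_fcoeff {φ : Torus d → ℝ} (hφ : IsSmooth φ) : RapidDecay (fcoeff φ) := by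
  intro N
  induction N generalizing φ with
  | zero =>
    obtain ⟨K, hK⟩ := (isCompact_range hφ.continuous).isBounded.exists_norm_le
    exact ⟨K, fun k => by simpa using norm_fcoeff_le (fun x => hK _ (mem_range_self x)) k⟩
  | succ N ih =>
    obtain ⟨K, hK⟩ := ih (hφ.sub hφ.laplacian)
    refine ⟨K, fun k => le_of_eq_of_le ?_ (hK k)⟩
    rw [fcoeff_sub (integrable_continuous hφ.continuous)
      (integrable_continuous hφ.laplacian.continuous), fcoeff_laplacian hφ]
    have : fcoeff φ k - -(eigenvalue k : ℂ) * fcoeff φ k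
        = ((1 + eigenvalue k : ℝ) : ℂ) * fcoeff φ k := by push_cast; ring
    rw [this, norm_mul, Complex.norm_real, Real.norm_of_nonneg (weight_pos k).le, pow_succ]
    ring

lemma series_fcoeff {φ : Torus d → ℝ} (hφ : IsSmooth φ) : series (fcoeff φ) = φ := by
  funext x
  let f : C(Torus d, ℂ) := ⟨fun x => (φ x : ℂ), Complex.continuous_ofReal.comp hφ.continuous⟩
  have e : ∀ k, mFourierCoeff f k = fcoeff φ k := fun k => by
    refine integral_congr_ae (μ := torusMeasure d) (ae_of_all _ fun x => ?_)
    simp [f, mul_comm]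
  have h := hasSum_mFourier_series_apply_of_summable (f := f)
    (by rw [show mFourierCoeff f = fcoeff φ from funext e]
        exact (rapidDecay_fcoeff hφ).summable_norm.of_norm) x
  simp only [e, smul_eq_mul] at h
  rw [series, h.tsum_eq]
  simp [f]

lemma integral_mFourier (k : Fin d → ℤ) :
    ∫ x, mFourier k x ∂torusMeasure d = if k = 0 then 1 else 0 := by
  have h := (orthonormal_iff_ite.1 (orthonormal_mFourier (d := Fin d))) 0 k
  rw [ContinuousMap.inner_toLp] at h
  simp only [eq_comm (a := (0 : Fin d → ℤ))] at h
  rw [← h]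
  refine integral_congr_ae (μ := torusMeasure d) (ae_of_all _ fun x => ?_)
  simp [mFourier_zero]

/-- Termwise integration and orthonormality of the modes. The Hermitian hypothesis is needed because
`series` is a real part. -/
lemma fcoeff_series {c : (Fin d → ℤ) → ℂ} (hc : Summable fun k => ‖c k‖) (h : Hermitian c) :
    fcoeff (series c) = c := by
  funext k
  have h1 := hasSum_integral_of_summable_integral_norm (μ := torusMeasure d)
    (F := fun l x => c l * mFourier l x * mFourier (-k) x)
    (fun l => ((integrable_const (c l)).mul_bdd (c := 1)
      (mFourier l).continuous.aestronglyMeasurable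
      (ae_of_all _ fun x => (norm_mFourier_apply l x).le)).mul_bdd (c := 1)
      (mFourier (-k)).continuous.aestronglyMeasurable
      (ae_of_all _ fun x => (norm_mFourier_apply _ x).le))
    (by simpa [norm_mFourier_apply] using hc)
  have h2 : ∀ l, ∫ x, c l * mFourier l x * mFourier (-k) x ∂torusMeasure d
      = if l = k then c k else 0 := by
    intro l
    have : ∀ x : Torus d, c l * mFourier l x * mFourier (-k) x = c l * mFourier (l - k) x := by
      intro x
      rw [mul_assoc, ← mFourier_add, sub_eq_add_neg]
    simp_rw [this]
    rw [integral_const_mul, integral_mFourier]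
    by_cases hl : l = k
    · simp [hl]
    · simp [hl, sub_eq_zero]
  simp_rw [h2] at h1
  have h3 := h1.unique (hasSum_ite_eq k (c k))
  rw [← h3]
  unfold fcoeff
  congr 1
  funext x
  rw [h.ofReal_series, tsum_mul_right]

/-! ### The square of the Sobolev norm -/

/-- The square of the `H^s` norm. -/
def sobolevSq (s : ℝ) (c : (Fin d → ℤ) → ℂ) : ℝ≥0∞ :=
  ∑' k, ENNReal.ofReal ((1 + eigenvalue k) ^ s) * ‖c k‖ₑ ^ 2

lemma sobolevNorm_sq (s : ℝ) (c : (Fin d → ℤ) → ℂ) : sobolevNorm s c ^ 2 = sobolevSq s c := by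
  rw [sobolevNorm, ← ENNReal.rpow_natCast, ← ENNReal.rpow_mul]
  norm_num
  rfl

lemma sobolevNorm_eq (s : ℝ) (c : (Fin d → ℤ) → ℂ) :
    sobolevNorm s c = sobolevSq s c ^ (1 / 2 : ℝ) := rfl

lemma sobolevSq_mono_exponent {s t : ℝ} (h : s ≤ t) (c : (Fin d → ℤ) → ℂ) :
    sobolevSq s c ≤ sobolevSq t c := by
  refine ENNReal.tsum_le_tsum fun k => ?_
  gcongr
  exact one_le_weight k

lemma sobolevSq_mono {c e : (Fin d → ℤ) → ℂ} (s : ℝ) (h : ∀ k, ‖c k‖ ≤ ‖e k‖) :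
    sobolevSq s c ≤ sobolevSq s e := by
  refine ENNReal.tsum_le_tsum fun k => ?_
  gcongr
  exact enorm_le_iff_norm_le.2 (h k)

lemma enorm_add_sq_le (a b : ℂ) : ‖a + b‖ₑ ^ 2 ≤ 2 * ‖a‖ₑ ^ 2 + 2 * ‖b‖ₑ ^ 2 := by
  simp only [← ofReal_norm]
  rw [← ENNReal.ofReal_pow (norm_nonneg _), ← ENNReal.ofReal_pow (norm_nonneg _),
    ← ENNReal.ofReal_pow (norm_nonneg _), show (2 : ℝ≥0∞) = ENNReal.ofReal 2 by simp,
    ← ENNReal.ofReal_mul (by norm_num), ← ENNReal.ofReal_mul (by norm_num),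
    ← ENNReal.ofReal_add (by positivity) (by positivity)]
  refine ENNReal.ofReal_le_ofReal ?_
  nlinarith [norm_add_le a b, norm_nonneg (a + b), sq_nonneg (‖a‖ - ‖b‖), norm_nonneg a,
    norm_nonneg b]

lemma sobolevSq_add_le (s : ℝ) (c e : (Fin d → ℤ) → ℂ) :
    sobolevSq s (fun k => c k + e k) ≤ 2 * sobolevSq s c + 2 * sobolevSq s e := by
  unfold sobolevSq
  rw [← ENNReal.tsum_mul_left, ← ENNReal.tsum_mul_left, ← ENNReal.tsum_add]
  refine ENNReal.tsum_le_tsum fun k => ?_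
  calc _ ≤ ENNReal.ofReal ((1 + eigenvalue k) ^ s) * (2 * ‖c k‖ₑ ^ 2 + 2 * ‖e k‖ₑ ^ 2) := by
        gcongr; exact enorm_add_sq_le _ _
    _ = _ := by ring

/-- Exact, because 1 + λ_k = 1 + ∑_i |2πk_i|². It allows induction on the order by differentiating
once. -/
lemma sobolevSq_add_one (s : ℝ) (c : (Fin d → ℤ) → ℂ) :
    sobolevSq (s + 1) c = sobolevSq s c + ∑ i, sobolevSq s (fun k => derivSymbol i k * c k) := by
  unfold sobolevSq
  rw [← Summable.tsum_finsetSum fun i _ => ENNReal.summable, ← ENNReal.tsum_add]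
  refine tsum_congr fun k => ?_
  have h1 : ∀ i, ENNReal.ofReal ((1 + eigenvalue k) ^ s) * ‖derivSymbol i k * c k‖ₑ ^ 2
      = ENNReal.ofReal (‖derivSymbol i k‖ ^ 2) *
        (ENNReal.ofReal ((1 + eigenvalue k) ^ s) * ‖c k‖ₑ ^ 2) := by
    intro i
    rw [enorm_mul, mul_pow, ENNReal.ofReal_pow (norm_nonneg _), ofReal_norm]
    ring
  simp_rw [h1]
  rw [← Finset.sum_mul, ← ENNReal.ofReal_sum_of_nonneg fun i _ => sq_nonneg _,
    sum_norm_derivSymbol_sq, Real.rpow_add (weight_pos k), Real.rpow_one, mul_add, mul_one,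
    ENNReal.ofReal_add (by have := weight_pos k; positivity)
      (mul_nonneg (Real.rpow_nonneg (weight_pos k).le _) (eigenvalue_nonneg k)),
    ENNReal.ofReal_mul (Real.rpow_nonneg (weight_pos k).le _)]
  ring

lemma sobolevSq_derivSymbol_le (s : ℝ) (c : (Fin d → ℤ) → ℂ) (i : Fin d) :
    sobolevSq s (fun k => derivSymbol i k * c k) ≤ sobolevSq (s + 1) c := by
  rw [sobolevSq_add_one]
  exact le_add_left (Finset.single_le_sum
    (f := fun i => sobolevSq s (fun k => derivSymbol i k * c k)) (fun _ _ => zero_le)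
    (Finset.mem_univ i))

/-- Lower semicontinuity: every finite partial sum passes to the limit. This transfers estimates
from smooth approximations to L² functions. -/
lemma sobolevSq_le_of_tendsto {ι : Type*} {l : Filter ι} [l.NeBot] {c : ι → (Fin d → ℤ) → ℂ}
    {e : (Fin d → ℤ) → ℂ} {s : ℝ} {K : ℝ≥0∞} (h : ∀ k, Tendsto (fun n => c n k) l (𝓝 (e k)))
    (hK : ∀ᶠ n in l, sobolevSq s (c n) ≤ K) : sobolevSq s e ≤ K := by
  unfold sobolevSq
  rw [ENNReal.tsum_eq_iSup_sum]
  refine iSup_le fun A => ?_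
  have ht : Tendsto (fun n => ∑ k ∈ A, ENNReal.ofReal ((1 + eigenvalue k) ^ s) * ‖c n k‖ₑ ^ 2) l
      (𝓝 (∑ k ∈ A, ENNReal.ofReal ((1 + eigenvalue k) ^ s) * ‖e k‖ₑ ^ 2)) := by
    refine tendsto_finsetSum _ fun k _ => ?_
    exact ENNReal.Tendsto.const_mul (((ENNReal.continuous_pow 2).tendsto _).comp
      ((continuous_enorm.tendsto _).comp (h k))) (Or.inr ENNReal.ofReal_ne_top)
  refine le_of_tendsto ht ?_
  filter_upwards [hK] with n hn
  exact (ENNReal.sum_le_tsum A).trans hn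

lemma sobolevSq_zero {φ : Torus d → ℝ} (hφ : MemLp φ 2 (torusMeasure d)) :
    sobolevSq 0 (fcoeff φ) = ENNReal.ofReal (∫ x, φ x ^ 2 ∂torusMeasure d) := by
  have h := hasSum_norm_fcoeff_sq hφ
  rw [← h.tsum_eq, ENNReal.ofReal_tsum_of_nonneg (fun k => sq_nonneg _) h.summable]
  refine tsum_congr fun k => ?_
  rw [Real.rpow_zero, ENNReal.ofReal_one, one_mul, ENNReal.ofReal_pow (norm_nonneg _), ofReal_norm]

lemma sobolevSq_zero_mul_le {φ ψ : Torus d → ℝ} {K : ℝ} (hφ : MemLp φ 2 (torusMeasure d))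
    (hψ : AEStronglyMeasurable ψ (torusMeasure d)) (hK : ∀ x, |ψ x| ≤ K) :
    sobolevSq 0 (fcoeff fun x => ψ x * φ x)
      ≤ ENNReal.ofReal (K ^ 2) * sobolevSq 0 (fcoeff φ) := by
  have h1 : MemLp (fun x => ψ x * φ x) 2 (torusMeasure d) := by
    refine MemLp.of_le_mul (c := K) hφ (hψ.mul hφ.1) (ae_of_all _ fun x => ?_)
    rw [norm_mul]
    gcongr
    exact hK x
  rw [sobolevSq_zero hφ, sobolevSq_zero h1, ← ENNReal.ofReal_mul (sq_nonneg _),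
    ← integral_const_mul]
  refine ENNReal.ofReal_le_ofReal (integral_mono h1.integrable_sq (hφ.integrable_sq.const_mul _) ?_)
  intro x
  simp only [mul_pow]
  have := sq_le_sq' (neg_le_of_abs_le (hK x)) (le_of_abs_le (hK x))
  gcongr

lemma sobolevSq_zero_le {ψ : Torus d → ℝ} {K : ℝ}
    (hψ : AEStronglyMeasurable ψ (torusMeasure d)) (hK : ∀ x, |ψ x| ≤ K) :
    sobolevSq 0 (fcoeff ψ) ≤ ENNReal.ofReal (K ^ 2) := by
  have h := sobolevSq_zero_mul_le (φ := fun _ => 1) (memLp_const 1) hψ hK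
  rw [sobolevSq_zero (memLp_const 1)] at h
  simpa using h

/-! ### Product estimates -/

/-- Cauchy-Schwarz with values in [0,∞], as Hölder's inequality for counting measure; no summability
has to be checked. -/
lemma sq_tsum_mul_le {ι : Type*} (x y : ι → ℝ≥0∞) :
    (∑' l, x l * y l) ^ 2 ≤ (∑' l, x l ^ 2) * ∑' l, y l ^ 2 := by
  let _ : MeasurableSpace ι := ⊤
  have h := ENNReal.lintegral_mul_le_Lp_mul_Lq Measure.count (p := 2) (q := 2)
    (by constructor <;> norm_num) (f := x) (g := y) measurable_from_top.aemeasurable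
    measurable_from_top.aemeasurable
  simp only [lintegral_count, Pi.mul_apply] at h
  calc _ ≤ _ := pow_le_pow_left' h 2
    _ = _ := by
      rw [mul_pow, ← ENNReal.rpow_natCast, ← ENNReal.rpow_natCast, ← ENNReal.rpow_mul,
        ← ENNReal.rpow_mul]
      norm_num

/-- A product estimate in Sobolev spaces, by the Cauchy-Schwarz inequality. -/
lemma sobolevSq_conv_le {a b c : (Fin d → ℤ) → ℂ} (s t : ℝ) (C : ℝ≥0∞)
    (hc : ∀ k, HasSum (fun l => a l * b (k - l)) (c k))
    (hC : ∀ k : Fin d → ℤ, ∑' l : Fin d → ℤ, ENNReal.ofReal ((1 + eigenvalue k) ^ t *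
      ((1 + eigenvalue l) ^ (-s) * (1 + eigenvalue (k - l)) ^ (-s))) ≤ C) :
    sobolevSq t c ≤ C * (sobolevSq s a * sobolevSq s b) := by
  have hpos : ∀ (k : Fin d → ℤ) (r : ℝ), 0 < (1 + eigenvalue k) ^ r :=
    fun k r => Real.rpow_pos_of_pos (weight_pos k) r
  -- Inserting w·v = 1 at l and at k-l puts the weights (1+λ)^s on the coefficients and leaves
  -- (1+λ)^{-s} for the kernel sum bounded by C.
  set w : (Fin d → ℤ) → ℝ≥0∞ := fun l => ENNReal.ofReal ((1 + eigenvalue l) ^ (s / 2)) with hw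
  set v : (Fin d → ℤ) → ℝ≥0∞ := fun l => ENNReal.ofReal ((1 + eigenvalue l) ^ (-(s / 2))) with hv
  have hwv : ∀ l, w l * v l = 1 := fun l => by
    rw [hw, hv, ← ENNReal.ofReal_mul (hpos _ _).le, ← Real.rpow_add (weight_pos l)]
    simp
  have hw2 : ∀ l, w l ^ 2 = ENNReal.ofReal ((1 + eigenvalue l) ^ s) := fun l => by
    rw [hw, ← ENNReal.ofReal_pow (hpos _ _).le, ← Real.rpow_natCast,
      ← Real.rpow_mul (weight_pos l).le]
    norm_num
  have hv2 : ∀ l, v l ^ 2 = ENNReal.ofReal ((1 + eigenvalue l) ^ (-s)) := fun l => by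
    rw [hv, ← ENNReal.ofReal_pow (hpos _ _).le, ← Real.rpow_natCast,
      ← Real.rpow_mul (weight_pos l).le]
    norm_num
  have key : ∀ k, ENNReal.ofReal ((1 + eigenvalue k) ^ t) * ‖c k‖ₑ ^ 2
      ≤ C * ∑' l, (w l ^ 2 * ‖a l‖ₑ ^ 2) * (w (k - l) ^ 2 * ‖b (k - l)‖ₑ ^ 2) := by
    intro k
    have h1 : ‖c k‖ₑ ≤ ∑' l, (w l * ‖a l‖ₑ * (w (k - l) * ‖b (k - l)‖ₑ)) * (v l * v (k - l)) := by
      rw [← (hc k).tsum_eq]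
      refine (enorm_tsum_le_tsum_enorm).trans (ENNReal.tsum_le_tsum fun l => ?_)
      rw [enorm_mul]
      calc ‖a l‖ₑ * ‖b (k - l)‖ₑ
          = (w l * v l) * (w (k - l) * v (k - l)) * (‖a l‖ₑ * ‖b (k - l)‖ₑ) := by
            rw [hwv, hwv]; simp
        _ ≤ _ := by apply le_of_eq; ring
    have h2 := (pow_le_pow_left' h1 2).trans (sq_tsum_mul_le _ _)
    have h3 : ENNReal.ofReal ((1 + eigenvalue k) ^ t) * ∑' l, (v l * v (k - l)) ^ 2 ≤ C := by
      rw [← ENNReal.tsum_mul_left]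
      refine le_trans (le_of_eq (tsum_congr fun l => ?_)) (hC k)
      rw [mul_pow, hv2, hv2, ← ENNReal.ofReal_mul (hpos _ _).le, ← ENNReal.ofReal_mul (hpos _ _).le]
    calc _ ≤ ENNReal.ofReal ((1 + eigenvalue k) ^ t) *
          ((∑' l, (w l * ‖a l‖ₑ * (w (k - l) * ‖b (k - l)‖ₑ)) ^ 2) *
            ∑' l, (v l * v (k - l)) ^ 2) := by gcongr
      _ = (ENNReal.ofReal ((1 + eigenvalue k) ^ t) * ∑' l, (v l * v (k - l)) ^ 2) *
          (∑' l, (w l * ‖a l‖ₑ * (w (k - l) * ‖b (k - l)‖ₑ)) ^ 2) := by ring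
      _ ≤ C * (∑' l, (w l * ‖a l‖ₑ * (w (k - l) * ‖b (k - l)‖ₑ)) ^ 2) := by gcongr
      _ = _ := by congr 1; refine tsum_congr fun l => ?_; ring
  calc sobolevSq t c ≤ ∑' k, C * ∑' l, (w l ^ 2 * ‖a l‖ₑ ^ 2) * (w (k - l) ^ 2 * ‖b (k - l)‖ₑ ^ 2) :=
        ENNReal.tsum_le_tsum key
    _ = C * ∑' l, ∑' k, (w l ^ 2 * ‖a l‖ₑ ^ 2) * (w (k - l) ^ 2 * ‖b (k - l)‖ₑ ^ 2) := by
        rw [ENNReal.tsum_mul_left, ENNReal.tsum_comm]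
    _ = C * ∑' l, (w l ^ 2 * ‖a l‖ₑ ^ 2) * sobolevSq s b := by
        congr 1
        refine tsum_congr fun l => ?_
        rw [ENNReal.tsum_mul_left]
        congr 1
        -- For fixed l the shift k ↦ k-l decouples the double sum into a product.
        refine ((Equiv.subRight l).tsum_eq (fun k => w k ^ 2 * ‖b k‖ₑ ^ 2)).trans ?_
        simp only [hw2, sobolevSq]
    _ = _ := by
        rw [ENNReal.tsum_mul_right]
        simp only [hw2, sobolevSq]

/-- The sum `∑_k (1 + λ_k)^{-2}`, which is finite in dimension at most `3`. -/
def weightSum (d : ℕ) : ℝ≥0∞ := ∑' k : Fin d → ℤ, ENNReal.ofReal (((1 + eigenvalue k) ^ 2)⁻¹)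

lemma weightSum_lt_top (hd : d ≤ 3) : weightSum d < ⊤ := by
  have h := summable_weight_inv (d := d) (N := 2) (by omega)
  rw [weightSum, ← ENNReal.ofReal_tsum_of_nonneg (fun k => by positivity) h]
  exact ENNReal.ofReal_lt_top

lemma tsum_sub_weight (k : Fin d → ℤ) :
    ∑' l, ENNReal.ofReal (((1 + eigenvalue (k - l)) ^ 2)⁻¹) = weightSum d :=
  (Equiv.subLeft k).tsum_eq fun l => ENNReal.ofReal (((1 + eigenvalue l) ^ 2)⁻¹)

/-- The product H¹·H¹ ⊂ L². The kernel satisfies xy ≤ x² + y², and both resulting sums equal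
`weightSum d` by translation. The bound has content only when that sum is finite, as for d ≤ 3. -/
lemma sobolevSq_conv_one_zero {a b c : (Fin d → ℤ) → ℂ}
    (hc : ∀ k, HasSum (fun l => a l * b (k - l)) (c k)) :
    sobolevSq 0 c ≤ (weightSum d + weightSum d) * (sobolevSq 1 a * sobolevSq 1 b) := by
  refine sobolevSq_conv_le 1 0 _ hc fun k => ?_
  nth_rewrite 2 [← tsum_sub_weight k]
  rw [weightSum, ← ENNReal.tsum_add]
  refine ENNReal.tsum_le_tsum fun l => ?_
  have h1 := weight_pos l
  have h2 := weight_pos (k - l)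
  rw [← ENNReal.ofReal_add (by positivity) (by positivity)]
  refine ENNReal.ofReal_le_ofReal ?_
  rw [Real.rpow_zero, one_mul, Real.rpow_neg_one, Real.rpow_neg_one, ← inv_pow, ← inv_pow]
  nlinarith [sq_nonneg ((1 + eigenvalue l)⁻¹ - (1 + eigenvalue (k - l))⁻¹),
    sq_nonneg ((1 + eigenvalue l)⁻¹), sq_nonneg ((1 + eigenvalue (k - l))⁻¹)]

/-- An output frequency k is controlled by one of the two input frequencies, by |x+y|² ≤ 2|x|² +
2|y|². -/
lemma weight_le (k l : Fin d → ℤ) :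
    1 + eigenvalue k ≤ 2 * ((1 + eigenvalue l) + (1 + eigenvalue (k - l))) := by
  have : eigenvalue k ≤ 2 * eigenvalue l + 2 * eigenvalue (k - l) := by
    simp only [eigenvalue_eq_sum, Finset.mul_sum]
    rw [← Finset.sum_add_distrib]
    refine Finset.sum_le_sum fun i _ => ?_
    simp only [Pi.sub_apply, Int.cast_sub]
    nlinarith [sq_nonneg (2 * Real.pi * (l i : ℝ) - 2 * Real.pi * ((k i : ℝ) - l i))]
  linarith

/-- `H^n` is an algebra if `n ≥ 2` (in dimension at most `3`). -/
lemma sobolevSq_conv_algebra {a b c : (Fin d → ℤ) → ℂ} (n : ℕ) (hn : 2 ≤ n)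
    (hc : ∀ k, HasSum (fun l => a l * b (k - l)) (c k)) :
    sobolevSq n c ≤ ENNReal.ofReal (4 ^ n) * (weightSum d + weightSum d) *
      (sobolevSq n a * sobolevSq n b) := by
  refine sobolevSq_conv_le n n _ hc fun k => ?_
  nth_rewrite 2 [← tsum_sub_weight k]
  rw [weightSum, ← ENNReal.tsum_add, ← ENNReal.tsum_mul_left]
  refine ENNReal.tsum_le_tsum fun l => ?_
  have h1 := weight_pos l
  have h2 := weight_pos (k - l)
  have h3 := weight_pos k
  rw [← ENNReal.ofReal_add (by positivity) (by positivity), ← ENNReal.ofReal_mul (by positivity)]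
  refine ENNReal.ofReal_le_ofReal ?_
  rw [Real.rpow_neg h1.le, Real.rpow_neg h2.le]
  simp only [Real.rpow_natCast]
  -- The weight at k is distributed over l and k-l. Each part cancels one of the two inverse
  -- weights, and the surviving inverse n-th power is summable because n ≥ 2.
  have h4 : (1 + eigenvalue k) ^ n ≤ 4 ^ n * ((1 + eigenvalue l) ^ n + (1 + eigenvalue (k - l)) ^ n) := by
    calc (1 + eigenvalue k) ^ n ≤ (2 * ((1 + eigenvalue l) + (1 + eigenvalue (k - l)))) ^ n :=
          pow_le_pow_left₀ h3.le (weight_le k l) n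
      _ = 2 ^ n * ((1 + eigenvalue l) + (1 + eigenvalue (k - l))) ^ n := by rw [mul_pow]
      _ ≤ 2 ^ n * (2 ^ (n - 1) * ((1 + eigenvalue l) ^ n + (1 + eigenvalue (k - l)) ^ n)) := by
          gcongr
          exact add_pow_le h1.le h2.le n
      _ ≤ 2 ^ n * (2 ^ n * ((1 + eigenvalue l) ^ n + (1 + eigenvalue (k - l)) ^ n)) := by
          gcongr
          · norm_num
          · omega
      _ = _ := by rw [← mul_assoc, ← mul_pow]; norm_num
  have h5 : ∀ j : Fin d → ℤ, ((1 + eigenvalue j) ^ n)⁻¹ ≤ ((1 + eigenvalue j) ^ 2)⁻¹ := fun j => by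
    have := weight_pos j
    gcongr
    exact one_le_weight j
  calc (1 + eigenvalue k) ^ n * (((1 + eigenvalue l) ^ n)⁻¹ * ((1 + eigenvalue (k - l)) ^ n)⁻¹)
      ≤ 4 ^ n * ((1 + eigenvalue l) ^ n + (1 + eigenvalue (k - l)) ^ n) *
        (((1 + eigenvalue l) ^ n)⁻¹ * ((1 + eigenvalue (k - l)) ^ n)⁻¹) := by gcongr
    _ = 4 ^ n * (((1 + eigenvalue l) ^ n)⁻¹ + ((1 + eigenvalue (k - l)) ^ n)⁻¹) := by
        field_simp
        ring
    _ ≤ _ := by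
        exact mul_le_mul_of_nonneg_left (add_le_add (h5 l) (h5 (k - l))) (by positivity)

/-! ### Composition with smooth functions -/

lemma IsSmooth.comp {f : ℝ → ℝ} (hf : ContDiff ℝ ∞ f) {φ : Torus d → ℝ} (hφ : IsSmooth φ) :
    IsSmooth (fun x => f (φ x)) :=
  ContDiff.comp hf hφ

lemma partialDeriv_comp {f : ℝ → ℝ} (hf : ContDiff ℝ ∞ f) {φ : Torus d → ℝ} (hφ : IsSmooth φ)
    (i : Fin d) :
    partialDeriv i (fun x => f (φ x)) = fun x => deriv f (φ x) * partialDeriv i φ x := by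
  funext x
  have h0 : toTorus d (EuclideanSpace.single i (0 : ℝ)) = 0 := by
    funext j; simp [toTorus]
  have h1 := hφ.hasDerivAt i x 0
  have h2 := ((hf.differentiable (by simp)) (φ (x + toTorus d (EuclideanSpace.single i (0 : ℝ))))).hasDerivAt
  have h3 := (h2.comp (0 : ℝ) h1).deriv
  simp only [h0, add_zero] at h3
  exact h3

lemma contDiff_deriv_infty {f : ℝ → ℝ} (hf : ContDiff ℝ ∞ f) : ContDiff ℝ ∞ (deriv f) :=
  ((contDiff_infty_iff_deriv).1 hf).2

lemma exists_bound_of_hasCompactSupport {f : ℝ → ℝ} (hf : ContDiff ℝ ∞ f)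
    (hfc : HasCompactSupport f) : ∃ M : ℝ, ∀ x, |f x| ≤ M :=
  hfc.exists_bound_of_continuous hf.continuous

lemma memLp_smooth {φ : Torus d → ℝ} (hφ : IsSmooth φ) : MemLp φ 2 (torusMeasure d) :=
  memLp_continuous hφ.continuous

lemma fcoeff_partialDeriv_funext {φ : Torus d → ℝ} (hφ : IsSmooth φ) (i : Fin d) :
    fcoeff (partialDeriv i φ) = fun k => derivSymbol i k * fcoeff φ k :=
  funext (fcoeff_partialDeriv hφ i)

lemma sobolevSq_smooth_add_one (s : ℝ) {φ : Torus d → ℝ} (hφ : IsSmooth φ) :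
    sobolevSq (s + 1) (fcoeff φ)
      = sobolevSq s (fcoeff φ) + ∑ i, sobolevSq s (fcoeff (partialDeriv i φ)) := by
  simp_rw [sobolevSq_add_one, fcoeff_partialDeriv_funext hφ]

lemma sobolevSq_partialDeriv_le (s : ℝ) {φ : Torus d → ℝ} (hφ : IsSmooth φ) (i : Fin d) :
    sobolevSq s (fcoeff (partialDeriv i φ)) ≤ sobolevSq (s + 1) (fcoeff φ) := by
  rw [fcoeff_partialDeriv_funext hφ]
  exact sobolevSq_derivSymbol_le s _ i

/-- The second order chain rule estimate in dimension at most `3`. -/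
lemma sobolevSq_one_chain (hd : d ≤ 3) {f : ℝ → ℝ} (hf : ContDiff ℝ ∞ f)
    (hfc : HasCompactSupport f) {K : ℝ≥0∞} (hK : K < ⊤) :
    ∃ K' < ⊤, ∀ φ : Torus d → ℝ, IsSmooth φ → sobolevSq 2 (fcoeff φ) ≤ K → ∀ i,
      sobolevSq 1 (fcoeff fun x => f (φ x) * partialDeriv i φ x) ≤ K' := by
  obtain ⟨M, hM⟩ := exists_bound_of_hasCompactSupport hf hfc
  obtain ⟨M', hM'⟩ := exists_bound_of_hasCompactSupport (contDiff_deriv_infty hf) hfc.deriv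
  set S := weightSum d with hS
  have hSt : S < ⊤ := weightSum_lt_top hd
  refine ⟨ENNReal.ofReal (M ^ 2) * K + ∑ j : Fin d,
    (2 * (ENNReal.ofReal (M' ^ 2) * ((S + S) * (K * K))) + 2 * (ENNReal.ofReal (M ^ 2) * K)), ?_,
    fun φ hφ hφK i => ?_⟩
  · simp only [Finset.sum_const, nsmul_eq_mul]
    have h1 : (2 : ℝ≥0∞) < ⊤ := by simp
    have h2 : ((Finset.univ : Finset (Fin d)).card : ℝ≥0∞) < ⊤ := by simp
    have h3 := ENNReal.add_lt_top.2 ⟨hSt, hSt⟩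
    have h4 : ENNReal.ofReal (M ^ 2) * K < ⊤ := ENNReal.mul_lt_top ENNReal.ofReal_lt_top hK
    exact ENNReal.add_lt_top.2 ⟨h4, ENNReal.mul_lt_top h2 (ENNReal.add_lt_top.2
      ⟨ENNReal.mul_lt_top h1 (ENNReal.mul_lt_top ENNReal.ofReal_lt_top
        (ENNReal.mul_lt_top h3 (ENNReal.mul_lt_top hK hK))), ENNReal.mul_lt_top h1 h4⟩)⟩
  · have hfφ := hφ.comp hf
    have hf'φ := hφ.comp (contDiff_deriv_infty hf)
    have hd1 : ∀ j, sobolevSq 1 (fcoeff (partialDeriv j φ)) ≤ K := fun j => by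
      refine (sobolevSq_partialDeriv_le 1 hφ j).trans ?_
      norm_num
      exact hφK
    have h0 : sobolevSq 0 (fcoeff (partialDeriv i φ)) ≤ K :=
      (sobolevSq_mono_exponent (by norm_num) _).trans (hd1 i)
    have hd2 : ∀ j, sobolevSq 0 (fcoeff (partialDeriv j (partialDeriv i φ))) ≤ K := fun j => by
      refine (sobolevSq_partialDeriv_le 0 (hφ.partialDeriv i) j).trans ?_
      rw [zero_add]
      exact hd1 i
    have h1 := sobolevSq_smooth_add_one 0 (hfφ.mul (hφ.partialDeriv i))
    rw [zero_add] at h1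
    rw [h1]
    gcongr with j
    · refine (sobolevSq_zero_mul_le (memLp_smooth (hφ.partialDeriv i))
        hfφ.continuous.aestronglyMeasurable (fun x => hM _)).trans ?_
      gcongr
    · have e : partialDeriv j (fun x => f (φ x) * partialDeriv i φ x)
          = fun x => deriv f (φ x) * (partialDeriv j φ x * partialDeriv i φ x)
            + f (φ x) * partialDeriv j (partialDeriv i φ) x := by
        funext x
        rw [partialDeriv_mul hfφ (hφ.partialDeriv i), partialDeriv_comp hf hφ]
        ring
      have hp := (hφ.partialDeriv j).mul (hφ.partialDeriv i)
      have e2 : fcoeff (fun x => deriv f (φ x) * (partialDeriv j φ x * partialDeriv i φ x)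
            + f (φ x) * partialDeriv j (partialDeriv i φ) x)
          = fun k => fcoeff (fun x => deriv f (φ x) * (partialDeriv j φ x * partialDeriv i φ x)) k
            + fcoeff (fun x => f (φ x) * partialDeriv j (partialDeriv i φ) x) k := by
        funext k
        exact fcoeff_add (integrable_continuous (hf'φ.mul hp).continuous)
          (integrable_continuous (hfφ.mul ((hφ.partialDeriv i).partialDeriv j)).continuous) k
      rw [e, e2]
      refine (sobolevSq_add_le _ _ _).trans ?_
      gcongr
      · refine (sobolevSq_zero_mul_le (memLp_smooth hp)
          hf'φ.continuous.aestronglyMeasurable (fun x => hM' _)).trans ?_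
        gcongr
        refine (sobolevSq_conv_one_zero (hasSum_fcoeff_mul (memLp_smooth (hφ.partialDeriv j))
          (memLp_smooth (hφ.partialDeriv i)))).trans ?_
        gcongr
        · exact hd1 j
        · exact hd1 i
      · refine (sobolevSq_zero_mul_le (memLp_smooth ((hφ.partialDeriv i).partialDeriv j))
          hfφ.continuous.aestronglyMeasurable (fun x => hM _)).trans ?_
        gcongr
        exact hd2 j

/-- Composition with a smooth compactly supported function is bounded in `H^n`. -/
theorem sobolevSq_comp_smooth (n : ℕ) (hn : 2 ≤ n → d ≤ 3) : ∀ {f : ℝ → ℝ}, ContDiff ℝ ∞ f →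
    HasCompactSupport f → ∀ {K : ℝ≥0∞}, K < ⊤ → ∃ K' < ⊤, ∀ φ : Torus d → ℝ, IsSmooth φ →
      sobolevSq n (fcoeff φ) ≤ K → sobolevSq n (fcoeff fun x => f (φ x)) ≤ K' := by
  induction n with
  | zero =>
    intro f hf hfc K hK
    obtain ⟨M, hM⟩ := exists_bound_of_hasCompactSupport hf hfc
    refine ⟨ENNReal.ofReal (M ^ 2), ENNReal.ofReal_lt_top, fun φ hφ _ => ?_⟩
    rw [Nat.cast_zero]
    exact sobolevSq_zero_le (hφ.comp hf).continuous.aestronglyMeasurable fun x => hM _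
  | succ n ih =>
    intro f hf hfc K hK
    have hn' : 2 ≤ n → d ≤ 3 := fun h => hn (by omega)
    obtain ⟨K₁, hK₁, h₁⟩ := ih hn' hf hfc hK
    have hf' := contDiff_deriv_infty hf
    -- By ∂_i f(φ) = f'(φ) ∂_iφ it remains to bound this product in H^n.
    suffices hs : ∃ K₂ < ⊤, ∀ φ : Torus d → ℝ, IsSmooth φ →
        sobolevSq (n + 1 : ℕ) (fcoeff φ) ≤ K → ∀ i,
        sobolevSq n (fcoeff fun x => deriv f (φ x) * partialDeriv i φ x) ≤ K₂ by
      obtain ⟨K₂, hK₂, h₂⟩ := hs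
      refine ⟨K₁ + ∑ _i : Fin d, K₂, ?_, fun φ hφ hφK => ?_⟩
      · rw [Finset.sum_const, nsmul_eq_mul]
        exact ENNReal.add_lt_top.2 ⟨hK₁, ENNReal.mul_lt_top (by simp) hK₂⟩
      · have h3 := h₂ φ hφ hφK
        push_cast at hφK ⊢
        rw [sobolevSq_smooth_add_one n (hφ.comp hf)]
        gcongr with i
        · exact h₁ φ hφ ((sobolevSq_mono_exponent (by linarith) _).trans hφK)
        · rw [partialDeriv_comp hf hφ]
          exact h3 i
    have hd1 : ∀ φ : Torus d → ℝ, IsSmooth φ → sobolevSq (n + 1 : ℕ) (fcoeff φ) ≤ K → ∀ i,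
        sobolevSq n (fcoeff (partialDeriv i φ)) ≤ K := fun φ hφ hφK i => by
      push_cast at hφK
      exact (sobolevSq_partialDeriv_le n hφ i).trans hφK
    obtain ⟨M, hM⟩ := exists_bound_of_hasCompactSupport hf' hfc.deriv
    -- For n = 0 bounded multiplication in L² suffices; n = 1 is the second order chain rule; from n
    -- = 2 on, H^n is an algebra and the induction hypothesis applies to f' in place of f.
    rcases lt_or_ge n 2 with hn2 | hn2
    · interval_cases n
      · refine ⟨ENNReal.ofReal (M ^ 2) * K, ENNReal.mul_lt_top ENNReal.ofReal_lt_top hK,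
          fun φ hφ hφK i => ?_⟩
        have := hd1 φ hφ hφK i
        rw [Nat.cast_zero] at this ⊢
        refine (sobolevSq_zero_mul_le (memLp_smooth (hφ.partialDeriv i))
          (hφ.comp hf').continuous.aestronglyMeasurable (fun x => hM _)).trans ?_
        gcongr
      · obtain ⟨K', hK', h⟩ := sobolevSq_one_chain (hn (by norm_num)) hf' hfc.deriv hK
        refine ⟨K', hK', fun φ hφ hφK i => ?_⟩
        rw [Nat.cast_one]
        refine h φ hφ (le_trans (le_of_eq ?_) hφK) i
        norm_num
    · obtain ⟨K', hK', h⟩ := ih hn' hf' hfc.deriv hK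
      have hS := weightSum_lt_top (hn (by omega))
      refine ⟨ENNReal.ofReal (4 ^ n) * (weightSum d + weightSum d) * (K' * K),
        ENNReal.mul_lt_top (ENNReal.mul_lt_top ENNReal.ofReal_lt_top
          (ENNReal.add_lt_top.2 ⟨hS, hS⟩)) (ENNReal.mul_lt_top hK' hK), fun φ hφ hφK i => ?_⟩
      refine (sobolevSq_conv_algebra n hn2 (hasSum_fcoeff_mul (memLp_smooth (hφ.comp hf'))
          (memLp_smooth (hφ.partialDeriv i)))).trans ?_
      gcongr
      · refine h φ hφ ((sobolevSq_mono_exponent ?_ _).trans hφK)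
        push_cast
        linarith
      · exact hd1 φ hφ hφK i

/-! ### Smoothing by the heat semigroup -/

/-- The Fourier multiplier of the heat semigroup at time `ε`. -/
def heatCoeff (ε : ℝ) (c : (Fin d → ℤ) → ℂ) (k : Fin d → ℤ) : ℂ :=
  (Real.exp (-(eigenvalue k * ε)) : ℂ) * c k

lemma norm_heatCoeff (ε : ℝ) (c : (Fin d → ℤ) → ℂ) (k : Fin d → ℤ) :
    ‖heatCoeff ε c k‖ = Real.exp (-(eigenvalue k * ε)) * ‖c k‖ := by
  rw [heatCoeff, norm_mul, Complex.norm_real, Real.norm_of_nonneg (Real.exp_pos _).le]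

lemma norm_heatCoeff_le {ε : ℝ} (hε : 0 ≤ ε) (c : (Fin d → ℤ) → ℂ) (k : Fin d → ℤ) :
    ‖heatCoeff ε c k‖ ≤ ‖c k‖ := by
  rw [norm_heatCoeff]
  refine mul_le_of_le_one_left (norm_nonneg _) (Real.exp_le_one_iff.2 ?_)
  linarith [mul_nonneg (eigenvalue_nonneg k) hε]

lemma Hermitian.heatCoeff {c : (Fin d → ℤ) → ℂ} (hc : Hermitian c) (ε : ℝ) :
    Hermitian (heatCoeff ε c) :=
  hc.real_mul fun k => by rw [eigenvalue_neg]

/-- From x^N/N! ≤ e^x at x = ε(1+λ_k); the factor e^ε compensates for the 1 in the weight. -/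
lemma exp_mul_weight_pow_le {ε : ℝ} (hε : 0 < ε) (N : ℕ) (k : Fin d → ℤ) :
    Real.exp (-(eigenvalue k * ε)) * (1 + eigenvalue k) ^ N
      ≤ Real.exp ε * (N.factorial / ε ^ N) := by
  have h := Real.pow_div_factorial_le_exp (ε * (1 + eigenvalue k))
    (mul_nonneg hε.le (weight_pos k).le) N
  have hf : (0 : ℝ) < N.factorial := by exact_mod_cast N.factorial_pos
  rw [div_le_iff₀ hf, mul_pow] at h
  have h2 : (1 + eigenvalue k) ^ N
      ≤ Real.exp (ε * (1 + eigenvalue k)) * (N.factorial / ε ^ N) := by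
    rw [mul_div_assoc', le_div_iff₀ (pow_pos hε _)]
    linarith
  calc _ ≤ Real.exp (-(eigenvalue k * ε)) *
        (Real.exp (ε * (1 + eigenvalue k)) * (N.factorial / ε ^ N)) := by gcongr
    _ = _ := by
      rw [← mul_assoc, ← Real.exp_add]
      congr 2
      ring

lemma rapidDecay_heatCoeff {ε : ℝ} (hε : 0 < ε) {c : (Fin d → ℤ) → ℂ} {K : ℝ}
    (hc : ∀ k, ‖c k‖ ≤ K) : RapidDecay (heatCoeff ε c) := fun N => by
  refine ⟨Real.exp ε * (N.factorial / ε ^ N) * K, fun k => ?_⟩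
  rw [norm_heatCoeff, mul_right_comm]
  have := exp_mul_weight_pow_le hε N k
  have := weight_pos k
  gcongr
  exact hc k

/-- The solution of the heat equation at time `ε` with initial value `w`. -/
def heatSmooth (ε : ℝ) (w : L2 d) : Torus d → ℝ := series (heatCoeff ε (L2.coeff w))

lemma rapidDecay_heat_coeff {ε : ℝ} (hε : 0 < ε) (w : L2 d) :
    RapidDecay (heatCoeff ε (L2.coeff w)) :=
  rapidDecay_heatCoeff hε (L2.norm_coeff_le w)

lemma isSmooth_heatSmooth {ε : ℝ} (hε : 0 < ε) (w : L2 d) : IsSmooth (heatSmooth ε w) :=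
  isSmooth_series (rapidDecay_heat_coeff hε w)

lemma L2.hermitian_coeff (w : L2 d) : Hermitian (L2.coeff w) := hermitian_fcoeff _

lemma fcoeff_heatSmooth {ε : ℝ} (hε : 0 < ε) (w : L2 d) :
    fcoeff (heatSmooth ε w) = heatCoeff ε (L2.coeff w) :=
  fcoeff_series (rapidDecay_heat_coeff hε w).summable_norm (w.hermitian_coeff.heatCoeff ε)

/-- Strong continuity of the heat semigroup at time zero: by Parseval this is a sum over modes,
dominated by |⟨w,e_k⟩|². -/
lemma tendsto_heatSmooth (w : L2 d) :
    Tendsto (fun ε => ∫ x, (heatSmooth ε w x - w x) ^ 2 ∂torusMeasure d) (𝓝[>] 0) (𝓝 0) := by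
  have h : ∀ᶠ ε in 𝓝[>] (0 : ℝ), ∑' k, ‖heatCoeff ε (L2.coeff w) k - L2.coeff w k‖ ^ 2
      = ∫ x, (heatSmooth ε w x - w x) ^ 2 ∂torusMeasure d := by
    filter_upwards [self_mem_nhdsWithin] with ε (hε : 0 < ε)
    have h1 := hasSum_norm_fcoeff_sq ((memLp_smooth (isSmooth_heatSmooth hε w)).sub (Lp.memLp w))
    rw [show (∫ x, (heatSmooth ε w x - w x) ^ 2 ∂torusMeasure d)
      = ∫ x, (heatSmooth ε w - ⇑w) x ^ 2 ∂torusMeasure d from rfl, ← h1.tsum_eq]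
    refine tsum_congr fun k => ?_
    rw [← fcoeff_heatSmooth hε]
    congr 2
    exact (fcoeff_sub (integrable_continuous (isSmooth_heatSmooth hε w).continuous) w.integrable
      k).symm
  refine Tendsto.congr' h ?_
  have h0 : ∑' _k : Fin d → ℤ, (0 : ℝ) = 0 := by simp
  rw [show 𝓝 (0 : ℝ) = 𝓝 (∑' _k : Fin d → ℤ, (0 : ℝ)) by rw [h0]]
  refine tendsto_tsum_of_dominated_convergence (bound := fun k => ‖L2.coeff w k‖ ^ 2)
    (L2.hasSum_norm_coeff_sq w).summable (fun k => ?_) ?_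
  · have hc : Continuous fun ε : ℝ => ‖heatCoeff ε (L2.coeff w) k - L2.coeff w k‖ ^ 2 := by
      unfold heatCoeff
      fun_prop
    have := hc.tendsto 0
    simp only [heatCoeff, mul_zero, neg_zero, Real.exp_zero, Complex.ofReal_one, one_mul, sub_self,
      norm_zero, ne_eq, OfNat.ofNat_ne_zero, not_false_eq_true, zero_pow] at this
    exact this.mono_left nhdsWithin_le_nhds
  · filter_upwards [self_mem_nhdsWithin] with ε (hε : 0 < ε) k
    rw [Real.norm_of_nonneg (sq_nonneg _)]
    have e : heatCoeff ε (L2.coeff w) k - L2.coeff w k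
        = ((Real.exp (-(eigenvalue k * ε)) - 1 : ℝ) : ℂ) * L2.coeff w k := by
      rw [heatCoeff]; push_cast; ring
    rw [e, norm_mul, Complex.norm_real]
    have h1 : Real.exp (-(eigenvalue k * ε)) ≤ 1 :=
      Real.exp_le_one_iff.2 (by linarith [mul_nonneg (eigenvalue_nonneg k) hε.le])
    have h2 := Real.exp_pos (-(eigenvalue k * ε))
    have h3 : ‖Real.exp (-(eigenvalue k * ε)) - 1‖ ≤ 1 := by
      rw [Real.norm_eq_abs, abs_le]
      constructor <;> linarith
    gcongr
    exact mul_le_of_le_one_left (norm_nonneg _) h3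

/-! ### Composition in `L²` -/

lemma memLp_comp {f : ℝ → ℝ} (hf : ContDiff ℝ ∞ f) (hfc : HasCompactSupport f)
    {g : Torus d → ℝ} (hg : AEStronglyMeasurable g (torusMeasure d)) :
    MemLp (fun x => f (g x)) 2 (torusMeasure d) := by
  obtain ⟨M, hM⟩ := exists_bound_of_hasCompactSupport hf hfc
  exact MemLp.of_bound (hf.continuous.comp_aestronglyMeasurable hg) M (ae_of_all _ fun x => hM _)

/-- One coefficient is at most the L² norm, and composition with f is Lipschitz on L² with the
Lipschitz constant of f. -/
lemma norm_fcoeff_comp_sub_sq_le {f : ℝ → ℝ} (hf : ContDiff ℝ ∞ f) (hfc : HasCompactSupport f)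
    {L : ℝ≥0} (hL : LipschitzWith L f) {g h : Torus d → ℝ} (hg : MemLp g 2 (torusMeasure d))
    (hh : MemLp h 2 (torusMeasure d)) (k : Fin d → ℤ) :
    ‖fcoeff (fun x => f (g x)) k - fcoeff (fun x => f (h x)) k‖ ^ 2
      ≤ L ^ 2 * ∫ x, (g x - h x) ^ 2 ∂torusMeasure d := by
  have h1 := (memLp_comp hf hfc hg.1).sub (memLp_comp hf hfc hh.1)
  rw [← fcoeff_sub ((memLp_comp hf hfc hg.1).integrable (by norm_num))
    ((memLp_comp hf hfc hh.1).integrable (by norm_num)), ← integral_const_mul]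
  refine (le_hasSum (hasSum_norm_fcoeff_sq h1) k fun _ _ => sq_nonneg _).trans ?_
  refine integral_mono h1.integrable_sq ((hg.sub hh).integrable_sq.const_mul _) fun x => ?_
  have := hL.dist_le_mul (g x) (h x)
  rw [Real.dist_eq, Real.dist_eq] at this
  simp only [Pi.sub_apply]
  rw [← mul_pow, sq_le_sq, abs_mul, abs_of_nonneg L.coe_nonneg]
  exact this

lemma exists_lipschitzWith {f : ℝ → ℝ} (hf : ContDiff ℝ ∞ f) (hfc : HasCompactSupport f) :
    ∃ L, LipschitzWith L f :=
  (hf.of_le (by simp)).lipschitzWith_of_hasCompactSupport hfc one_ne_zero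

lemma tendsto_fcoeff_comp_heatSmooth {f : ℝ → ℝ} (hf : ContDiff ℝ ∞ f)
    (hfc : HasCompactSupport f) (w : L2 d) (k : Fin d → ℤ) :
    Tendsto (fun ε => fcoeff (fun x => f (heatSmooth ε w x)) k) (𝓝[>] 0)
      (𝓝 (fcoeff (fun x => f (w x)) k)) := by
  obtain ⟨L, hL⟩ := exists_lipschitzWith hf hfc
  have h0 := ((tendsto_heatSmooth w).const_mul ((L : ℝ) ^ 2)).sqrt
  rw [mul_zero, Real.sqrt_zero] at h0
  refine tendsto_iff_norm_sub_tendsto_zero.2 (squeeze_zero' (Eventually.of_forall fun _ =>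
    norm_nonneg _) ?_ h0)
  filter_upwards [self_mem_nhdsWithin] with ε (hε : 0 < ε)
  exact Real.le_sqrt_of_sq_le (norm_fcoeff_comp_sub_sq_le hf hfc hL
    (memLp_smooth (isSmooth_heatSmooth hε w)) (Lp.memLp w) k)

/-- Composition with a smooth compactly supported function is bounded in `H^n`. -/
theorem sobolevSq_comp (n : ℕ) (hn : 2 ≤ n → d ≤ 3) {f : ℝ → ℝ} (hf : ContDiff ℝ ∞ f)
    (hfc : HasCompactSupport f) {K : ℝ≥0∞} (hK : K < ⊤) :
    ∃ K' < ⊤, ∀ w : L2 d, sobolevSq n (L2.coeff w) ≤ K →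
      sobolevSq n (fcoeff fun x => f (w x)) ≤ K' := by
  obtain ⟨K', hK', h⟩ := sobolevSq_comp_smooth (d := d) n hn hf hfc hK
  refine ⟨K', hK', fun w hw => ?_⟩
  -- The smooth case is applied to the heat regularisations of w, whose coefficients are no larger
  -- than those of w.
  refine sobolevSq_le_of_tendsto (l := 𝓝[>] (0 : ℝ)) (tendsto_fcoeff_comp_heatSmooth hf hfc w) ?_
  filter_upwards [self_mem_nhdsWithin] with ε (hε : 0 < ε)
  refine h _ (isSmooth_heatSmooth hε w) (le_trans ?_ hw)
  rw [fcoeff_heatSmooth hε]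
  exact sobolevSq_mono _ (norm_heatCoeff_le hε.le _)

/-! ### Weak derivatives of continuous functions of one real variable -/

/-- The primitive of a test function with vanishing integral is a test function. -/
lemma exists_primitive_of_integral_eq_zero {T : ℝ} {χ : ℝ → ℝ} (hχ : ContDiff ℝ ∞ χ)
    {S : Set ℝ} (hS : IsCompact S) (hne : S.Nonempty) (hST : S ⊆ Ioo 0 T)
    (hsupp : ∀ t, t ∉ S → χ t = 0) (h0 : ∫ t, χ t = 0) :
    ∃ η : ℝ → ℝ, ContDiff ℝ ∞ η ∧ HasCompactSupport η ∧ tsupport η ⊆ Ioo 0 T ∧ deriv η = χ := by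
  obtain ⟨a, haS, ha⟩ := hS.exists_isLeast hne
  obtain ⟨b, hbS, hb⟩ := hS.exists_isGreatest hne
  have hχc := hχ.continuous
  have hd : ∀ t, HasDerivAt (fun t => ∫ s in a..t, χ s) (χ t) t := fun t =>
    intervalIntegral.integral_hasDerivAt_right (hχc.intervalIntegrable _ _)
      (hχc.stronglyMeasurableAtFilter _ _) hχc.continuousAt
  have hder : deriv (fun t => ∫ s in a..t, χ s) = χ := funext fun t => (hd t).deriv
  have hout : ∀ t, t ∉ Icc a b → χ t = 0 := fun t ht => hsupp t fun hS => ht ⟨ha hS, hb hS⟩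
  have hab : a ≤ b := ha hbS
  have hts : tsupport (fun t => ∫ s in a..t, χ s) ⊆ Icc a b := by
    refine closure_minimal (fun t ht => ?_) isClosed_Icc
    by_contra hn
    refine ht ?_
    change (∫ s in a..t, χ s) = 0
    rcases lt_or_ge t a with hta | hta
    · rw [intervalIntegral.integral_symm, intervalIntegral.integral_of_le hta.le,
        integral_Ioc_eq_integral_Ioo, setIntegral_eq_zero_of_forall_eq_zero, neg_zero]
      exact fun s hs => hout s fun h => absurd h.1 (not_le.2 hs.2)
    · have htb : b < t := lt_of_not_ge fun h => hn ⟨hta, h⟩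
      rw [intervalIntegral.integral_of_le hta, ← integral_Icc_eq_integral_Ioc,
        setIntegral_eq_integral_of_forall_compl_eq_zero, h0]
      exact fun s hs => hout s fun h => hs ⟨h.1, h.2.trans htb.le⟩
  refine ⟨fun t => ∫ s in a..t, χ s, ?_, ?_, ?_, hder⟩
  · refine contDiff_infty_iff_deriv.2 ⟨fun t => (hd t).differentiableAt, ?_⟩
    rw [hder]
    exact hχ
  · exact isCompact_Icc.of_isClosed_subset (isClosed_tsupport _) hts
  · exact hts.trans fun t ht => ⟨(hST haS).1.trans_le ht.1, ht.2.trans_lt (hST hbS).2⟩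

/-- The lemma of du Bois-Reymond for continuous functions. -/
lemma exists_eqOn_const_of_integral_deriv_mul {T : ℝ} (hT : 0 < T) {h : ℝ → ℝ} (hh : Continuous h)
    (H : ∀ η : ℝ → ℝ, ContDiff ℝ ∞ η → HasCompactSupport η → tsupport η ⊆ Ioo 0 T →
      ∫ t, deriv η t * h t = 0) : ∃ c, ∀ t ∈ Icc 0 T, h t = c := by
  let B : ContDiffBump (T / 2) := ⟨T / 8, T / 4, by positivity, by linarith⟩
  set ψ₀ : ℝ → ℝ := B.normed volume with hψ₀
  have hψ₀s : ContDiff ℝ ∞ ψ₀ := B.contDiff_normed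
  have hψ₀c : HasCompactSupport ψ₀ := B.hasCompactSupport_normed
  have hψ₀i : ∫ t, ψ₀ t = 1 := B.integral_normed
  have hψ₀t : tsupport ψ₀ ⊆ Ioo 0 T := by
    rw [hψ₀, B.tsupport_normed_eq, Real.closedBall_eq_Icc]
    intro t ht
    have h1 : T / 2 - T / 4 ≤ t := ht.1
    have h2 : t ≤ T / 2 + T / 4 := ht.2
    constructor <;> linarith
  have hne : (tsupport ψ₀).Nonempty := by
    by_contra hn
    rw [not_nonempty_iff_eq_empty, tsupport_eq_empty_iff] at hn
    rw [hn] at hψ₀i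
    simp at hψ₀i
  refine ⟨∫ t, ψ₀ t * h t, ?_⟩
  set c := ∫ t, ψ₀ t * h t with hc
  have hint : ∀ {ψ g : ℝ → ℝ}, Continuous ψ → HasCompactSupport ψ → Continuous g →
      Integrable fun t => ψ t * g t := fun hψ hψc hg =>
    (hψ.mul hg).integrable_of_hasCompactSupport hψc.mul_right
  have key : ∀ ψ : ℝ → ℝ, ContDiff ℝ ∞ ψ → HasCompactSupport ψ → tsupport ψ ⊆ Ioo 0 T →
      ∫ t, ψ t • (h t - c) = 0 := by
    intro ψ hψ hψc hψt
    have hψint : Integrable ψ := hψ.continuous.integrable_of_hasCompactSupport hψc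
    have hψ₀int : Integrable ψ₀ := hψ₀s.continuous.integrable_of_hasCompactSupport hψ₀c
    -- Subtracting (∫ψ)ψ₀ makes the integral vanish, so the difference is the derivative of an
    -- admissible test function.
    obtain ⟨η, h1, h2, h3, h4⟩ := exists_primitive_of_integral_eq_zero (T := T)
      (χ := fun t => ψ t - (∫ s, ψ s) * ψ₀ t) (hψ.sub (contDiff_const.mul hψ₀s))
      (hψc.isCompact.union hψ₀c.isCompact) (hne.inr) (union_subset hψt hψ₀t)
      (fun t ht => by
        rw [image_eq_zero_of_notMem_tsupport fun h => ht (Or.inl h),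
          image_eq_zero_of_notMem_tsupport fun h => ht (Or.inr h)]
        simp)
      (by rw [integral_sub hψint (hψ₀int.const_mul _), integral_const_mul, hψ₀i]; simp)
    have h5 := H η h1 h2 h3
    simp only [h4, sub_mul, mul_assoc] at h5
    rw [integral_sub (hint hψ.continuous hψc hh)
      ((hint hψ₀s.continuous hψ₀c hh).const_mul _), integral_const_mul, ← hc] at h5
    simp only [smul_eq_mul, mul_sub]
    rw [integral_sub (hint hψ.continuous hψc hh) (hψint.mul_const c), integral_mul_const]
    exact h5
  have hae := IsOpen.ae_eq_zero_of_integral_contDiff_smul_eq_zero (μ := volume)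
    (isOpen_Ioo (a := (0 : ℝ)) (b := T)) (f := fun t => h t - c)
    ((hh.sub continuous_const).locallyIntegrable.locallyIntegrableOn _) key
  have heq : EqOn h (fun _ => c) (Ioo 0 T) := by
    refine Measure.eqOn_open_of_ae_eq (μ := volume) ?_ isOpen_Ioo hh.continuousOn continuousOn_const
    rw [EventuallyEq, ae_restrict_iff' measurableSet_Ioo]
    filter_upwards [hae] with t ht htm
    exact sub_eq_zero.1 (ht htm)
  have := heq.closure hh continuous_const
  rw [closure_Ioo hT.ne] at this
  exact this

/-- A continuous function with continuous weak derivative is continuously differentiable. -/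
theorem exists_hasDerivAt_of_weak_deriv {T : ℝ} (hT : 0 < T) {g w : ℝ → ℝ}
    (hg : ContinuousOn g (Icc 0 T)) (hw : ContinuousOn w (Icc 0 T))
    (H : ∀ η : ℝ → ℝ, ContDiff ℝ ∞ η → HasCompactSupport η → tsupport η ⊆ Ioo 0 T →
      ∫ t in Icc 0 T, deriv η t * g t = -∫ t in Icc 0 T, η t * w t) :
    ∃ G : ℝ → ℝ, ∀ t ∈ Icc 0 T, G t = g t ∧ HasDerivAt G (w t) t := by
  -- Both functions are extended by their boundary values, so that the derivative obtained is
  -- two-sided even at 0 and T.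
  set g' := IccExtend hT.le ((Icc 0 T).domRestrict g) with hg'
  set w' := IccExtend hT.le ((Icc 0 T).domRestrict w) with hw'
  have hgc : Continuous g' := hg.domRestrict.Icc_extend'
  have hwc : Continuous w' := hw.domRestrict.Icc_extend'
  have hgg : ∀ t ∈ Icc 0 T, g' t = g t := fun t ht => IccExtend_of_mem _ _ ht
  have hww : ∀ t ∈ Icc 0 T, w' t = w t := fun t ht => IccExtend_of_mem _ _ ht
  set W : ℝ → ℝ := fun t => ∫ s in (0 : ℝ)..t, w' s with hW
  have hWd : ∀ t, HasDerivAt W (w' t) t := fun t =>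
    intervalIntegral.integral_hasDerivAt_right (hwc.intervalIntegrable _ _)
      (hwc.stronglyMeasurableAtFilter _ _) hwc.continuousAt
  have hWc : Continuous W := continuous_iff_continuousAt.2 fun t => (hWd t).continuousAt
  -- The difference of g and the primitive of w has weak derivative zero, hence is constant on
  -- [0,T].
  obtain ⟨c, hc⟩ := exists_eqOn_const_of_integral_deriv_mul hT
    (h := fun t => g' t - W t) (hgc.sub hWc) (by
    intro η h1 h2 h3
    have hd := h1.continuous_deriv (by simp)
    have hint : ∀ {ψ g : ℝ → ℝ}, Continuous ψ → HasCompactSupport ψ → Continuous g →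
        Integrable fun t => ψ t * g t := fun hψ hψc hg =>
      (hψ.mul hg).integrable_of_hasCompactSupport hψc.mul_right
    have hres : ∀ {ψ p q : ℝ → ℝ}, tsupport ψ ⊆ Ioo 0 T → (∀ t ∈ Icc 0 T, p t = q t) →
        ∫ t in Icc 0 T, ψ t * q t = ∫ t, ψ t * p t := by
      intro ψ p q hψ hpq
      rw [setIntegral_congr_fun measurableSet_Icc fun t ht => by rw [← hpq t ht]]
      refine setIntegral_eq_integral_of_forall_compl_eq_zero fun t ht => ?_
      rw [image_eq_zero_of_notMem_tsupport fun h => ht (Ioo_subset_Icc_self (hψ h)), zero_mul]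
    have h4 := H η h1 h2 h3
    rw [hres (tsupport_deriv_subset.trans h3) hgg, hres h3 hww] at h4
    have h5 := integral_mul_deriv_eq_deriv_mul_of_integrable (u := W) (v := η) (u' := w')
      (v' := deriv η) (fun t _ => hWd t) (fun t _ => ((h1.differentiable (by simp)) t).hasDerivAt)
      (by simpa only [mul_comm] using! hint hd h2.deriv hWc)
      (by simpa only [mul_comm] using! hint h1.continuous h2 hwc)
      (by simpa only [mul_comm] using! hint h1.continuous h2 hWc)
    simp only [mul_comm (W _), mul_comm (w' _)] at h5
    simp only [mul_sub]
    rw [integral_sub (hint hd h2.deriv hgc) (hint hd h2.deriv hWc), h4, h5]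
    ring)
  refine ⟨fun t => c + W t, fun t ht => ⟨?_, ?_⟩⟩
  · have := hc t ht
    rw [← hgg t ht]
    linarith
  · rw [← hww t ht]
    exact (hWd t).const_add c

/-! ### The modes of the heat equation -/

lemma hasDerivAt_exp_mul (a t : ℝ) :
    HasDerivAt (fun s => Real.exp (a * s)) (a * Real.exp (a * t)) t := by
  have := ((hasDerivAt_id t).const_mul a).exp
  simpa [mul_comm] using this

/-- Energy estimate for one real mode. -/
lemma mode_energy {T l : ℝ} (hl : 0 ≤ l) {G F : ℝ → ℝ} (hF : ContinuousOn F (Icc 0 T))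
    (hG : ∀ t ∈ Icc 0 T, HasDerivAt G (-l * G t + F t) t) {t : ℝ} (ht : t ∈ Icc 0 T) :
    G t ^ 2 + (1 + l) * ∫ s in (0 : ℝ)..t, G s ^ 2
      ≤ Real.exp (2 * T) * (G 0 ^ 2 + (1 + l)⁻¹ * ∫ s in (0 : ℝ)..t, F s ^ 2) := by
  have hm : 0 < 1 + l := by linarith
  have ht0 := ht.1
  have hsub : Icc 0 t ⊆ Icc 0 T := Icc_subset_Icc_right ht.2
  have hGc : ContinuousOn G (Icc 0 t) := fun s hs => (hG s (hsub hs)).continuousAt.continuousWithinAt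
  have hFc := hF.mono hsub
  have hec : ContinuousOn (fun s : ℝ => Real.exp (-2 * s)) (Icc 0 t) := by fun_prop
  have hint : ∀ {p : ℝ → ℝ}, ContinuousOn p (Icc 0 t) → IntervalIntegrable p volume 0 t :=
    fun hp => ContinuousOn.intervalIntegrable (by rwa [uIcc_of_le ht0])
  -- The factor e^{-2s} turns the damping 2l into 2(1+l), so the mode l = 0 is damped too; removing
  -- it at the end costs e^{2T}.
  have hder : ∀ s ∈ uIcc 0 t, HasDerivAt (fun s => Real.exp (-2 * s) * G s ^ 2)
      (Real.exp (-2 * s) * (-2 * (1 + l) * G s ^ 2 + 2 * G s * F s)) s := by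
    intro s hs
    rw [uIcc_of_le ht0] at hs
    have h1 := (hasDerivAt_exp_mul (-2) s).mul ((hG s (hsub hs)).pow 2)
    refine h1.congr_deriv ?_
    simp
    ring
  have hc1 : ContinuousOn (fun s => Real.exp (-2 * s) *
      (-2 * (1 + l) * G s ^ 2 + 2 * G s * F s)) (Icc 0 t) := by fun_prop
  have h1 := intervalIntegral.integral_eq_sub_of_hasDerivAt hder (hint hc1)
  simp only [mul_zero, Real.exp_zero, one_mul] at h1
  have hc2 : ContinuousOn (fun s => Real.exp (-2 * s) * G s ^ 2) (Icc 0 t) := by fun_prop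
  have hc3 : ContinuousOn (fun s => Real.exp (-2 * s) * F s ^ 2) (Icc 0 t) := by fun_prop
  have h2 : ∫ s in (0 : ℝ)..t, Real.exp (-2 * s) * (-2 * (1 + l) * G s ^ 2 + 2 * G s * F s)
      ≤ ∫ s in (0 : ℝ)..t, (-(1 + l) * (Real.exp (-2 * s) * G s ^ 2)
        + (1 + l)⁻¹ * (Real.exp (-2 * s) * F s ^ 2)) := by
    refine intervalIntegral.integral_mono_on ht0 (hint hc1)
      (hint ((continuousOn_const.mul hc2).add (continuousOn_const.mul hc3))) fun s _ => ?_
    -- Young's inequality with weight 1+l absorbs half of the damping and leaves the factor (1+l)⁻¹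
    -- on the source.
    have h3 : 2 * G s * F s ≤ (1 + l) * G s ^ 2 + (1 + l)⁻¹ * F s ^ 2 := by
      have h4 : 0 ≤ (1 + l)⁻¹ * ((1 + l) * G s - F s) ^ 2 := by positivity
      have h5 : (1 + l)⁻¹ * ((1 + l) * G s - F s) ^ 2
          = (1 + l) * G s ^ 2 - 2 * G s * F s + (1 + l)⁻¹ * F s ^ 2 := by
        field_simp
        ring
      linarith
    have h6 := Real.exp_pos (-2 * s)
    nlinarith [mul_le_mul_of_nonneg_left h3 h6.le]
  have hi2 : IntervalIntegrable (fun s => -(1 + l) * (Real.exp (-2 * s) * G s ^ 2)) volume 0 t :=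
    hint (continuousOn_const.mul hc2)
  have hi3 : IntervalIntegrable (fun s => (1 + l)⁻¹ * (Real.exp (-2 * s) * F s ^ 2)) volume 0 t :=
    hint (continuousOn_const.mul hc3)
  rw [intervalIntegral.integral_add hi2 hi3, intervalIntegral.integral_const_mul,
    intervalIntegral.integral_const_mul] at h2
  have hG2 : ContinuousOn (fun s => G s ^ 2) (Icc 0 t) := by fun_prop
  have hF2 : ContinuousOn (fun s => F s ^ 2) (Icc 0 t) := by fun_prop
  have h3 : ∫ s in (0 : ℝ)..t, Real.exp (-2 * s) * F s ^ 2 ≤ ∫ s in (0 : ℝ)..t, F s ^ 2 := by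
    refine intervalIntegral.integral_mono_on ht0 (hint hc3) (hint hF2) fun s hs => ?_
    refine mul_le_of_le_one_left (sq_nonneg _) (Real.exp_le_one_iff.2 ?_)
    linarith [hs.1]
  have h4 : Real.exp (-2 * T) * ∫ s in (0 : ℝ)..t, G s ^ 2
      ≤ ∫ s in (0 : ℝ)..t, Real.exp (-2 * s) * G s ^ 2 := by
    rw [← intervalIntegral.integral_const_mul]
    refine intervalIntegral.integral_mono_on ht0 (hint (continuousOn_const.mul hG2)) (hint hc2)
      fun s hs => ?_
    have : s ≤ T := hs.2.trans ht.2
    gcongr Real.exp ?_ * _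
    linarith
  have h5 : Real.exp (-2 * T) * G t ^ 2 ≤ Real.exp (-2 * t) * G t ^ 2 := by
    have := ht.2
    gcongr Real.exp ?_ * _
    linarith
  have h6 : Real.exp (-2 * T) * (G t ^ 2 + (1 + l) * ∫ s in (0 : ℝ)..t, G s ^ 2)
      ≤ G 0 ^ 2 + (1 + l)⁻¹ * ∫ s in (0 : ℝ)..t, F s ^ 2 := by
    have h7 := mul_le_mul_of_nonneg_left h3 (inv_pos.2 hm).le
    have h8 := mul_le_mul_of_nonneg_left h4 hm.le
    nlinarith
  calc _ = Real.exp (2 * T) * (Real.exp (-2 * T) *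
        (G t ^ 2 + (1 + l) * ∫ s in (0 : ℝ)..t, G s ^ 2)) := by
        rw [← mul_assoc, ← Real.exp_add]
        simp
    _ ≤ _ := by gcongr


/-! ### The system of all modes: Duhamel's formula and summed energy estimates -/

/-- The Fourier coefficients `a` solve the heat equation with right hand side `F`. -/
def ModeSolution (T : ℝ) (a F : ℝ → (Fin d → ℤ) → ℂ) : Prop :=
  ∀ k, ContinuousOn (fun t => F t k) (Icc 0 T) ∧ ∃ A : ℝ → ℂ, ∀ t ∈ Icc 0 T, A t = a t k ∧
    HasDerivAt A (-(eigenvalue k : ℂ) * A t + F t k) t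

lemma ModeSolution.continuousOn {T : ℝ} {a F : ℝ → (Fin d → ℤ) → ℂ} (h : ModeSolution T a F)
    (k : Fin d → ℤ) : ContinuousOn (fun t => a t k) (Icc 0 T) := by
  obtain ⟨A, hA⟩ := (h k).2
  have : ContinuousOn A (Icc 0 T) := fun s hs => (hA s hs).2.continuousAt.continuousWithinAt
  exact this.congr fun t ht => (hA t ht).1.symm

/-- The derivative in s of e^{-λ_k(t-s)}A(s) is e^{-λ_k(t-s)}F_k(s); integrate over [0,t]. -/
lemma ModeSolution.duhamel {T : ℝ} {a F : ℝ → (Fin d → ℤ) → ℂ} (h : ModeSolution T a F)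
    (k : Fin d → ℤ) {t : ℝ} (ht : t ∈ Icc 0 T) :
    a t k = heatCoeff t (a 0) k + ∫ s in (0 : ℝ)..t, heatCoeff (t - s) (F s) k := by
  obtain ⟨hF, A, hA⟩ := h k
  have hsub : Icc 0 t ⊆ Icc 0 T := Icc_subset_Icc_right ht.2
  have hder : ∀ s ∈ uIcc 0 t, HasDerivAt
      (fun s => ((Real.exp (-(eigenvalue k * (t - s))) : ℝ) : ℂ) * A s)
      (heatCoeff (t - s) (F s) k) s := by
    intro s hs
    rw [uIcc_of_le ht.1] at hs
    have h1 : HasDerivAt (fun s : ℝ => Real.exp (-(eigenvalue k * (t - s))))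
        (eigenvalue k * Real.exp (-(eigenvalue k * (t - s)))) s := by
      have h2 := (((hasDerivAt_id s).const_sub t).const_mul (eigenvalue k)).neg.exp
      simpa [mul_comm] using h2
    refine (h1.ofReal_comp.mul (hA s (hsub hs)).2).congr_deriv ?_
    rw [heatCoeff]
    push_cast
    ring
  have hFc : ContinuousOn (fun s => heatCoeff (t - s) (F s) k) (Icc 0 t) := by
    unfold heatCoeff
    have := hF.mono hsub
    fun_prop
  have h1 := intervalIntegral.integral_eq_sub_of_hasDerivAt hder
    (ContinuousOn.intervalIntegrable (by rwa [uIcc_of_le ht.1]))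
  rw [h1, heatCoeff, (hA t ht).1, (hA 0 ⟨le_rfl, ht.1.trans ht.2⟩).1]
  simp

/-- Energy estimate for one mode. -/
lemma ModeSolution.energy {T : ℝ} {a F : ℝ → (Fin d → ℤ) → ℂ} (h : ModeSolution T a F)
    (k : Fin d → ℤ) {t : ℝ} (ht : t ∈ Icc 0 T) :
    ‖a t k‖ ^ 2 + (1 + eigenvalue k) * ∫ s in (0 : ℝ)..t, ‖a s k‖ ^ 2
      ≤ Real.exp (2 * T) * (‖a 0 k‖ ^ 2 +
        (1 + eigenvalue k)⁻¹ * ∫ s in (0 : ℝ)..t, ‖F s k‖ ^ 2) := by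
  obtain ⟨hF, A, hA⟩ := h k
  have hac := h.continuousOn k
  have hl := eigenvalue_nonneg k
  have hsub : uIcc 0 t ⊆ Icc 0 T := by
    rw [uIcc_of_le ht.1]; exact Icc_subset_Icc_right ht.2
  -- Since λ_k is real, the real and imaginary parts solve the same scalar equation separately.
  have hre := mode_energy (T := T) (G := fun t => (A t).re) (F := fun t => (F t k).re) hl
    (Complex.continuous_re.comp_continuousOn hF) (fun s hs => by
      have := Complex.reCLM.hasFDerivAt.comp_hasDerivAt s (hA s hs).2
      exact this.congr_deriv (by simp)) ht
  have him := mode_energy (T := T) (G := fun t => (A t).im) (F := fun t => (F t k).im) hl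
    (Complex.continuous_im.comp_continuousOn hF) (fun s hs => by
      have := Complex.imCLM.hasFDerivAt.comp_hasDerivAt s (hA s hs).2
      exact this.congr_deriv (by simp)) ht
  have h0 := (hA 0 ⟨le_rfl, ht.1.trans ht.2⟩).1
  have hsq : ∀ z : ℂ, ‖z‖ ^ 2 = z.re ^ 2 + z.im ^ 2 := fun z => by
    rw [← Complex.normSq_eq_norm_sq, Complex.normSq_apply]; ring
  have hsplit : ∀ {p : ℝ → ℂ}, ContinuousOn p (Icc 0 T) → ∫ s in (0 : ℝ)..t, ‖p s‖ ^ 2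
      = (∫ s in (0 : ℝ)..t, (p s).re ^ 2) + ∫ s in (0 : ℝ)..t, (p s).im ^ 2 := by
    intro p hp
    rw [← intervalIntegral.integral_add]
    · simp_rw [hsq]
    · exact (((Complex.continuous_re.comp_continuousOn hp).pow 2).mono hsub).intervalIntegrable
    · exact (((Complex.continuous_im.comp_continuousOn hp).pow 2).mono hsub).intervalIntegrable
  have hA' : ∫ s in (0 : ℝ)..t, ‖a s k‖ ^ 2 = ∫ s in (0 : ℝ)..t, ‖A s‖ ^ 2 :=
    intervalIntegral.integral_congr fun s hs => by
      simp only [(hA s (hsub hs)).1]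
  rw [hA', hsplit (hac.congr fun s hs => (hA s hs).1), hsplit hF, ← (hA t ht).1, ← h0, hsq, hsq]
  linarith

/-- The bound for all Sobolev norms in the parabolic regularity estimate. -/
def parabolicBound (T s : ℝ) (c : (Fin d → ℤ) → ℂ) (F : ℝ → (Fin d → ℤ) → ℂ) : ℝ≥0∞ :=
  ENNReal.ofReal (Real.exp (2 * T)) *
    (sobolevSq s c + ∫⁻ t in Icc 0 T, sobolevSq (s - 1) (F t))

/-- The bound for one mode. -/
def modeBound (T : ℝ) (a F : ℝ → (Fin d → ℤ) → ℂ) (k : Fin d → ℤ) : ℝ :=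
  Real.exp (2 * T) * (‖a 0 k‖ ^ 2 + (1 + eigenvalue k)⁻¹ * ∫ s in (0 : ℝ)..T, ‖F s k‖ ^ 2)

lemma lintegral_enorm_sq {T : ℝ} (hT : 0 ≤ T) {p : ℝ → ℂ} (hp : ContinuousOn p (Icc 0 T)) :
    ∫⁻ t in Icc 0 T, ‖p t‖ₑ ^ 2 = ENNReal.ofReal (∫ t in (0 : ℝ)..T, ‖p t‖ ^ 2) := by
  rw [intervalIntegral.integral_of_le hT, ← integral_Icc_eq_integral_Ioc,
    ofReal_integral_eq_lintegral_ofReal]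
  · refine lintegral_congr fun t => ?_
    rw [ENNReal.ofReal_pow (norm_nonneg _), ofReal_norm]
  · exact (hp.norm.pow 2).integrableOn_Icc
  · exact ae_of_all _ fun t => sq_nonneg _

lemma aemeasurable_enorm_sq {T : ℝ} {p : ℝ → ℂ} (hp : ContinuousOn p (Icc 0 T)) :
    AEMeasurable (fun t => ‖p t‖ₑ ^ 2) (volume.restrict (Icc 0 T)) :=
  ((hp.aestronglyMeasurable measurableSet_Icc).enorm).pow_const 2

/-- The factor (1+λ_k)⁻¹ in front of the source lowers its Sobolev order from s to s-1, which is the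
parabolic gain. -/
lemma tsum_modeBound {T : ℝ} (hT : 0 ≤ T) {a F : ℝ → (Fin d → ℤ) → ℂ} (h : ModeSolution T a F)
    (s : ℝ) : ∑' k, ENNReal.ofReal ((1 + eigenvalue k) ^ s) * ENNReal.ofReal (modeBound T a F k)
      = parabolicBound T s (a 0) F := by
  have hm : ∀ k (r : ℝ), 0 ≤ (1 + eigenvalue (d := d) k) ^ r :=
    fun k r => Real.rpow_nonneg (weight_pos k).le r
  unfold parabolicBound sobolevSq
  rw [lintegral_tsum fun k => (aemeasurable_enorm_sq (h k).1).const_mul _, ← ENNReal.tsum_add,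
    ← ENNReal.tsum_mul_left]
  refine tsum_congr fun k => ?_
  have hi : 0 ≤ ∫ s in (0 : ℝ)..T, ‖F s k‖ ^ 2 :=
    intervalIntegral.integral_nonneg hT fun _ _ => sq_nonneg _
  have hw := weight_pos k
  rw [lintegral_const_mul' _ _ ENNReal.ofReal_ne_top, lintegral_enorm_sq hT (h k).1, modeBound,
    ENNReal.ofReal_mul (Real.exp_pos _).le, ENNReal.ofReal_add (sq_nonneg _) (by positivity),
    ENNReal.ofReal_pow (norm_nonneg _), ofReal_norm, ENNReal.ofReal_mul (by positivity),
    show s - 1 = s + (-1) by ring, Real.rpow_add hw, Real.rpow_neg_one,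
    ENNReal.ofReal_mul (hm k s)]
  ring

lemma ModeSolution.norm_sq_le_modeBound {T : ℝ} {a F : ℝ → (Fin d → ℤ) → ℂ}
    (h : ModeSolution T a F) (k : Fin d → ℤ) {t : ℝ} (ht : t ∈ Icc 0 T) :
    ‖a t k‖ ^ 2 ≤ modeBound T a F k := by
  have h1 := h.energy k ht
  have hi : 0 ≤ ∫ s in (0 : ℝ)..t, ‖a s k‖ ^ 2 :=
    intervalIntegral.integral_nonneg ht.1 fun _ _ => sq_nonneg _
  have hw := weight_pos k
  have hmono : ∫ s in (0 : ℝ)..t, ‖F s k‖ ^ 2 ≤ ∫ s in (0 : ℝ)..T, ‖F s k‖ ^ 2 := by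
    refine intervalIntegral.integral_mono_interval le_rfl ht.1 ht.2
      (ae_of_all _ fun _ => sq_nonneg _) ?_
    refine ContinuousOn.intervalIntegrable ?_
    rw [uIcc_of_le (ht.1.trans ht.2)]
    exact (h k).1.norm.pow 2
  calc ‖a t k‖ ^ 2 ≤ ‖a t k‖ ^ 2 + (1 + eigenvalue k) * ∫ s in (0 : ℝ)..t, ‖a s k‖ ^ 2 :=
        le_add_of_nonneg_right (by positivity)
    _ ≤ _ := h1
    _ ≤ _ := by unfold modeBound; gcongr

lemma ModeSolution.sobolevSq_le {T : ℝ} (hT : 0 ≤ T) {a F : ℝ → (Fin d → ℤ) → ℂ}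
    (h : ModeSolution T a F) (s : ℝ) {t : ℝ} (ht : t ∈ Icc 0 T) :
    sobolevSq s (a t) ≤ parabolicBound T s (a 0) F := by
  rw [← tsum_modeBound hT h]
  refine ENNReal.tsum_le_tsum fun k => ?_
  gcongr
  rw [← ofReal_norm, ← ENNReal.ofReal_pow (norm_nonneg _)]
  exact ENNReal.ofReal_le_ofReal (h.norm_sq_le_modeBound k ht)

lemma ModeSolution.lintegral_sobolevSq_le {T : ℝ} (hT : 0 ≤ T) {a F : ℝ → (Fin d → ℤ) → ℂ}
    (h : ModeSolution T a F) (s : ℝ) :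
    ∫⁻ t in Icc 0 T, sobolevSq (s + 1) (a t) ≤ parabolicBound T s (a 0) F := by
  rw [← tsum_modeBound hT h]
  unfold sobolevSq
  rw [lintegral_tsum fun k => (aemeasurable_enorm_sq (h.continuousOn k)).const_mul _]
  refine ENNReal.tsum_le_tsum fun k => ?_
  have hw := weight_pos k
  rw [lintegral_const_mul' _ _ ENNReal.ofReal_ne_top, lintegral_enorm_sq hT (h.continuousOn k),
    Real.rpow_add hw, Real.rpow_one, ENNReal.ofReal_mul (Real.rpow_nonneg hw.le _), mul_assoc,
    ← ENNReal.ofReal_mul hw.le]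
  gcongr
  have h1 := h.energy k ⟨hT, le_rfl⟩
  exact (le_add_of_nonneg_left (sq_nonneg _)).trans h1

/-- Continuity in time with values in the Sobolev space. -/
lemma ModeSolution.tendsto_sobolevSq_sub {T : ℝ} (hT : 0 ≤ T) {a F : ℝ → (Fin d → ℤ) → ℂ}
    (h : ModeSolution T a F) (s : ℝ) (hfin : parabolicBound T s (a 0) F ≠ ⊤) {t₀ : ℝ}
    (ht₀ : t₀ ∈ Icc 0 T) :
    Tendsto (fun t => sobolevSq s (fun k => a t k - a t₀ k)) (𝓝[Icc 0 T] t₀) (𝓝 0) := by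
  let _ : MeasurableSpace (Fin d → ℤ) := ⊤
  -- Dominated convergence over the modes: |x-y|² ≤ 2|x|² + 2|y|² gives four times the mode bound,
  -- which is independent of t and summable by `hfin`.
  have key := tendsto_lintegral_filter_of_dominated_convergence (μ := Measure.count)
    (l := 𝓝[Icc 0 T] t₀)
    (F := fun t k => ENNReal.ofReal ((1 + eigenvalue k) ^ s) * ‖a t k - a t₀ k‖ₑ ^ 2)
    (f := fun _ => 0)
    (fun k => 4 * (ENNReal.ofReal ((1 + eigenvalue k) ^ s) * ENNReal.ofReal (modeBound T a F k)))
    (Eventually.of_forall fun _ => measurable_from_top) ?_ ?_ ?_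
  · simpa only [lintegral_count, tsum_zero, sobolevSq] using key
  · filter_upwards [self_mem_nhdsWithin] with t ht
    refine ae_of_all _ fun k => ?_
    have h1 := h.norm_sq_le_modeBound k ht
    have h2 := h.norm_sq_le_modeBound k ht₀
    have h3 : ‖a t k - a t₀ k‖ ^ 2 ≤ 4 * modeBound T a F k := by
      nlinarith [norm_sub_le (a t k) (a t₀ k), norm_nonneg (a t k - a t₀ k),
        sq_nonneg (‖a t k‖ - ‖a t₀ k‖), norm_nonneg (a t k), norm_nonneg (a t₀ k)]
    calc _ ≤ ENNReal.ofReal ((1 + eigenvalue k) ^ s) * ENNReal.ofReal (4 * modeBound T a F k) := by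
          gcongr
          rw [← ofReal_norm, ← ENNReal.ofReal_pow (norm_nonneg _)]
          exact ENNReal.ofReal_le_ofReal h3
      _ = _ := by
          rw [ENNReal.ofReal_mul (by norm_num)]
          simp only [ENNReal.ofReal_ofNat]
          ring
  · rw [lintegral_count, ENNReal.tsum_mul_left, tsum_modeBound hT h]
    exact ENNReal.mul_ne_top (by simp) hfin
  · refine ae_of_all _ fun k => ?_
    have h1 : Tendsto (fun t => a t k - a t₀ k) (𝓝[Icc 0 T] t₀) (𝓝 (a t₀ k - a t₀ k)) :=
      (h.continuousOn k t₀ ht₀).sub tendsto_const_nhds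
    rw [sub_self] at h1
    have h2 := ((ENNReal.continuous_pow 2).tendsto _).comp ((continuous_enorm.tendsto _).comp h1)
    have h3 := ENNReal.Tendsto.const_mul (a := ENNReal.ofReal ((1 + eigenvalue k) ^ s)) h2
      (Or.inr ENNReal.ofReal_ne_top)
    simpa using h3

/-! ### The modes of a weak solution -/

lemma inner_L2_eq (v w : L2 d) : inner ℝ v w = ∫ x, v x * w x ∂torusMeasure d := by
  rw [L2.inner_def]
  congr 1
  funext x
  simp [mul_comm]

lemma H1.toL2_ofSmooth {φ : Torus d → ℝ} (hφ : IsSmooth φ) :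
    H1.toL2 (H1.ofSmooth φ hφ) =ᵐ[torusMeasure d] φ :=
  (memLp_continuous hφ.continuous).coeFn_toLp

lemma H1.grad_ofSmooth {φ : Torus d → ℝ} (hφ : IsSmooth φ) (i : Fin d) :
    H1.grad (H1.ofSmooth φ hφ) i =ᵐ[torusMeasure d] partialDeriv i φ :=
  (memLp_continuous (hφ.partialDeriv i).continuous).coeFn_toLp

lemma H1.isWeakPartial (v : H1 d) (i : Fin d) : IsWeakPartial i (H1.toL2 v) (H1.grad v i) :=
  v.2 i

lemma integral_mul_congr_right (g : Torus d → ℝ) {v φ : Torus d → ℝ}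
    (h : v =ᵐ[torusMeasure d] φ) :
    ∫ x, g x * v x ∂torusMeasure d = ∫ x, g x * φ x ∂torusMeasure d := by
  refine integral_congr_ae ?_
  filter_upwards [h] with x hx
  rw [hx]

/-- Green's formula. -/
lemma H1.sum_inner_grad (U : H1 d) {φ : Torus d → ℝ} (hφ : IsSmooth φ) :
    ∑ i, inner ℝ (H1.grad U i) (H1.grad (H1.ofSmooth φ hφ) i)
      = -∫ x, H1.toL2 U x * laplacian φ x ∂torusMeasure d := by
  simp only [laplacian, Finset.mul_sum]
  rw [integral_finsetSum _ fun i _ =>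
    integrable_L2_mul _ ((hφ.partialDeriv i).partialDeriv i).continuous, ← Finset.sum_neg_distrib]
  refine Finset.sum_congr rfl fun i _ => ?_
  rw [inner_L2_eq, integral_mul_congr_right _ (H1.grad_ofSmooth hφ i),
    U.isWeakPartial i _ (hφ.partialDeriv i), neg_neg]

section WeakSolution

variable {f : ℝ → ℝ} {T : ℝ} {θ : H1 d} {u : ℝ → L2 d} {u' : ℝ → HNeg1 d}

/-- Green's formula moves both derivatives onto φ. The exceptional null set depends on φ, which is
harmless for the countably many modes. -/
lemma IsWeakSolution.deriv_ofSmooth (h : IsWeakSolution f T θ u u') {φ : Torus d → ℝ}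
    (hφ : IsSmooth φ) : ∀ᵐ t ∂volume.restrict (Icc 0 T), u' t (H1.ofSmooth φ hφ)
      = ∫ x, u t x * laplacian φ x ∂torusMeasure d + ∫ x, f (u t x) * φ x ∂torusMeasure d := by
  obtain ⟨U, -, hU, heq⟩ := h.equation
  filter_upwards [hU, heq (H1.ofSmooth φ hφ)] with t h1 h2
  rw [H1.sum_inner_grad, h1,
    integral_mul_congr_right (fun x => f (u t x)) (H1.toL2_ofSmooth hφ)] at h2
  linarith

lemma continuousOn_integral_mul (hu : ContinuousOn u (Icc 0 T)) {φ : Torus d → ℝ}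
    (hφ : Continuous φ) :
    ContinuousOn (fun t => ∫ x, u t x * φ x ∂torusMeasure d) (Icc 0 T) := by
  have e : (fun t => ∫ x, u t x * φ x ∂torusMeasure d)
      = fun t => inner ℝ (u t) ((memLp_continuous hφ).toLp φ) := by
    funext t
    rw [inner_L2_eq]
    exact (integral_mul_congr_right _ (memLp_continuous hφ).coeFn_toLp).symm
  rw [e]
  exact ContinuousOn.inner (𝕜 := ℝ) hu continuousOn_const

lemma integral_sub_sq (v w : L2 d) : ∫ x, (v x - w x) ^ 2 ∂torusMeasure d = ‖v - w‖ ^ 2 := by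
  rw [← integral_sq_eq_norm_sq]
  refine integral_congr_ae ?_
  filter_upwards [Lp.coeFn_sub v w] with x hx
  rw [hx, Pi.sub_apply]

lemma norm_fcoeff_comp_sub_le (hf : ContDiff ℝ ∞ f) (hfc : HasCompactSupport f)
    {L : ℝ≥0} (hL : LipschitzWith L f) (v w : L2 d) (k : Fin d → ℤ) :
    ‖fcoeff (fun x => f (v x)) k - fcoeff (fun x => f (w x)) k‖ ≤ L * ‖v - w‖ := by
  have h := norm_fcoeff_comp_sub_sq_le hf hfc hL (Lp.memLp v) (Lp.memLp w) k
  rw [integral_sub_sq, ← mul_pow] at h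
  exact (sq_le_sq₀ (norm_nonneg _) (by positivity)).1 h

lemma continuousOn_fcoeff_comp (hf : ContDiff ℝ ∞ f) (hfc : HasCompactSupport f)
    (hu : ContinuousOn u (Icc 0 T)) (k : Fin d → ℤ) :
    ContinuousOn (fun t => fcoeff (fun x => f (u t x)) k) (Icc 0 T) := by
  obtain ⟨L, hL⟩ := exists_lipschitzWith hf hfc
  have : LipschitzWith L fun v : L2 d => fcoeff (fun x => f (v x)) k :=
    LipschitzWith.of_dist_le_mul fun v w => by
      rw [dist_eq_norm, dist_eq_norm]
      exact norm_fcoeff_comp_sub_le hf hfc hL v w k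
  exact this.continuous.comp_continuousOn hu

lemma integrable_comp (hf : ContDiff ℝ ∞ f) (hfc : HasCompactSupport f) (w : L2 d) :
    Integrable (fun x => f (w x)) (torusMeasure d) :=
  (memLp_comp hf hfc (Lp.memLp w).1).integrable (by norm_num)

lemma laplacian_cosMode (k : Fin d → ℤ) (x : Torus d) :
    laplacian (cosMode k) x = -eigenvalue k * cosMode k x := by
  have h : ∀ i, partialDeriv i (partialDeriv i (cosMode k)) x
      = -(2 * Real.pi * k i) ^ 2 * cosMode k x := by
    intro i
    have e : partialDeriv i (cosMode k) = fun x => -(2 * Real.pi * k i) * sinMode k x :=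
      funext (partialDeriv_cosMode k i)
    have h1 := partialDeriv_sinMode k i x
    rw [e, partialDeriv, deriv_const_mul_field]
    rw [partialDeriv] at h1
    rw [h1]
    ring
  rw [laplacian, Finset.sum_congr rfl fun i _ => h i, eigenvalue_eq_sum, ← Finset.sum_neg_distrib,
    Finset.sum_mul]

lemma laplacian_sinMode (k : Fin d → ℤ) (x : Torus d) :
    laplacian (sinMode k) x = -eigenvalue k * sinMode k x := by
  have h : ∀ i, partialDeriv i (partialDeriv i (sinMode k)) x
      = -(2 * Real.pi * k i) ^ 2 * sinMode k x := by
    intro i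
    have e : partialDeriv i (sinMode k) = fun x => (2 * Real.pi * k i) * cosMode k x :=
      funext (partialDeriv_sinMode k i)
    have h1 := partialDeriv_cosMode k i x
    rw [e, partialDeriv, deriv_const_mul_field]
    rw [partialDeriv] at h1
    rw [h1]
    ring
  rw [laplacian, Finset.sum_congr rfl fun i _ => h i, eigenvalue_eq_sum, ← Finset.sum_neg_distrib,
    Finset.sum_mul]

lemma integral_mul_eigen (w : Torus d → ℝ) {φ : Torus d → ℝ} {l : ℝ}
    (hl : ∀ x, laplacian φ x = -l * φ x) :
    ∫ x, w x * laplacian φ x ∂torusMeasure d = -l * ∫ x, w x * φ x ∂torusMeasure d := by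
  rw [← integral_const_mul]
  congr 1
  funext x
  rw [hl]
  ring

/-- The pairing of a weak solution with an eigenfunction solves an ordinary differential
equation. -/
lemma IsWeakSolution.exists_hasDerivAt (hT : 0 < T)
    (h : IsWeakSolution f T θ u u') {φ : Torus d → ℝ} (hφ : IsSmooth φ) {l : ℝ}
    (hl : ∀ x, laplacian φ x = -l * φ x)
    (hF : ContinuousOn (fun t => ∫ x, f (u t x) * φ x ∂torusMeasure d) (Icc 0 T)) :
    ∃ G : ℝ → ℝ, ∀ t ∈ Icc 0 T, G t = ∫ x, u t x * φ x ∂torusMeasure d ∧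
      HasDerivAt G (-l * ∫ x, u t x * φ x ∂torusMeasure d
        + ∫ x, f (u t x) * φ x ∂torusMeasure d) t := by
  have hg := continuousOn_integral_mul h.continuousOn hφ.continuous
  refine exists_hasDerivAt_of_weak_deriv hT hg ((continuousOn_const.mul hg).add hF) ?_
  intro η h1 h2 h3
  have h4 := h.weak_deriv η h1 h2 h3 (H1.ofSmooth φ hφ)
  have e1 : ∀ t, inner ℝ (u t) (H1.toL2 (H1.ofSmooth φ hφ))
      = ∫ x, u t x * φ x ∂torusMeasure d := fun t => by
    rw [inner_L2_eq, integral_mul_congr_right _ (H1.toL2_ofSmooth hφ)]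
  simp only [e1] at h4
  rw [h4]
  congr 1
  refine integral_congr_ae ?_
  filter_upwards [h.deriv_ofSmooth hφ] with t ht
  rw [ht, integral_mul_eigen _ hl]

/-- The Fourier coefficients of the nonlinearity. -/
def sourceCoeff (f : ℝ → ℝ) (u : ℝ → L2 d) (t : ℝ) (k : Fin d → ℤ) : ℂ :=
  fcoeff (fun x => f (u t x)) k

/-- The pairings with cosine and sine solve real equations with the same eigenvalue; cosine minus i
times sine assembles them into the complex coefficient. -/
theorem IsWeakSolution.modeSolution (hT : 0 < T) (hf : ContDiff ℝ ∞ f)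
    (hfc : HasCompactSupport f) (h : IsWeakSolution f T θ u u') :
    ModeSolution T (fun t => L2.coeff (u t)) (sourceCoeff f u) := by
  intro k
  have hF := continuousOn_fcoeff_comp hf hfc h.continuousOn k
  refine ⟨hF, ?_⟩
  have hFre : ∀ t, ∫ x, f (u t x) * cosMode k x ∂torusMeasure d
      = (fcoeff (fun x => f (u t x)) k).re := fun t => by
    rw [fcoeff_eq_cos_sin (integrable_comp hf hfc _)]; simp
  have hFim : ∀ t, ∫ x, f (u t x) * sinMode k x ∂torusMeasure d
      = -(fcoeff (fun x => f (u t x)) k).im := fun t => by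
    rw [fcoeff_eq_cos_sin (integrable_comp hf hfc _)]; simp
  obtain ⟨G, hG⟩ := h.exists_hasDerivAt hT (isSmooth_cosMode k) (laplacian_cosMode k) (by
    simp_rw [hFre]; exact Complex.continuous_re.comp_continuousOn hF)
  obtain ⟨H, hH⟩ := h.exists_hasDerivAt hT (isSmooth_sinMode k) (laplacian_sinMode k) (by
    simp_rw [hFim]; exact (Complex.continuous_im.comp_continuousOn hF).neg)
  refine ⟨fun t => (G t : ℂ) - Complex.I * (H t : ℂ), fun t ht => ⟨?_, ?_⟩⟩
  · change _ = fcoeff (u t) k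
    simp only [fcoeff_eq_cos_sin (u t).integrable, (hG t ht).1, (hH t ht).1]
  · refine ((hG t ht).2.ofReal_comp.sub ((hH t ht).2.ofReal_comp.const_mul Complex.I)).congr_deriv ?_
    simp only [sourceCoeff, fcoeff_eq_cos_sin (integrable_comp hf hfc _), (hG t ht).1, (hH t ht).1]
    push_cast
    ring

lemma IsWeakSolution.coeff_deriv (hf : ContDiff ℝ ∞ f)
    (hfc : HasCompactSupport f) (h : IsWeakSolution f T θ u u') :
    ∀ᵐ t ∂volume.restrict (Icc 0 T), ∀ k, HNeg1.coeff (u' t) k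
      = -(eigenvalue k : ℂ) * L2.coeff (u t) k + sourceCoeff f u t k := by
  refine ae_all_iff.2 fun k => ?_
  filter_upwards [h.deriv_ofSmooth (isSmooth_cosMode k), h.deriv_ofSmooth (isSmooth_sinMode k)]
    with t h1 h2
  rw [HNeg1.coeff, h1, h2, integral_mul_eigen _ (laplacian_cosMode k),
    integral_mul_eigen _ (laplacian_sinMode k), sourceCoeff, L2.coeff_eq_fcoeff,
    fcoeff_eq_cos_sin (integrable_comp hf hfc _), fcoeff_eq_cos_sin (u t).integrable]
  push_cast
  ring

/-- Sobolev bounds for the nonlinearity, uniformly in the solution. -/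
theorem exists_sobolevSq_source_le (hT : 0 < T) (hf : ContDiff ℝ ∞ f)
    (hfc : HasCompactSupport f) (γ : ℝ) (B : ℝ≥0∞) (hB : B < ⊤) (n : ℕ) (hn : 2 ≤ n → d ≤ 3)
    (hnγ : (n : ℝ) ≤ γ) :
    ∃ K < ⊤, ∀ (θ : H1 d) (u : ℝ → L2 d) (u' : ℝ → HNeg1 d), IsWeakSolution f T θ u u' →
      sobolevSq γ (L2.coeff (H1.toL2 θ)) ≤ B → ∀ t ∈ Icc 0 T,
        sobolevSq n (sourceCoeff f u t) ≤ K := by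
  induction n with
  | zero =>
    obtain ⟨M, hM⟩ := exists_bound_of_hasCompactSupport hf hfc
    refine ⟨ENNReal.ofReal (M ^ 2), ENNReal.ofReal_lt_top, fun θ u u' _ _ t _ => ?_⟩
    rw [Nat.cast_zero]
    exact sobolevSq_zero_le (memLp_comp hf hfc (Lp.memLp (u t)).1).1 fun x => hM _
  | succ n ih =>
    push_cast at hnγ
    obtain ⟨K, hK, h⟩ := ih (fun h => hn (by omega)) (by linarith)
    -- The number fed to the composition estimate is the parabolic bound at order n+1, with the
    -- source bounded by K in H^n over the whole time interval.
    obtain ⟨K', hK', h'⟩ := sobolevSq_comp (d := d) (n + 1) hn hf hfc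
      (K := ENNReal.ofReal (Real.exp (2 * T)) * (B + K * volume (Icc 0 T)))
      (ENNReal.mul_lt_top ENNReal.ofReal_lt_top
        (ENNReal.add_lt_top.2 ⟨hB, ENNReal.mul_lt_top hK measure_Icc_lt_top⟩))
    refine ⟨K', hK', fun θ u u' hu hθ t ht => h' (u t) ?_⟩
    refine ((hu.modeSolution hT hf hfc).sobolevSq_le hT.le _ ht).trans ?_
    unfold parabolicBound
    rw [hu.initial]
    gcongr
    · refine (sobolevSq_mono_exponent ?_ _).trans hθ
      push_cast
      exact hnγ
    · rw [← setLIntegral_const]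
      refine setLIntegral_mono measurable_const fun s hs => ?_
      push_cast
      rw [add_sub_cancel_right]
      exact h θ u u' hu hθ s hs

end WeakSolution

/-! ### Sobolev estimates for weak solutions -/

lemma sobolevSq_eigenvalue_mul_le (s : ℝ) (c : (Fin d → ℤ) → ℂ) :
    sobolevSq s (fun k => -(eigenvalue k : ℂ) * c k) ≤ sobolevSq (s + 2) c := by
  refine ENNReal.tsum_le_tsum fun k => ?_
  have hw := weight_pos k
  have h1 : ‖(-(eigenvalue k : ℂ))‖ₑ ^ 2 ≤ ENNReal.ofReal ((1 + eigenvalue k) ^ 2) := by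
    rw [← ofReal_norm, ← ENNReal.ofReal_pow (norm_nonneg _)]
    refine ENNReal.ofReal_le_ofReal ?_
    rw [norm_neg, Complex.norm_real, Real.norm_of_nonneg (eigenvalue_nonneg k)]
    have := eigenvalue_nonneg k
    gcongr
    linarith
  rw [enorm_mul, mul_pow, Real.rpow_add hw, Real.rpow_two,
    ENNReal.ofReal_mul (Real.rpow_nonneg hw.le _), mul_assoc]
  gcongr

lemma sobolevSq_le_of_sobolevNorm_le {s : ℝ} {c : (Fin d → ℤ) → ℂ} {K : ℝ≥0∞}
    (h : sobolevNorm s c ≤ K) : sobolevSq s c ≤ K ^ 2 := by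
  rw [← sobolevNorm_sq]
  gcongr

lemma sobolevNorm_le_of_sobolevSq_le {s : ℝ} {c : (Fin d → ℤ) → ℂ} {K : ℝ≥0∞}
    (h : sobolevSq s c ≤ K) : sobolevNorm s c ≤ K ^ (1 / 2 : ℝ) := by
  rw [sobolevNorm_eq]
  gcongr

/-- The Sobolev bounds of a weak solution, with constants depending only on the data. -/
theorem exists_parabolicBound {f : ℝ → ℝ} (hf : ContDiff ℝ ∞ f) (hfc : HasCompactSupport f)
    {T : ℝ} (hT : 0 < T) {γ : ℝ} (hγ : 0 ≤ γ) (hγd : 2 < γ → d ≤ 3) {B : ℝ≥0∞} (hB : B < ⊤) :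
    ∃ R < ⊤, ∃ K < ⊤, ∀ (θ : H1 d) (u : ℝ → L2 d) (u' : ℝ → HNeg1 d),
      IsWeakSolution f T θ u u' → sobolevSq γ (L2.coeff (H1.toL2 θ)) ≤ B →
      parabolicBound T γ (L2.coeff (u 0)) (sourceCoeff f u) ≤ R ∧
      ∀ t ∈ Icc 0 T, sobolevSq (γ - 1) (sourceCoeff f u t) ≤ K := by
  -- The bootstrap stops at N = ⌈γ⌉₊ - 1, truncated to 0 when γ = 0, so that γ-1 ≤ N ≤ γ. If N ≥ 2
  -- then γ > 2, which is exactly when d ≤ 3 is known.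
  have hn0 : (⌈γ⌉₊ : ℝ) < γ + 1 := Nat.ceil_lt_add_one hγ
  have hn1 : γ ≤ ⌈γ⌉₊ := Nat.le_ceil γ
  have hn2 : (⌈γ⌉₊ : ℝ) ≤ ((⌈γ⌉₊ - 1 : ℕ) : ℝ) + 1 := by
    exact_mod_cast (by omega : ⌈γ⌉₊ ≤ (⌈γ⌉₊ - 1) + 1)
  have hn3 : ((⌈γ⌉₊ - 1 : ℕ) : ℝ) ≤ γ := by
    rcases Nat.eq_zero_or_pos ⌈γ⌉₊ with h | h
    · simpa [h] using hγ
    · rw [Nat.cast_sub h, Nat.cast_one]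
      linarith
  obtain ⟨K, hK, h⟩ := exists_sobolevSq_source_le (d := d) hT hf hfc γ B hB (⌈γ⌉₊ - 1)
    (fun h => hγd (by exact_mod_cast Nat.lt_ceil.1 (show 2 < ⌈γ⌉₊ by omega))) hn3
  refine ⟨ENNReal.ofReal (Real.exp (2 * T)) * (B + K * volume (Icc 0 T)),
    ENNReal.mul_lt_top ENNReal.ofReal_lt_top
      (ENNReal.add_lt_top.2 ⟨hB, ENNReal.mul_lt_top hK measure_Icc_lt_top⟩),
    K, hK, fun θ u u' hu hθ => ?_⟩
  have h1 : ∀ t ∈ Icc 0 T, sobolevSq (γ - 1) (sourceCoeff f u t) ≤ K := fun t ht =>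
    (sobolevSq_mono_exponent (by linarith) _).trans (h θ u u' hu hθ t ht)
  refine ⟨?_, h1⟩
  unfold parabolicBound
  rw [hu.initial, ← setLIntegral_const]
  exact mul_le_mul' le_rfl (add_le_add hθ (setLIntegral_mono measurable_const h1))

/-- The Sobolev part of the regularity theorem. -/
theorem exists_sobolev_bounds {f : ℝ → ℝ} (hf : ContDiff ℝ ∞ f) (hfc : HasCompactSupport f)
    {T : ℝ} (hT : 0 < T) {γ : ℝ} (hγ : 0 ≤ γ) (hγd : 2 < γ → d ≤ 3) (B : ℝ) :
    ∃ C C' : ℝ≥0, ∀ (θ : H1 d) (u : ℝ → L2 d) (u' : ℝ → HNeg1 d),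
      IsWeakSolution f T θ u u' → L2.hNorm γ (H1.toL2 θ) ≤ ENNReal.ofReal B →
      (∫⁻ t in Icc 0 T, L2.hNorm (γ + 1) (u t) ^ 2) + (⨆ t ∈ Icc 0 T, L2.hNorm γ (u t)) ≤ C ∧
      (∫⁻ t in Icc 0 T, HNeg1.hNorm (γ - 1) (u' t) ^ 2)
        + essSup (fun t => HNeg1.hNorm (γ - 2) (u' t)) (volume.restrict (Icc 0 T)) ≤ C' ∧
      (∀ t₀ ∈ Icc 0 T,
        Tendsto (fun t => L2.hNorm γ (u t - u t₀)) (𝓝[Icc 0 T] t₀) (𝓝 0)) := by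
  obtain ⟨R, hR, K, hK, h⟩ := exists_parabolicBound (d := d) hf hfc hT hγ hγd
    (B := ENNReal.ofReal B ^ 2) (ENNReal.pow_lt_top ENNReal.ofReal_lt_top)
  have h2 : (2 : ℝ≥0∞) < ⊤ := by simp
  have hroot : ∀ {x : ℝ≥0∞}, x < ⊤ → x ^ (1 / 2 : ℝ) < ⊤ := fun hx =>
    ENNReal.rpow_lt_top_of_nonneg (by norm_num) hx.ne
  have hC : R + R ^ (1 / 2 : ℝ) < ⊤ := ENNReal.add_lt_top.2 ⟨hR, hroot hR⟩
  have hS : 2 * R + 2 * K < ⊤ :=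
    ENNReal.add_lt_top.2 ⟨ENNReal.mul_lt_top h2 hR, ENNReal.mul_lt_top h2 hK⟩
  have hC' : (2 * R + 2 * K * volume (Icc 0 T)) + (2 * R + 2 * K) ^ (1 / 2 : ℝ) < ⊤ :=
    ENNReal.add_lt_top.2 ⟨ENNReal.add_lt_top.2 ⟨ENNReal.mul_lt_top h2 hR,
      ENNReal.mul_lt_top (ENNReal.mul_lt_top h2 hK) measure_Icc_lt_top⟩, hroot hS⟩
  refine ⟨(R + R ^ (1 / 2 : ℝ)).toNNReal,
    ((2 * R + 2 * K * volume (Icc 0 T)) + (2 * R + 2 * K) ^ (1 / 2 : ℝ)).toNNReal,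
    fun θ u u' hu hθ => ?_⟩
  rw [ENNReal.coe_toNNReal hC.ne, ENNReal.coe_toNNReal hC'.ne]
  obtain ⟨hp, hF⟩ := h θ u u' hu (sobolevSq_le_of_sobolevNorm_le hθ)
  have hm := hu.modeSolution hT hf hfc
  have hint : ∫⁻ t in Icc 0 T, sobolevSq (γ + 1) (L2.coeff (u t)) ≤ R :=
    (hm.lintegral_sobolevSq_le hT.le γ).trans hp
  have hsup : ∀ t ∈ Icc 0 T, sobolevSq γ (L2.coeff (u t)) ≤ R := fun t ht =>
    (hm.sobolevSq_le hT.le γ ht).trans hp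
  -- In coefficients u' = -λu + F, so u' at order s costs u at order s+2 and the source at order s;
  -- this is used with s = γ-1 and s = γ-2.
  have hder : ∀ᵐ t ∂volume.restrict (Icc 0 T), t ∈ Icc 0 T ∧ ∀ s,
      sobolevSq s (HNeg1.coeff (u' t)) ≤ 2 * sobolevSq (s + 2) (L2.coeff (u t))
        + 2 * sobolevSq s (sourceCoeff f u t) := by
    filter_upwards [hu.coeff_deriv hf hfc, ae_restrict_mem measurableSet_Icc] with t ht htm
    refine ⟨htm, fun s => ?_⟩
    rw [funext ht]
    refine (sobolevSq_add_le _ _ _).trans ?_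
    gcongr
    exact sobolevSq_eigenvalue_mul_le _ _
  refine ⟨add_le_add ?_ (iSup₂_le fun t ht => sobolevNorm_le_of_sobolevSq_le (hsup t ht)),
    add_le_add ?_ (essSup_le_of_ae_le _ ?_), fun t₀ ht₀ => ?_⟩
  · simp only [L2.hNorm, sobolevNorm_sq]
    exact hint
  · simp only [HNeg1.hNorm, sobolevNorm_sq]
    calc ∫⁻ t in Icc 0 T, sobolevSq (γ - 1) (HNeg1.coeff (u' t))
        ≤ ∫⁻ t in Icc 0 T, (2 * sobolevSq (γ + 1) (L2.coeff (u t)) + 2 * K) := by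
          refine lintegral_mono_ae ?_
          filter_upwards [hder] with t ht
          have := ht.2 (γ - 1)
          rw [show γ - 1 + 2 = γ + 1 by ring] at this
          refine this.trans ?_
          gcongr
          exact hF t ht.1
      _ ≤ _ := by
          rw [lintegral_add_right _ measurable_const, lintegral_const_mul' _ _ h2.ne,
            setLIntegral_const]
          gcongr
  · filter_upwards [hder] with t ht
    refine sobolevNorm_le_of_sobolevSq_le ((ht.2 (γ - 2)).trans ?_)
    rw [show γ - 2 + 2 = γ by ring]
    gcongr
    · exact hsup t ht.1
    · exact (sobolevSq_mono_exponent (by linarith) _).trans (hF t ht.1)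
  · have h1 := hm.tendsto_sobolevSq_sub hT.le γ (hp.trans_lt hR).ne ht₀
    have h3 := (ENNReal.continuous_rpow_const (y := (1 / 2 : ℝ))).tendsto 0 |>.comp h1
    rw [ENNReal.zero_rpow_of_pos (by norm_num)] at h3
    refine h3.congr fun t => ?_
    rw [L2.hNorm, sobolevNorm_eq, show L2.coeff (u t - u t₀)
      = fun k => L2.coeff (u t) k - L2.coeff (u t₀) k from funext (L2.coeff_sub _ _)]
    rfl

section HeatSup

open ProbabilityTheory

/-! ### Gaussian averages and sup norm estimates for the heat semigroup -/

lemma norm_exp_derivSymbol (i : Fin d) (k : Fin d → ℤ) (s : ℝ) :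
    ‖Complex.exp (derivSymbol i k * s)‖ = 1 := by
  have : derivSymbol i k * s = ((2 * Real.pi * k i * s : ℝ) : ℂ) * Complex.I := by
    simp [derivSymbol]; ring
  rw [this, Complex.norm_exp_ofReal_mul_I]

/-- Averaging a Fourier series along a coordinate direction. -/
lemma integral_mul_series_shift {c : (Fin d → ℤ) → ℂ} (hc : Summable fun k => ‖c k‖)
    (ν : Measure ℝ) {p : ℝ → ℝ} (hp : Integrable p ν) (i : Fin d) (x : Torus d) :
    ∫ z, p z * series c (x + toTorus d (EuclideanSpace.single i z)) ∂ν
      = series (fun k => (∫ z, (p z : ℂ) * Complex.exp (derivSymbol i k * z) ∂ν) * c k) x := by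
  set G : (Fin d → ℤ) → ℝ → ℂ := fun k z =>
    (p z : ℂ) * Complex.exp (derivSymbol i k * z) * (c k * mFourier k x) with hG
  have hcont : ∀ k, Continuous fun z : ℝ => Complex.exp (derivSymbol i k * z) := by
    intro k; fun_prop
  have hint : ∀ k, Integrable (G k) ν := fun k => by
    refine Integrable.mul_const (hp.ofReal.mul_bdd (c := 1) (hcont k).aestronglyMeasurable
      (ae_of_all _ fun z => (norm_exp_derivSymbol i k z).le)) _
  have hnorm : ∀ k z, ‖G k z‖ = ‖p z‖ * ‖c k‖ := fun k z => by
    simp only [hG, norm_mul, norm_exp_derivSymbol, norm_mFourier_apply, Complex.norm_real, mul_one]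
  have hsum : Summable fun k => ∫ z, ‖G k z‖ ∂ν := by
    simp_rw [hnorm, integral_mul_const]
    exact hc.mul_left _
  have h1 := hasSum_integral_of_summable_integral_norm hint hsum
  have h2 : ∀ z, p z * series c (x + toTorus d (EuclideanSpace.single i z))
      = (∑' k, G k z).re := by
    intro z
    have : ∑' k, G k z = (p z : ℂ) * ∑' k, c k * mFourier k (x + toTorus d
        (EuclideanSpace.single i z)) := by
      rw [← tsum_mul_left]
      refine tsum_congr fun k => ?_
      rw [mFourier_shift]
      simp only [hG]
      ring
    rw [this, Complex.re_ofReal_mul, series]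
  have hint' : Integrable (fun z => ∑' k, G k z) ν := by
    have e : (fun z => ∑' k, G k z) = fun z => (p z : ℂ) * ∑' k, c k * mFourier k (x + toTorus d
        (EuclideanSpace.single i z)) := by
      funext z
      rw [← tsum_mul_left]
      refine tsum_congr fun k => ?_
      rw [mFourier_shift]
      simp only [hG]
      ring
    rw [e]
    refine hp.ofReal.mul_bdd (c := ∑' k, ‖c k‖) (Continuous.aestronglyMeasurable ?_)
      (ae_of_all _ fun z => ?_)
    · simp_rw [mFourier_shift]
      refine continuous_tsum (u := fun k => ‖c k‖) (fun k => ?_) hc fun k z => ?_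
      · exact continuous_const.mul (continuous_const.mul (hcont k))
      · rw [norm_mul, norm_mul, norm_mFourier_apply, norm_exp_derivSymbol, one_mul, mul_one]
    · refine tsum_of_norm_bounded hc.hasSum fun k => ?_
      rw [norm_mul, norm_mFourier_apply, mul_one]
  simp_rw [h2]
  have h3 := integral_re hint'
  simp only [RCLike.re_to_complex] at h3
  rw [h3, ← h1.tsum_eq, series]
  congr 1
  refine tsum_congr fun k => ?_
  simp only [hG]
  rw [integral_mul_const]
  ring

/-- The multiplier is a superposition of translations with density p, so its sup norm is at most the
L¹ norm of p. -/
lemma abs_series_average_le {c : (Fin d → ℤ) → ℂ} (hc : Summable fun k => ‖c k‖)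
    (ν : Measure ℝ) {p : ℝ → ℝ} (hp : Integrable p ν) (i : Fin d) {K : ℝ}
    (hK : ∀ x, |series c x| ≤ K) (x : Torus d) :
    |series (fun k => (∫ z, (p z : ℂ) * Complex.exp (derivSymbol i k * z) ∂ν) * c k) x|
      ≤ (∫ z, |p z| ∂ν) * K := by
  rw [← integral_mul_series_shift hc ν hp, ← integral_mul_const]
  rw [← Real.norm_eq_abs]
  refine norm_integral_le_of_norm_le (g := fun z => |p z| * K) (hp.norm.mul_const K)
    (ae_of_all _ fun z => ?_)
  rw [norm_mul]
  exact mul_le_mul_of_nonneg_left (hK _) (norm_nonneg _)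

/-- The multiplier of the heat semigroup at time `t` in the direction `i`. -/
def directionalHeat (t : ℝ) (i : Fin d) (k : Fin d → ℤ) : ℝ :=
  Real.exp (-((2 * Real.pi * k i) ^ 2 * t))

lemma exp_derivSymbol_sq (t : ℝ≥0) (i : Fin d) (k : Fin d → ℤ) :
    Complex.exp ((2 * t : ℝ≥0) * derivSymbol i k ^ 2 / 2) = (directionalHeat t i k : ℂ) := by
  rw [directionalHeat, Complex.ofReal_exp]
  congr 1
  simp only [derivSymbol, mul_pow, Complex.I_sq]
  push_cast
  ring

/-- The Gaussian of variance 2t is the one-dimensional heat kernel at time t: its moment generating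
function at 2πi k_i is e^{-(2πk_i)²t}. -/
lemma integral_exp_derivSymbol (t : ℝ≥0) (i : Fin d) (k : Fin d → ℤ) :
    ∫ z, Complex.exp (derivSymbol i k * z) ∂gaussianReal 0 (2 * t)
      = (directionalHeat t i k : ℂ) := by
  have h := complexMGF_id_gaussianReal (μ := 0) (v := 2 * t) (derivSymbol i k)
  rw [complexMGF] at h
  simp only [id, Complex.ofReal_zero, mul_zero, zero_add] at h
  rw [h, exp_derivSymbol_sq]

/-- Differentiating the moment generating function brings down 2t times the symbol, so the density
z/(2t) realises ∂_i composed with the directional heat flow. -/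
lemma integral_id_mul_exp_derivSymbol (t : ℝ≥0) (i : Fin d) (k : Fin d → ℤ) :
    ∫ z : ℝ, (z : ℂ) * Complex.exp (derivSymbol i k * z) ∂gaussianReal 0 (2 * t)
      = (2 * t : ℝ) * derivSymbol i k * (directionalHeat t i k : ℂ) := by
  have h1 := hasDerivAt_complexMGF (X := id) (μ := gaussianReal 0 (2 * t)) (z := derivSymbol i k)
    (by rw [integrableExpSet_id_gaussianReal]; simp)
  have e : complexMGF id (gaussianReal 0 (2 * t))
      = fun z => Complex.exp ((2 * t : ℝ≥0) * z ^ 2 / 2) := by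
    funext z
    rw [complexMGF_id_gaussianReal]
    simp
  rw [e] at h1
  have h2 : HasDerivAt (fun z : ℂ => Complex.exp ((2 * t : ℝ≥0) * z ^ 2 / 2))
      (Complex.exp ((2 * t : ℝ≥0) * derivSymbol i k ^ 2 / 2) *
        ((2 * t : ℝ≥0) * (2 * derivSymbol i k) / 2)) (derivSymbol i k) := by
    have := (((hasDerivAt_id (derivSymbol i k)).pow 2).const_mul ((2 * t : ℝ≥0) : ℂ)).div_const 2
    refine (this.cexp).congr_deriv ?_
    simp
  have h3 := h1.unique h2
  simp only [id] at h3
  rw [h3, exp_derivSymbol_sq]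
  push_cast
  ring

/-- By |z| ≤ z²/(2√v) + √v/2 and the second moment v. -/
lemma integral_abs_gaussianReal_le {v : ℝ≥0} (hv : v ≠ 0) :
    ∫ z, |z| ∂gaussianReal 0 v ≤ √v := by
  have hv' : (0 : ℝ) < v := by exact_mod_cast pos_iff_ne_zero.2 hv
  have hs : 0 < √(v : ℝ) := Real.sqrt_pos.2 hv'
  have hm : MemLp (fun z : ℝ => z) 2 (gaussianReal 0 v) := memLp_id_gaussianReal 2
  have h2 : ∫ z, z ^ 2 ∂gaussianReal 0 v = v := by
    have h := variance_fun_id_gaussianReal (μ := 0) (v := v)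
    rw [variance_eq_integral measurable_id'.aemeasurable] at h
    simpa [integral_id_gaussianReal] using h
  calc ∫ z, |z| ∂gaussianReal 0 v
      ≤ ∫ z, (z ^ 2 * (2 * √(v : ℝ))⁻¹ + √(v : ℝ) / 2) ∂gaussianReal 0 v := by
        refine integral_mono (hm.integrable (by norm_num)).abs
          ((hm.integrable_sq.mul_const _).add (integrable_const _)) fun z => ?_
        simp only
        rw [← sub_nonneg]
        have : z ^ 2 * (2 * √(v : ℝ))⁻¹ + √(v : ℝ) / 2 - |z|
            = (|z| - √(v : ℝ)) ^ 2 * (2 * √(v : ℝ))⁻¹ := by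
          rw [← sq_abs z]
          field_simp
          ring
        rw [this]
        positivity
    _ = √v := by
        rw [integral_add (hm.integrable_sq.mul_const _) (integrable_const _), integral_mul_const, h2]
        simp only [integral_const, probReal_univ, one_smul]
        have : √(v : ℝ) ^ 2 = v := Real.sq_sqrt hv'.le
        field_simp
        linarith

lemma abs_series_directionalHeat_le {c : (Fin d → ℤ) → ℂ} (hc : Summable fun k => ‖c k‖)
    {K : ℝ} (hK : ∀ x, |series c x| ≤ K) {t : ℝ} (ht : 0 < t) (i : Fin d) (x : Torus d) :
    |series (fun k => (directionalHeat t i k : ℂ) * c k) x| ≤ K := by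
  lift t to ℝ≥0 using ht.le
  have h := abs_series_average_le hc (gaussianReal 0 (2 * t)) (p := fun _ => 1)
    (integrable_const _) i hK x
  simpa [integral_exp_derivSymbol] using h

/-- Averaging with density z/(2t) has norm at most (2t)⁻¹√(2t) = (2t)^{-1/2}. -/
lemma abs_series_deriv_directionalHeat_le {c : (Fin d → ℤ) → ℂ} (hc : Summable fun k => ‖c k‖)
    {K : ℝ} (hK : ∀ x, |series c x| ≤ K) {t : ℝ} (ht : 0 < t) (i : Fin d) (x : Torus d) :
    |series (fun k => derivSymbol i k * ((directionalHeat t i k : ℂ) * c k)) x|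
      ≤ (√(2 * t))⁻¹ * K := by
  lift t to ℝ≥0 using ht.le
  have ht' : (0 : ℝ) < 2 * (t : ℝ) := by positivity
  have hK0 : 0 ≤ K := (abs_nonneg _).trans (hK x)
  have hv : (2 * t : ℝ≥0) ≠ 0 := by
    intro h0
    have : ((2 * t : ℝ≥0) : ℝ) = 0 := by rw [h0]; rfl
    push_cast at this
    linarith
  have hm : Integrable (fun z : ℝ => z) (gaussianReal 0 (2 * t)) :=
    (memLp_id_gaussianReal (μ := 0) (v := 2 * t) 1).integrable (by norm_num)
  have h := abs_series_average_le hc (gaussianReal 0 (2 * t))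
    (p := fun z => (2 * (t : ℝ))⁻¹ * z) (hm.const_mul _) i hK x
  have e1 : ∀ k, ∫ z : ℝ, (((2 * (t : ℝ))⁻¹ * z : ℝ) : ℂ) * Complex.exp (derivSymbol i k * z)
      ∂gaussianReal 0 (2 * t) = derivSymbol i k * (directionalHeat t i k : ℂ) := by
    intro k
    have : ∀ z : ℝ, (((2 * (t : ℝ))⁻¹ * z : ℝ) : ℂ) * Complex.exp (derivSymbol i k * z)
        = ((2 * (t : ℝ))⁻¹ : ℝ) * ((z : ℂ) * Complex.exp (derivSymbol i k * z)) := by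
      intro z; push_cast; ring
    simp_rw [this]
    rw [integral_const_mul, integral_id_mul_exp_derivSymbol, mul_assoc, ← mul_assoc,
      ← Complex.ofReal_mul, inv_mul_cancel₀ ht'.ne', Complex.ofReal_one, one_mul]
  simp_rw [e1, mul_assoc] at h
  refine h.trans (mul_le_mul_of_nonneg_right ?_ hK0)
  simp_rw [abs_mul, abs_of_pos (inv_pos.2 ht')]
  rw [integral_const_mul]
  have h3 := integral_abs_gaussianReal_le hv
  push_cast at h3
  calc _ ≤ (2 * (t : ℝ))⁻¹ * √(2 * (t : ℝ)) := by gcongr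
    _ = _ := by
      have := Real.sqrt_pos.2 ht'
      have h4 := Real.mul_self_sqrt ht'.le
      rw [eq_comm, inv_eq_iff_eq_inv, mul_inv, inv_inv, ← div_eq_mul_inv, eq_div_iff this.ne']
      exact h4

lemma abs_series_prod_directionalHeat_le {c : (Fin d → ℤ) → ℂ} (hc : Summable fun k => ‖c k‖)
    {K : ℝ} (hK : ∀ x, |series c x| ≤ K) {t : ℝ} (ht : 0 < t) (A : Finset (Fin d)) :
    (Summable fun k => ‖((∏ j ∈ A, directionalHeat t j k : ℝ) : ℂ) * c k‖) ∧ ∀ x : Torus d,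
    |series (fun k => ((∏ j ∈ A, directionalHeat t j k : ℝ) : ℂ) * c k) x| ≤ K := by
  induction A using Finset.induction_on with
  | empty => simpa using ⟨hc, hK⟩
  | insert i A hi ih =>
    have e : ∀ k, ((∏ j ∈ insert i A, directionalHeat t j k : ℝ) : ℂ) * c k
        = (directionalHeat t i k : ℂ) * (((∏ j ∈ A, directionalHeat t j k : ℝ) : ℂ) * c k) := by
      intro k
      rw [Finset.prod_insert hi]
      push_cast
      ring
    simp_rw [e]
    refine ⟨ih.1.of_nonneg_of_le (fun _ => norm_nonneg _) fun k => ?_,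
      fun x => abs_series_directionalHeat_le ih.1 ih.2 ht i x⟩
    rw [norm_mul]
    refine mul_le_of_le_one_left (norm_nonneg _) ?_
    rw [Complex.norm_real, directionalHeat, Real.norm_of_nonneg (Real.exp_pos _).le,
      Real.exp_le_one_iff]
    have : 0 ≤ (2 * Real.pi * k i) ^ 2 * t := by positivity
    linarith

lemma prod_directionalHeat (t : ℝ) (k : Fin d → ℤ) :
    ∏ j, directionalHeat t j k = Real.exp (-(eigenvalue k * t)) := by
  simp only [directionalHeat]
  rw [← Real.exp_sum, Finset.sum_neg_distrib, ← Finset.sum_mul, eigenvalue_eq_sum]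

/-- The heat semigroup is a contraction in the sup norm. -/
lemma abs_series_heatCoeff_le {c : (Fin d → ℤ) → ℂ} (hc : Summable fun k => ‖c k‖)
    {K : ℝ} (hK : ∀ x, |series c x| ≤ K) {t : ℝ} (ht : 0 < t) (x : Torus d) :
    |series (heatCoeff t c) x| ≤ K := by
  have h := (abs_series_prod_directionalHeat_le hc hK ht Finset.univ).2 x
  simp_rw [prod_directionalHeat] at h
  exact h

/-- The gradient estimate for the heat semigroup in the sup norm. -/
lemma abs_series_deriv_heatCoeff_le {c : (Fin d → ℤ) → ℂ} (hc : Summable fun k => ‖c k‖)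
    {K : ℝ} (hK : ∀ x, |series c x| ≤ K) {t : ℝ} (ht : 0 < t) (i : Fin d) (x : Torus d) :
    |series (fun k => derivSymbol i k * heatCoeff t c k) x| ≤ (√(2 * t))⁻¹ * K := by
  -- The other coordinates act as contractions; only direction i pays for the derivative.
  have h1 := abs_series_prod_directionalHeat_le hc hK ht (Finset.univ.erase i)
  have h2 := abs_series_deriv_directionalHeat_le h1.1 h1.2 ht i x
  have e : ∀ k, (directionalHeat t i k : ℂ) *
      (((∏ j ∈ Finset.univ.erase i, directionalHeat t j k : ℝ) : ℂ) * c k) = heatCoeff t c k := by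
    intro k
    rw [heatCoeff, ← prod_directionalHeat, ← Finset.mul_prod_erase _ _ (Finset.mem_univ i)]
    push_cast
    ring
  simp_rw [e] at h2
  exact h2

end HeatSup

/-! ### Sup norm bounds for all partial derivatives of a Fourier series -/

/-- All partial derivatives of order at most `m` of the Fourier series with coefficients `c` are
bounded by `K`. -/
def SupBound : ℕ → ℝ → ((Fin d → ℤ) → ℂ) → Prop
  | 0, K, c => ∀ x, |series c x| ≤ K
  | m + 1, K, c => (∀ x, |series c x| ≤ K) ∧ ∀ i, SupBound m K (fun k => derivSymbol i k * c k)

lemma SupBound.abs_series_le {m : ℕ} {K : ℝ} {c : (Fin d → ℤ) → ℂ} (h : SupBound m K c)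
    (x : Torus d) : |series c x| ≤ K := by
  cases m with
  | zero => exact h x
  | succ m => exact h.1 x

lemma SupBound.mono {m : ℕ} {K L : ℝ} (hKL : K ≤ L) {c : (Fin d → ℤ) → ℂ}
    (h : SupBound m K c) : SupBound m L c := by
  induction m generalizing c with
  | zero => exact fun x => (h x).trans hKL
  | succ m ih => exact ⟨fun x => (h.1 x).trans hKL, fun i => ih (h.2 i)⟩

lemma SupBound.of_succ {m : ℕ} {K : ℝ} {c : (Fin d → ℤ) → ℂ} (h : SupBound (m + 1) K c) :
    SupBound m K c := by
  induction m generalizing c with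
  | zero => exact h.1
  | succ m ih => exact ⟨h.1, fun i => ih (h.2 i)⟩

lemma SupBound.nonneg {m : ℕ} {K : ℝ} {c : (Fin d → ℤ) → ℂ} (h : SupBound m K c) : 0 ≤ K :=
  (abs_nonneg _).trans (h.abs_series_le 0)

lemma series_add {c e : (Fin d → ℤ) → ℂ} (hc : Summable fun k => ‖c k‖)
    (he : Summable fun k => ‖e k‖) (x : Torus d) :
    series (fun k => c k + e k) x = series c x + series e x := by
  simp only [series, add_mul]
  rw [(summable_mul_mFourier hc x).tsum_add (summable_mul_mFourier he x), Complex.add_re]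

lemma SupBound.add {m : ℕ} {K L : ℝ} {c e : (Fin d → ℤ) → ℂ} (hc : RapidDecay c)
    (he : RapidDecay e) (h : SupBound m K c) (h' : SupBound m L e) :
    SupBound m (K + L) (fun k => c k + e k) := by
  have h0 : ∀ x, |series (fun k => c k + e k) x| ≤ K + L := fun x => by
    rw [series_add hc.summable_norm he.summable_norm]
    exact (abs_add_le _ _).trans (add_le_add (h.abs_series_le x) (h'.abs_series_le x))
  induction m generalizing c e with
  | zero => exact h0
  | succ m ih =>
    refine ⟨h0, fun i => ?_⟩
    simp_rw [mul_add]
    refine ih (hc.derivSymbol_mul i) (he.derivSymbol_mul i) (h.2 i) (h'.2 i) fun x => ?_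
    rw [series_add (hc.derivSymbol_mul i).summable_norm (he.derivSymbol_mul i).summable_norm]
    exact (abs_add_le _ _).trans (add_le_add ((h.2 i).abs_series_le x) ((h'.2 i).abs_series_le x))

lemma exists_supBound (m : ℕ) {c : (Fin d → ℤ) → ℂ} (hc : RapidDecay c) :
    ∃ K, SupBound m K c := by
  induction m generalizing c with
  | zero => exact ⟨_, PeriodicRD.abs_series_le hc.summable_norm⟩
  | succ m ih =>
    choose K hK using fun i => ih (hc.derivSymbol_mul i)
    have hKn : ∀ i, 0 ≤ K i := fun i => (hK i).nonneg
    have h0 : 0 ≤ ∑' k, ‖c k‖ := tsum_nonneg fun _ => norm_nonneg _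
    refine ⟨∑' k, ‖c k‖ + ∑ i, K i, fun x => (PeriodicRD.abs_series_le hc.summable_norm x).trans
      (le_add_of_nonneg_right (Finset.sum_nonneg fun i _ => hKn i)), fun i => (hK i).mono ?_⟩
    have := Finset.single_le_sum (fun i _ => hKn i) (Finset.mem_univ i)
    linarith

lemma derivSymbol_mul_heatCoeff (i : Fin d) (t : ℝ) (c : (Fin d → ℤ) → ℂ) :
    (fun k => derivSymbol i k * heatCoeff t c k)
      = heatCoeff t (fun k => derivSymbol i k * c k) := by
  funext k
  simp only [heatCoeff]
  ring

lemma SupBound.heatCoeff {m : ℕ} {K t : ℝ} {c : (Fin d → ℤ) → ℂ} (hc : RapidDecay c)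
    (h : SupBound m K c) (ht : 0 < t) : SupBound m K (heatCoeff t c) := by
  induction m generalizing c with
  | zero => exact abs_series_heatCoeff_le hc.summable_norm h ht
  | succ m ih =>
    refine ⟨abs_series_heatCoeff_le hc.summable_norm h.1 ht, fun i => ?_⟩
    rw [derivSymbol_mul_heatCoeff]
    exact ih (hc.derivSymbol_mul i) (h.2 i)

/-- The heat semigroup gains one derivative. -/
lemma SupBound.heatCoeff_succ {m : ℕ} {K t : ℝ} {c : (Fin d → ℤ) → ℂ} (hc : RapidDecay c)
    (h : SupBound m K c) (ht : 0 < t) :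
    SupBound (m + 1) (K * (1 + (√(2 * t))⁻¹)) (PeriodicRD.heatCoeff t c) := by
  have hs : 0 ≤ (√(2 * t))⁻¹ := by positivity
  have h0 := h.nonneg
  have hK1 : K ≤ K * (1 + (√(2 * t))⁻¹) := le_mul_of_one_le_right h0 (by linarith)
  induction m generalizing c with
  | zero =>
    refine ⟨fun x => (abs_series_heatCoeff_le hc.summable_norm h ht x).trans hK1, fun i x =>
      (abs_series_deriv_heatCoeff_le hc.summable_norm h ht i x).trans ?_⟩
    rw [mul_comm]
    exact mul_le_mul_of_nonneg_left (by linarith) h0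
  | succ m ih =>
    refine ⟨fun x => (abs_series_heatCoeff_le hc.summable_norm h.1 ht x).trans hK1, fun i => ?_⟩
    rw [derivSymbol_mul_heatCoeff]
    exact ih (hc.derivSymbol_mul i) (h.2 i)

lemma norm_derivSymbol_mul_le {c e : (Fin d → ℤ) → ℂ} (h : ∀ k, ‖c k‖ ≤ ‖e k‖) (i : Fin d)
    (k : Fin d → ℤ) : ‖derivSymbol i k * c k‖ ≤ ‖derivSymbol i k * e k‖ := by
  rw [norm_mul, norm_mul]
  exact mul_le_mul_of_nonneg_left (h k) (norm_nonneg _)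

/-- Domination by one rapidly decaying sequence survives multiplication by the derivative symbols,
so every differentiated series converges pointwise. -/
lemma SupBound.of_tendsto {m : ℕ} {K : ℝ} {ι : Type*} {l : Filter ι} [l.NeBot]
    {C : ι → (Fin d → ℤ) → ℂ} {c D : (Fin d → ℤ) → ℂ} (hD : RapidDecay D)
    (hdom : ∀ᶠ n in l, ∀ k, ‖C n k‖ ≤ ‖D k‖) (hlim : ∀ k, Tendsto (fun n => C n k) l (𝓝 (c k)))
    (h : ∀ᶠ n in l, SupBound m K (C n)) : SupBound m K c := by
  induction m generalizing C c D with
  | zero =>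
    intro x
    have ht : Tendsto (fun n => ∑' k, C n k * mFourier k x) l (𝓝 (∑' k, c k * mFourier k x)) := by
      refine tendsto_tsum_of_dominated_convergence hD.summable_norm
        (fun k => (hlim k).mul_const _) ?_
      filter_upwards [hdom] with n hn k
      rw [norm_mul, norm_mFourier_apply, mul_one]
      exact hn k
    have h2 := ((Complex.continuous_re.tendsto _).comp ht).abs
    refine le_of_tendsto h2 ?_
    filter_upwards [h] with n hn
    exact hn x
  | succ m ih =>
    refine ⟨?_, fun i => ?_⟩
    · intro x
      have ht : Tendsto (fun n => ∑' k, C n k * mFourier k x) l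
          (𝓝 (∑' k, c k * mFourier k x)) := by
        refine tendsto_tsum_of_dominated_convergence hD.summable_norm
          (fun k => (hlim k).mul_const _) ?_
        filter_upwards [hdom] with n hn k
        rw [norm_mul, norm_mFourier_apply, mul_one]
        exact hn k
      have h2 := ((Complex.continuous_re.tendsto _).comp ht).abs
      refine le_of_tendsto h2 ?_
      filter_upwards [h] with n hn
      exact hn.1 x
    · refine ih (hD.derivSymbol_mul i) ?_ (fun k => (hlim k).const_mul _) ?_
      · filter_upwards [hdom] with n hn using norm_derivSymbol_mul_le hn i
      · filter_upwards [h] with n hn using hn.2 i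

/-- The triangle inequality for integrals, with a bound κ(s) that may vary with s; this accommodates
the singular kernel in Duhamel's formula. -/
lemma SupBound.integral {m : ℕ} {ν : Measure ℝ} [IsFiniteMeasure ν] {κ : ℝ → ℝ}
    (hκ : Integrable κ ν) {C : ℝ → (Fin d → ℤ) → ℂ} {D : (Fin d → ℤ) → ℂ} (hD : RapidDecay D)
    (hdom : ∀ᵐ s ∂ν, ∀ k, ‖C s k‖ ≤ ‖D k‖)
    (hC : ∀ k, AEStronglyMeasurable (fun s => C s k) ν)
    (h : ∀ᵐ s ∂ν, SupBound m (κ s) (C s)) :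
    SupBound m (∫ s, κ s ∂ν) (fun k => ∫ s, C s k ∂ν) := by
  have base : ∀ {C : ℝ → (Fin d → ℤ) → ℂ} {D : (Fin d → ℤ) → ℂ}, RapidDecay D →
      (∀ᵐ s ∂ν, ∀ k, ‖C s k‖ ≤ ‖D k‖) → (∀ k, AEStronglyMeasurable (fun s => C s k) ν) →
      (∀ᵐ s ∂ν, ∀ x, |series (C s) x| ≤ κ s) →
      ∀ x, |series (fun k => ∫ s, C s k ∂ν) x| ≤ ∫ s, κ s ∂ν := by
    intro C D hD hdom hC h x
    have hb : ∀ k, ∀ᵐ s ∂ν, ‖C s k * mFourier k x‖ ≤ ‖D k‖ := fun k => by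
      filter_upwards [hdom] with s hs
      rw [norm_mul, norm_mFourier_apply, mul_one]
      exact hs k
    have h1 := hasSum_integral_of_dominated_convergence (μ := ν) (F := fun k s => C s k * mFourier k x)
      (f := fun s => ∑' k, C s k * mFourier k x) (fun k _ => ‖D k‖)
      (fun k => (hC k).mul_const _) hb (ae_of_all _ fun _ => hD.summable_norm)
      (integrable_const _) (by
        filter_upwards [hdom] with s hs
        exact (summable_mul_mFourier
          (hD.summable_norm.of_nonneg_of_le (fun _ => norm_nonneg _) hs) x).hasSum)
    have hint : Integrable (fun s => ∑' k, C s k * mFourier k x) ν := by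
      refine Integrable.mono' (integrable_const (∑' k, ‖D k‖)) ?_ ?_
      · have hs : ∀ᵐ s ∂ν, HasSum (fun k => C s k * mFourier k x) (∑' k, C s k * mFourier k x) := by
          filter_upwards [hdom] with s hs
          exact (summable_mul_mFourier
            (hD.summable_norm.of_nonneg_of_le (fun _ => norm_nonneg _) hs) x).hasSum
        refine aestronglyMeasurable_of_tendsto_ae (atTop : Filter (Finset (Fin d → ℤ)))
          (f := fun A s => ∑ k ∈ A, C s k * mFourier k x)
          (fun A => Finset.aestronglyMeasurable_fun_sum A fun k _ => (hC k).mul_const _) hs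
      · filter_upwards [ae_all_iff.2 hb] with s hs
        exact tsum_of_norm_bounded hD.summable_norm.hasSum hs
    have h3 := integral_re hint
    simp only [RCLike.re_to_complex] at h3
    have h4 : series (fun k => ∫ s, C s k ∂ν) x = ∫ s, series (C s) x ∂ν := by
      simp only [series]
      rw [h3, ← h1.tsum_eq]
      congr 1
      exact tsum_congr fun k => (integral_mul_const _ _).symm
    rw [h4, ← Real.norm_eq_abs]
    refine norm_integral_le_of_norm_le hκ ?_
    filter_upwards [h] with s hs using hs x
  induction m generalizing C D with
  | zero => exact base hD hdom hC h
  | succ m ih =>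
    refine ⟨base hD hdom hC (h.mono fun s hs => hs.1), fun i => ?_⟩
    simp_rw [← integral_const_mul]
    refine ih (hD.derivSymbol_mul i) ?_ (fun k => (hC k).const_mul _) (h.mono fun s hs => hs.2 i)
    filter_upwards [hdom] with s hs using norm_derivSymbol_mul_le hs i

lemma SupBound.fcoeff_partialDeriv {m : ℕ} {K : ℝ} {φ : Torus d → ℝ} (hφ : IsSmooth φ)
    (h : SupBound (m + 1) K (fcoeff φ)) (i : Fin d) :
    SupBound m K (fcoeff (partialDeriv i φ)) := by
  rw [fcoeff_partialDeriv_funext hφ]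
  exact h.2 i

lemma supBound_succ_fcoeff_iff {m : ℕ} {K : ℝ} {φ : Torus d → ℝ} (hφ : IsSmooth φ) :
    SupBound (m + 1) K (fcoeff φ) ↔
      (∀ x, |φ x| ≤ K) ∧ ∀ i, SupBound m K (fcoeff (partialDeriv i φ)) := by
  simp_rw [fcoeff_partialDeriv_funext hφ]
  rw [SupBound, series_fcoeff hφ]

/-- Leibniz' rule doubles the number of terms with each derivative, whence 2^m. -/
lemma SupBound.mul {m : ℕ} {K L : ℝ} {φ ψ : Torus d → ℝ} (hφ : IsSmooth φ) (hψ : IsSmooth ψ)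
    (h : SupBound m K (fcoeff φ)) (h' : SupBound m L (fcoeff ψ)) :
    SupBound m (2 ^ m * (K * L)) (fcoeff fun x => φ x * ψ x) := by
  have hK := h.nonneg
  have hL := h'.nonneg
  have h0 : ∀ {m : ℕ} {φ ψ : Torus d → ℝ}, IsSmooth φ → IsSmooth ψ → SupBound m K (fcoeff φ) →
      SupBound m L (fcoeff ψ) → ∀ x, |φ x * ψ x| ≤ K * L := by
    intro m φ ψ hφ hψ h h' x
    have e1 := h.abs_series_le x
    have e2 := h'.abs_series_le x
    rw [series_fcoeff hφ] at e1
    rw [series_fcoeff hψ] at e2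
    rw [abs_mul]
    exact mul_le_mul e1 e2 (abs_nonneg _) hK
  induction m generalizing φ ψ with
  | zero =>
    intro x
    rw [series_fcoeff (hφ.mul hψ), pow_zero, one_mul]
    exact h0 hφ hψ h h' x
  | succ m ih =>
    rw [supBound_succ_fcoeff_iff (hφ.mul hψ)]
    have hKL : 0 ≤ K * L := mul_nonneg hK hL
    refine ⟨fun x => (h0 hφ hψ h h' x).trans
      (le_mul_of_one_le_left hKL (one_le_pow₀ one_le_two)), fun i => ?_⟩
    have e : partialDeriv i (fun x => φ x * ψ x)
        = fun x => partialDeriv i φ x * ψ x + φ x * partialDeriv i ψ x := by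
      funext x
      exact partialDeriv_mul hφ hψ i x
    have hs1 := (hφ.partialDeriv i).mul hψ
    have hs2 := hφ.mul (hψ.partialDeriv i)
    have e2 : fcoeff (partialDeriv i fun x => φ x * ψ x)
        = fun k => fcoeff (fun x => partialDeriv i φ x * ψ x) k
          + fcoeff (fun x => φ x * partialDeriv i ψ x) k := by
      funext k
      rw [e, fcoeff_add (integrable_continuous hs1.continuous) (integrable_continuous hs2.continuous)]
    rw [e2, pow_succ, mul_assoc, two_mul, mul_add]
    exact (ih (hφ.partialDeriv i) hψ (h.fcoeff_partialDeriv hφ i) h'.of_succ).add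
      (rapidDecay_fcoeff hs1) (rapidDecay_fcoeff hs2)
      (ih hφ (hψ.partialDeriv i) h.of_succ (h'.fcoeff_partialDeriv hψ i))

/-- Composition with a smooth compactly supported function preserves bounds on derivatives. -/
lemma exists_supBound_comp (m : ℕ) {f : ℝ → ℝ} (hf : ContDiff ℝ ∞ f) (hfc : HasCompactSupport f)
    (K : ℝ) : ∃ K', ∀ φ : Torus d → ℝ, IsSmooth φ → SupBound m K (fcoeff φ) →
      SupBound m K' (fcoeff fun x => f (φ x)) := by
  induction m generalizing f with
  | zero =>
    obtain ⟨M, hM⟩ := exists_bound_of_hasCompactSupport hf hfc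
    refine ⟨M, fun φ hφ _ x => ?_⟩
    rw [series_fcoeff (hφ.comp hf)]
    exact hM _
  | succ m ih =>
    obtain ⟨M, hM⟩ := exists_bound_of_hasCompactSupport hf hfc
    obtain ⟨K₁, hK₁⟩ := ih (contDiff_deriv_infty hf) hfc.deriv
    refine ⟨max M (2 ^ m * (K₁ * K)), fun φ hφ h => ?_⟩
    rw [supBound_succ_fcoeff_iff (hφ.comp hf)]
    refine ⟨fun x => (hM _).trans (le_max_left _ _), fun i => ?_⟩
    rw [partialDeriv_comp hf hφ]
    exact ((hK₁ φ hφ h.of_succ).mul (hφ.comp (contDiff_deriv_infty hf)) (hφ.partialDeriv i)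
      (h.fcoeff_partialDeriv hφ i)).mono (le_max_right _ _)

/-- Bounds on derivatives give decay of the Fourier coefficients. -/
lemma SupBound.norm_mul_weight_le {N : ℕ} {K : ℝ} {c : (Fin d → ℤ) → ℂ} (hc : RapidDecay c)
    (hh : Hermitian c) (h : SupBound (2 * N) K c) (k : Fin d → ℤ) :
    ‖c k‖ * (1 + eigenvalue k) ^ N ≤ (1 + d) ^ N * K := by
  induction N generalizing c with
  | zero =>
    have := norm_fcoeff_le (g := series c) h.abs_series_le k
    rw [fcoeff_series hc.summable_norm hh] at this
    simpa using this
  | succ N ih =>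
    have h0 := ih hc hh h.of_succ.of_succ
    have h1 : ∀ i, ‖derivSymbol i k * (derivSymbol i k * c k)‖ * (1 + eigenvalue k) ^ N
        ≤ (1 + d) ^ N * K := fun i =>
      ih ((hc.derivSymbol_mul i).derivSymbol_mul i) ((hh.derivSymbol_mul i).derivSymbol_mul i)
        ((h.2 i).2 i)
    -- Writing 1+λ_k = 1 + ∑_i |2πk_i|² trades one power of the weight for 1+d terms with up to two
    -- more derivatives, whence the factor 1+d.
    have e : ‖c k‖ * (1 + eigenvalue k) ^ (N + 1) = ‖c k‖ * (1 + eigenvalue k) ^ N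
        + ∑ i, ‖derivSymbol i k * (derivSymbol i k * c k)‖ * (1 + eigenvalue k) ^ N := by
      have : ∀ i, ‖derivSymbol i k * (derivSymbol i k * c k)‖
          = ‖derivSymbol i k‖ ^ 2 * ‖c k‖ := fun i => by
        rw [norm_mul, norm_mul]
        ring
      simp_rw [this]
      rw [← Finset.sum_mul, ← Finset.sum_mul, sum_norm_derivSymbol_sq]
      ring
    rw [e]
    calc _ ≤ (1 + d) ^ N * K + ∑ _i : Fin d, (1 + d) ^ N * K :=
          add_le_add h0 (Finset.sum_le_sum fun i _ => h1 i)
      _ = _ := by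
          rw [Finset.sum_const, Finset.card_univ, Fintype.card_fin, nsmul_eq_mul]
          ring

/-! ### Bounds for coefficientwise limits -/

/-- `c` is the coefficientwise limit of smooth functions whose derivatives of order at most `m`
are bounded by `K`. -/
def LimSupBound (m : ℕ) (K : ℝ) (c : (Fin d → ℤ) → ℂ) : Prop :=
  ∃ φ : ℝ → Torus d → ℝ, (∀ᶠ ε in 𝓝[>] (0 : ℝ), IsSmooth (φ ε) ∧ SupBound m K (fcoeff (φ ε))) ∧
    ∀ k, Tendsto (fun ε => fcoeff (φ ε) k) (𝓝[>] 0) (𝓝 (c k))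

lemma LimSupBound.nonneg {m : ℕ} {K : ℝ} {c : (Fin d → ℤ) → ℂ} (h : LimSupBound m K c) :
    0 ≤ K := by
  obtain ⟨φ, h1, -⟩ := h
  obtain ⟨ε, hε⟩ := h1.exists
  exact hε.2.nonneg

lemma LimSupBound.norm_mul_weight_le {N : ℕ} {K : ℝ} {c : (Fin d → ℤ) → ℂ}
    (h : LimSupBound (2 * N) K c) (k : Fin d → ℤ) :
    ‖c k‖ * (1 + eigenvalue k) ^ N ≤ (1 + d) ^ N * K := by
  obtain ⟨φ, h1, h2⟩ := h
  refine le_of_tendsto ((h2 k).norm.mul_const _) ?_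
  filter_upwards [h1] with ε hε
  exact hε.2.norm_mul_weight_le (rapidDecay_fcoeff hε.1) (hermitian_fcoeff _) k

/-- The sup bound K also bounds all coefficients of the approximations, so after a positive heat
time they share one rapidly decaying majorant and the gradient estimate passes to the limit. -/
lemma LimSupBound.heatCoeff_succ {m : ℕ} {K t : ℝ} {c : (Fin d → ℤ) → ℂ}
    (h : LimSupBound m K c) (ht : 0 < t) :
    SupBound (m + 1) (K * (1 + (√(2 * t))⁻¹)) (heatCoeff t c) := by
  have hK := h.nonneg
  obtain ⟨φ, h1, h2⟩ := h
  have hD : RapidDecay (heatCoeff t fun _ : Fin d → ℤ => (K : ℂ)) :=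
    rapidDecay_heatCoeff ht (K := K) fun k => by rw [Complex.norm_real, Real.norm_of_nonneg hK]
  refine SupBound.of_tendsto (C := fun ε => heatCoeff t (fcoeff (φ ε))) hD ?_
    (fun k => (h2 k).const_mul _) ?_
  · filter_upwards [h1] with ε hε k
    rw [norm_heatCoeff, norm_heatCoeff, Complex.norm_real, Real.norm_of_nonneg hK]
    refine mul_le_mul_of_nonneg_left (norm_fcoeff_le (fun x => ?_) k) (Real.exp_pos _).le
    rw [← series_fcoeff hε.1]
    exact hε.2.abs_series_le x
  · filter_upwards [h1] with ε hε
    exact hε.2.heatCoeff_succ (rapidDecay_fcoeff hε.1) ht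

/-! ### Propagation of smoothness -/

lemma LimSupBound.norm_le {m : ℕ} {K : ℝ} {c : (Fin d → ℤ) → ℂ} (h : LimSupBound m K c)
    (k : Fin d → ℤ) : ‖c k‖ ≤ K := by
  obtain ⟨φ, h1, h2⟩ := h
  refine le_of_tendsto (h2 k).norm ?_
  filter_upwards [h1] with ε hε
  refine norm_fcoeff_le (fun x => ?_) k
  rw [← series_fcoeff hε.1]
  exact hε.2.abs_series_le x

/-- The inverse square root singularity is integrable. The shift ε keeps the integrand continuous up
to s = t, while the bound, from the primitive s - √(2(t-s+ε)), does not depend on ε. -/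
lemma integral_inv_sqrt_le {T t ε : ℝ} (ht : t ∈ Icc 0 T) (hε : ε ∈ Ioc (0 : ℝ) 1)
    (K : ℝ) (hK : 0 ≤ K) :
    IntegrableOn (fun s => K * (1 + (√(2 * (t - s + ε)))⁻¹)) (Ioc 0 t) ∧
    ∫ s in Ioc 0 t, K * (1 + (√(2 * (t - s + ε)))⁻¹) ≤ K * (T + √(2 * (T + 1))) := by
  have hpos : ∀ s ∈ Icc 0 t, 0 < 2 * (t - s + ε) := fun s hs => by
    have := hs.2
    have := hε.1
    linarith
  have hc : ContinuousOn (fun s => K * (1 + (√(2 * (t - s + ε)))⁻¹)) (Icc 0 t) := by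
    refine continuousOn_const.mul (continuousOn_const.add (ContinuousOn.inv₀ ?_ fun s hs =>
      (Real.sqrt_pos.2 (hpos s hs)).ne'))
    fun_prop
  have hc' := hc
  rw [← uIcc_of_le ht.1] at hc'
  refine ⟨(hc.integrableOn_Icc).mono_set Ioc_subset_Icc_self, ?_⟩
  rw [← intervalIntegral.integral_of_le ht.1]
  have hd : ∀ s ∈ uIcc 0 t, HasDerivAt (fun s => K * (s - √(2 * (t - s + ε))))
      (K * (1 + (√(2 * (t - s + ε)))⁻¹)) s := by
    intro s hs
    rw [uIcc_of_le ht.1] at hs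
    have h1 : HasDerivAt (fun s : ℝ => 2 * (t - s + ε)) (-2) s := by
      have := (((hasDerivAt_id s).const_sub t).add_const ε).const_mul 2
      simpa using this
    have h2 := h1.sqrt (hpos s hs).ne'
    refine (((hasDerivAt_id s).sub h2).const_mul K).congr_deriv ?_
    have h3 := (Real.sqrt_pos.2 (hpos s hs)).ne'
    field_simp
    ring
  rw [intervalIntegral.integral_eq_sub_of_hasDerivAt hd hc'.intervalIntegrable, ← mul_sub]
  refine mul_le_mul_of_nonneg_left ?_ hK
  have h1 : 0 ≤ √(2 * (t - t + ε)) := Real.sqrt_nonneg _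
  have h2 : √(2 * (t - 0 + ε)) ≤ √(2 * (T + 1)) := by
    apply Real.sqrt_le_sqrt
    linarith [ht.2, hε.2]
  linarith [ht.2]

/-- Bounds on `m` derivatives of the source give bounds on `m + 1` derivatives of the solution. -/
lemma ModeSolution.exists_supBound_succ {T : ℝ} (hT : 0 ≤ T) {a F : ℝ → (Fin d → ℤ) → ℂ}
    (h : ModeSolution T a F) (h0 : RapidDecay (a 0)) {m : ℕ} {K : ℝ}
    (hF : ∀ t ∈ Icc 0 T, LimSupBound m K (F t)) :
    ∃ K', ∀ t ∈ Icc 0 T, ∀ ε ∈ Ioc (0 : ℝ) 1, SupBound (m + 1) K' (heatCoeff ε (a t)) := by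
  have hK : 0 ≤ K := (hF 0 ⟨le_rfl, hT⟩).nonneg
  obtain ⟨K₀, hK₀⟩ := exists_supBound (m + 1) h0
  refine ⟨K₀ + K * (T + √(2 * (T + 1))), fun t ht ε hε => ?_⟩
  have hcomm : ∀ (s r : ℝ) (c : (Fin d → ℤ) → ℂ) k,
      heatCoeff s (heatCoeff r c) k = heatCoeff (r + s) c k := by
    intro s r c k
    simp only [heatCoeff]
    rw [← mul_assoc, ← Complex.ofReal_mul, ← Real.exp_add]
    congr 4
    ring
  set ν := (volume : Measure ℝ).restrict (Ioc 0 t) with hν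
  set J : (Fin d → ℤ) → ℂ := fun k => ∫ s, heatCoeff (t - s + ε) (F s) k ∂ν with hJ
  -- Duhamel's formula after the heat flow for time ε: the source at time s is smoothed for t-s+ε >
  -- 0, so the derivative gain applies at every s.
  have hsplit : heatCoeff ε (a t) = fun k => heatCoeff (t + ε) (a 0) k + J k := by
    funext k
    rw [← hcomm, hJ]
    simp only [← hcomm ε]
    conv_lhs => rw [heatCoeff, h.duhamel k ht, intervalIntegral.integral_of_le ht.1]
    simp only [heatCoeff]
    rw [mul_add, integral_const_mul]
  have hs : ∀ᵐ s ∂ν, s ∈ Icc 0 t :=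
    (ae_restrict_mem measurableSet_Ioc).mono fun s hs => Ioc_subset_Icc_self hs
  have hsT : ∀ s ∈ Icc 0 t, s ∈ Icc 0 T := fun s hs => ⟨hs.1, hs.2.trans ht.2⟩
  have hD : RapidDecay (heatCoeff ε fun _ : Fin d → ℤ => (K : ℂ)) :=
    rapidDecay_heatCoeff hε.1 (K := K) fun k => by rw [Complex.norm_real, Real.norm_of_nonneg hK]
  have hint := integral_inv_sqrt_le ht hε K hK
  have hJb : SupBound (m + 1) (∫ s, K * (1 + (√(2 * (t - s + ε)))⁻¹) ∂ν) J := by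
    refine SupBound.integral hint.1 hD ?_ ?_ ?_
    · filter_upwards [hs] with s hs k
      rw [norm_heatCoeff, norm_heatCoeff, Complex.norm_real, Real.norm_of_nonneg hK]
      refine mul_le_mul (Real.exp_le_exp.2 ?_) ((hF s (hsT s hs)).norm_le k) (norm_nonneg _)
        (Real.exp_pos _).le
      have := mul_nonneg (eigenvalue_nonneg k) (sub_nonneg.2 hs.2)
      linarith
    · intro k
      have hcF : ContinuousOn (fun s => F s k) (Icc 0 t) := (h k).1.mono hsT
      have : ContinuousOn (fun s => heatCoeff (t - s + ε) (F s) k) (Icc 0 t) := by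
        simp only [heatCoeff]
        refine ContinuousOn.mul ?_ hcF
        fun_prop
      exact (this.mono Ioc_subset_Icc_self).aestronglyMeasurable measurableSet_Ioc
    · filter_upwards [hs] with s hs
      exact (hF s (hsT s hs)).heatCoeff_succ (by linarith [hs.2, hε.1])
  have hθ : SupBound (m + 1) K₀ (heatCoeff (t + ε) (a 0)) :=
    hK₀.heatCoeff h0 (by linarith [ht.1, hε.1])
  have hJr : RapidDecay J := by
    refine (hD.mul t 0 (m := fun _ => (t : ℂ)) fun k => ?_).of_norm_le fun k => ?_
    · rw [Complex.norm_real, Real.norm_of_nonneg ht.1]; simp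
    · have : ∀ᵐ s ∂ν, ‖heatCoeff (t - s + ε) (F s) k‖
          ≤ ‖heatCoeff ε (fun _ : Fin d → ℤ => (K : ℂ)) k‖ := by
        filter_upwards [hs] with s hs
        rw [norm_heatCoeff, norm_heatCoeff, Complex.norm_real, Real.norm_of_nonneg hK]
        refine mul_le_mul (Real.exp_le_exp.2 ?_) ((hF s (hsT s hs)).norm_le k) (norm_nonneg _)
          (Real.exp_pos _).le
        have := mul_nonneg (eigenvalue_nonneg k) (sub_nonneg.2 hs.2)
        linarith
      refine (norm_integral_le_of_norm_le (integrable_const _) this).trans ?_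
      rw [integral_const, norm_mul, Complex.norm_real, Real.norm_of_nonneg ht.1, smul_eq_mul]
      simp [hν, ht.1]
  rw [hsplit]
  exact (hθ.add (h0.of_norm_le (norm_heatCoeff_le (by linarith [ht.1, hε.1]) _)) hJr hJb).mono
    (by linarith [hint.2])

/-- The bootstrap: f(u(t)) is the coefficientwise limit of f(e^{εΔ}u(t)). The heat flow gains one
derivative per round, composition with f loses none, and the start is the boundedness of f. -/
lemma IsWeakSolution.exists_limSupBound {f : ℝ → ℝ} (hf : ContDiff ℝ ∞ f)
    (hfc : HasCompactSupport f) {T : ℝ} (hT : 0 < T) {θ : H1 d} {u : ℝ → L2 d} {u' : ℝ → HNeg1 d}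
    (h : IsWeakSolution f T θ u u') (h0 : RapidDecay (L2.coeff (u 0))) (m : ℕ) :
    ∃ K, ∀ t ∈ Icc 0 T, LimSupBound m K (sourceCoeff f u t) := by
  have hev : ∀ᶠ ε in 𝓝[>] (0 : ℝ), ε ∈ Ioc (0 : ℝ) 1 :=
    Ioc_mem_nhdsGT one_pos
  induction m with
  | zero =>
    obtain ⟨M, hM⟩ := exists_bound_of_hasCompactSupport hf hfc
    refine ⟨M, fun t _ => ⟨fun ε x => f (heatSmooth ε (u t) x), ?_,
      fun k => tendsto_fcoeff_comp_heatSmooth hf hfc (u t) k⟩⟩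
    filter_upwards [hev] with ε hε
    have hs := (isSmooth_heatSmooth hε.1 (u t)).comp hf
    refine ⟨hs, fun x => ?_⟩
    rw [series_fcoeff hs]
    exact hM _
  | succ m ih =>
    obtain ⟨K, hK⟩ := ih
    obtain ⟨K₁, hK₁⟩ := (h.modeSolution hT hf hfc).exists_supBound_succ hT.le h0 hK
    obtain ⟨K₂, hK₂⟩ := exists_supBound_comp (d := d) (m + 1) hf hfc K₁
    refine ⟨K₂, fun t ht => ⟨fun ε x => f (heatSmooth ε (u t) x), ?_,
      fun k => tendsto_fcoeff_comp_heatSmooth hf hfc (u t) k⟩⟩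
    filter_upwards [hev] with ε hε
    have hs := isSmooth_heatSmooth hε.1 (u t)
    refine ⟨hs.comp hf, hK₂ _ hs ?_⟩
    rw [fcoeff_heatSmooth hε.1]
    exact hK₁ t ht ε hε

/-- Smooth initial data: the Fourier coefficients of the solution decay rapidly, uniformly in
time. -/
theorem IsWeakSolution.exists_weight_bound {f : ℝ → ℝ} (hf : ContDiff ℝ ∞ f)
    (hfc : HasCompactSupport f) {T : ℝ} (hT : 0 < T) {θ : H1 d} {u : ℝ → L2 d} {u' : ℝ → HNeg1 d}
    (h : IsWeakSolution f T θ u u') (h0 : RapidDecay (L2.coeff (u 0))) (N : ℕ) :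
    ∃ K, ∀ t ∈ Icc 0 T, ∀ k, ‖L2.coeff (u t) k‖ * (1 + eigenvalue k) ^ N ≤ K ∧
      ‖sourceCoeff f u t k‖ * (1 + eigenvalue k) ^ N ≤ K := by
  obtain ⟨K, hK⟩ := h.exists_limSupBound hf hfc hT h0 (2 * N)
  obtain ⟨K₀, hK₀⟩ := h0 N
  set L := (1 + (d : ℝ)) ^ N * K with hL
  have hF : ∀ t ∈ Icc 0 T, ∀ k, ‖sourceCoeff f u t k‖ * (1 + eigenvalue k) ^ N ≤ L :=
    fun t ht k => (hK t ht).norm_mul_weight_le k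
  have hL0 : 0 ≤ L := mul_nonneg (by positivity) (hK 0 ⟨le_rfl, hT.le⟩).nonneg
  -- The solution inherits the decay of data and source through Duhamel's formula, as the heat
  -- factor is at most one and the time interval has length at most T.
  refine ⟨max (K₀ + T * L) L, fun t ht k => ⟨le_max_of_le_left ?_, le_max_of_le_right (hF t ht k)⟩⟩
  have hw : 0 < (1 + eigenvalue k) ^ N := pow_pos (weight_pos k) _
  have e := (h.modeSolution hT hf hfc).duhamel k ht
  have hI : ‖∫ s in (0 : ℝ)..t, heatCoeff (t - s) (sourceCoeff f u s) k‖
      ≤ L / (1 + eigenvalue k) ^ N * |t - 0| := by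
    refine intervalIntegral.norm_integral_le_of_norm_le_const fun s hs => ?_
    rw [uIoc_of_le ht.1] at hs
    refine (norm_heatCoeff_le (sub_nonneg.2 hs.2) _ _).trans ?_
    rw [le_div_iff₀ hw]
    exact hF s ⟨hs.1.le, hs.2.trans ht.2⟩ k
  rw [sub_zero, abs_of_nonneg ht.1] at hI
  rw [e]
  calc _ ≤ (‖L2.coeff (u 0) k‖ + L / (1 + eigenvalue k) ^ N * t) * (1 + eigenvalue k) ^ N := by
        gcongr
        exact (norm_add_le _ _).trans (add_le_add (norm_heatCoeff_le ht.1 _ _) hI)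
    _ = ‖L2.coeff (u 0) k‖ * (1 + eigenvalue k) ^ N + t * L := by
        field_simp
    _ ≤ _ := by
        have := hK₀ k
        have := mul_le_mul_of_nonneg_right ht.2 hL0
        linarith

/-! ### Hölder bounds -/

/-- One derivative beyond the integer part of b makes the top derivative Lipschitz, which implies
the Hölder bound for |y-z| ≤ 1; for larger distances twice the sup bound suffices. The remaining d+1
powers of the weight pay for summation. -/
lemma holderBound_series {c : (Fin d → ℤ) → ℂ} (hc : RapidDecay c) {b K : ℝ}
    (hK : ∀ k, ‖c k‖ * (1 + eigenvalue k) ^ (⌊b⌋₊ + 1 + (d + 1)) ≤ K) :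
    HolderBound b (2 * (K * ∑' k : Fin d → ℤ, ((1 + eigenvalue k) ^ (d + 1))⁻¹)) (series c) := by
  set m := ⌊b⌋₊ with hm
  set S := K * ∑' k : Fin d → ℤ, ((1 + eigenvalue k) ^ (d + 1))⁻¹ with hS
  have hsum := summable_of_weight_bound hK
  have hSb : ∀ j ≤ m + 1, ∀ y, ‖iteratedFDeriv ℝ j (perLift (series c)) y‖ ≤ S := fun j hj y => by
    refine (norm_iteratedFDeriv_series_le hc j y).trans (le_trans ?_ hsum.2)
    refine (hc.summable_weight j).tsum_le_tsum (fun k => ?_) hsum.1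
    exact mul_le_mul_of_nonneg_left (pow_le_pow_right₀ (one_le_weight k) hj) (norm_nonneg _)
  have hS0 : 0 ≤ S := (norm_nonneg _).trans (hSb 0 (Nat.zero_le _) 0)
  have hsm : ContDiff ℝ ∞ (perLift (series c)) := isSmooth_series hc
  have hlip : ∀ y z, ‖iteratedFDeriv ℝ m (perLift (series c)) y
      - iteratedFDeriv ℝ m (perLift (series c)) z‖ ≤ S * ‖y - z‖ := fun y z => by
    refine Convex.norm_image_sub_le_of_norm_fderiv_le (𝕜 := ℝ) (s := univ) (fun x _ => ?_)
      (fun x _ => ?_) convex_univ (mem_univ z) (mem_univ y)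
    · exact (hsm.differentiable_iteratedFDeriv (m := m) (by exact_mod_cast ENat.natCast_lt_top m)) x
    · rw [norm_fderiv_iteratedFDeriv]
      exact hSb _ le_rfl x
  refine ⟨hsm.of_le (by exact_mod_cast le_top), fun j hj y =>
    (hSb j (by omega) y).trans (by linarith), fun hbm y z => ?_⟩
  have hα : 0 < b - m := sub_pos.2 hbm
  have hα1 : b - m ≤ 1 := by
    have := Nat.lt_floor_add_one b
    linarith
  rcases le_or_gt ‖y - z‖ 1 with h1 | h1
  · refine (hlip y z).trans ?_
    rcases (norm_nonneg (y - z)).eq_or_lt with h0 | h0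
    · rw [← h0, mul_zero]
      exact mul_nonneg (by linarith) (Real.rpow_nonneg le_rfl _)
    · have := Real.rpow_le_rpow_of_exponent_ge h0 h1 hα1
      rw [Real.rpow_one] at this
      exact mul_le_mul (by linarith) this h0.le (by linarith)
  · refine (norm_sub_le _ _).trans ?_
    have h2 := hSb m (by omega) y
    have h3 := hSb m (by omega) z
    have h4 := Real.one_le_rpow h1.le hα.le
    calc _ ≤ 2 * S * 1 := by linarith
      _ ≤ _ := mul_le_mul_of_nonneg_left h4 (by linarith)

/-! ### The time derivative of a smooth solution -/

/-- Separability allows a single null set of times to serve all test functions. -/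
instance instSeparableSpaceH1 (d : ℕ) : TopologicalSpace.SeparableSpace (H1 d) := by
  have : Fact ((2 : ℝ≥0∞) ≠ ⊤) := ⟨by norm_num⟩
  have : MeasurableSpace.CountablyGenerated (Torus d) := inferInstance
  have : MeasureTheory.IsSeparable (torusMeasure d) := inferInstance
  have : SecondCountableTopology (L2 d) := inferInstance
  exact inferInstanceAs (TopologicalSpace.SeparableSpace ↥(H1Submodule d))

lemma H1.continuous_toL2 : Continuous (H1.toL2 : H1 d → L2 d) :=
  (WithLp.prod_continuous_ofLp 2 _ _).fst.comp continuous_subtype_val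

lemma H1.continuous_grad (i : Fin d) : Continuous (fun v : H1 d => H1.grad v i) := by
  have h : Continuous fun v : H1 d => (Subtype.val v).snd :=
    (WithLp.prod_continuous_ofLp 2 _ _).snd.comp continuous_subtype_val
  exact (PiLp.continuous_apply 2 _ i).comp h

lemma H1.coeff_grad (v : H1 d) (i : Fin d) (k : Fin d → ℤ) :
    L2.coeff (H1.grad v i) k = derivSymbol i k * L2.coeff (H1.toL2 v) k :=
  fcoeff_of_forall_mode (L2.integrable _) (L2.integrable _) i (H1.isWeakPartial v i) k

/-- Green's formula for a smooth function against an element of `H¹`. -/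
lemma H1.sum_inner_grad_right {h : Torus d → ℝ} (hh : IsSmooth h) {U : H1 d}
    (hU : H1.toL2 U =ᵐ[torusMeasure d] h) (v : H1 d) :
    ∑ i, inner ℝ (H1.grad U i) (H1.grad v i)
      = -∫ x, laplacian h x * H1.toL2 v x ∂torusMeasure d := by
  have hg : ∀ i, H1.grad U i =ᵐ[torusMeasure d] partialDeriv i h := fun i => by
    have : H1.grad U i = (memLp_smooth (hh.partialDeriv i)).toLp (partialDeriv i h) := by
      refine L2.ext_coeff fun k => ?_
      rw [H1.coeff_grad, fcoeff_toLp, fcoeff_partialDeriv hh, L2.coeff_eq_fcoeff,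
        fcoeff_congr_ae hU]
    rw [this]
    exact MemLp.coeFn_toLp _
  have hi : ∀ i, inner ℝ (H1.grad U i) (H1.grad v i)
      = -∫ x, H1.toL2 v x * partialDeriv i (partialDeriv i h) x ∂torusMeasure d := fun i => by
    rw [H1.isWeakPartial v i _ (hh.partialDeriv i), neg_neg, inner_L2_eq]
    refine integral_congr_ae ?_
    filter_upwards [hg i] with x hx
    rw [hx, mul_comm]
  simp_rw [hi]
  rw [Finset.sum_neg_distrib, ← integral_finsetSum _ fun i _ => integrable_L2_mul _
    ((hh.partialDeriv i).partialDeriv i).continuous]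
  congr 1
  refine integral_congr_ae (ae_of_all _ fun x => ?_)
  simp only [laplacian]
  rw [Finset.sum_mul]
  exact Finset.sum_congr rfl fun i _ => mul_comm _ _

/-- The equation holds at almost every time simultaneously for all test functions. -/
lemma IsWeakSolution.ae_forall_equation {f : ℝ → ℝ} (hf : ContDiff ℝ ∞ f)
    (hfc : HasCompactSupport f) {T : ℝ} {θ : H1 d} {u : ℝ → L2 d} {u' : ℝ → HNeg1 d}
    (h : IsWeakSolution f T θ u u') : ∀ᵐ t ∂volume.restrict (Icc 0 T),
      ∃ U : H1 d, H1.toL2 U = u t ∧ ∀ v : H1 d,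
        u' t v + ∑ i, inner ℝ (H1.grad U i) (H1.grad v i)
          = ∫ x, f (u t x) * H1.toL2 v x ∂torusMeasure d := by
  obtain ⟨U, -, hU, heq⟩ := h.equation
  -- The equation holds almost everywhere for a countable dense set of test functions at once; both
  -- sides are continuous in v, so it extends to all of H¹.
  have hall := ae_all_iff.2 fun n => heq (TopologicalSpace.denseSeq (H1 d) n)
  filter_upwards [hU, hall] with t htU ht
  refine ⟨U t, htU, ?_⟩
  have hm : MemLp (fun x => f (u t x)) 2 (torusMeasure d) :=
    memLp_comp hf hfc (Lp.aestronglyMeasurable _)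
  have hr : ∀ v : H1 d, ∫ x, f (u t x) * H1.toL2 v x ∂torusMeasure d
      = inner ℝ (hm.toLp _) (H1.toL2 v) := fun v => by
    rw [inner_L2_eq]
    refine integral_congr_ae ?_
    filter_upwards [hm.coeFn_toLp] with x hx
    rw [hx]
  simp_rw [hr] at ht ⊢
  have hl : Continuous fun v : H1 d => u' t v + ∑ i, inner ℝ (H1.grad (U t) i) (H1.grad v i) :=
    (u' t).continuous.add (continuous_finsetSum _ fun i _ =>
      continuous_const.inner (H1.continuous_grad i))
  have hr' : Continuous fun v : H1 d => inner ℝ (hm.toLp _) (H1.toL2 v) :=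
    continuous_const.inner H1.continuous_toL2
  refine congrFun (Continuous.ext_on (TopologicalSpace.denseRange_denseSeq (H1 d)) hl hr' ?_)
  rintro _ ⟨n, rfl⟩
  exact ht n

/-- Smooth initial data give solutions in `C¹([0,T], C^b(Ω))`. -/
theorem IsWeakSolution.memC1Holder {f : ℝ → ℝ} (hf : ContDiff ℝ ∞ f)
    (hfc : HasCompactSupport f) {T : ℝ} (hT : 0 < T) {θ : H1 d} {u : ℝ → L2 d} {u' : ℝ → HNeg1 d}
    (h : IsWeakSolution f T θ u u') (hθ : L2.IsSmooth (H1.toL2 θ)) (b : ℝ) :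
    MemC1Holder T b u u' := by
  obtain ⟨h₀, hs₀, he₀⟩ := hθ
  have hr₀ : RapidDecay (L2.coeff (u 0)) := by
    have : L2.coeff (u 0) = fcoeff h₀ := by
      rw [h.initial]
      exact fcoeff_congr_ae he₀
    rw [this]
    exact rapidDecay_fcoeff hs₀
  have hw := h.exists_weight_bound hf hfc hT hr₀
  have hrapid : ∀ t ∈ Icc 0 T, RapidDecay (L2.coeff (u t)) := fun t ht N => by
    obtain ⟨K, hK⟩ := hw N
    exact ⟨K, fun k => (hK t ht k).1⟩
  set N := ⌊b⌋₊ + 1 + (d + 1) with hN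
  -- One power more than the Hölder bound for u requires, because the Laplacian in u' consumes a
  -- factor of the weight.
  obtain ⟨K, hK⟩ := hw (N + 1)
  have hK0 : 0 ≤ K := (mul_nonneg (norm_nonneg _) (pow_nonneg (weight_pos 0).le _)).trans
    (hK 0 ⟨le_rfl, hT.le⟩ 0).1
  have hlow : ∀ (c : (Fin d → ℤ) → ℂ) k, ‖c k‖ * (1 + eigenvalue k) ^ (N + 1) ≤ K →
      ‖c k‖ * (1 + eigenvalue k) ^ N ≤ K := fun c k hc =>
    (mul_le_mul_of_nonneg_left (pow_le_pow_right₀ (one_le_weight k) (Nat.le_succ N))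
      (norm_nonneg _)).trans hc
  have hrep : ∀ t ∈ Icc 0 T, u t =ᵐ[torusMeasure d] series (L2.coeff (u t)) := fun t ht => by
    have hm := memLp_smooth (isSmooth_series (hrapid t ht))
    have : u t = hm.toLp _ := by
      refine L2.ext_coeff fun k => ?_
      rw [fcoeff_toLp, fcoeff_series (hrapid t ht).summable_norm (L2.hermitian_coeff _)]
    conv_lhs => rw [this]
    exact hm.coeFn_toLp
  refine ⟨2 * ((2 * K) * ∑' k : Fin d → ℤ, ((1 + eigenvalue k) ^ (d + 1))⁻¹), fun t ht =>
    ⟨_, holderBound_series (hrapid t ht) fun k => ?_, hrep t ht⟩, ?_⟩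
  · exact (hlow _ k (hK t ht k).1).trans (by linarith)
  filter_upwards [h.ae_forall_equation hf hfc, ae_restrict_mem measurableSet_Icc]
    with t ⟨U, hU, ht⟩ htT
  set φ := series (L2.coeff (u t)) with hφ
  have hφs : IsSmooth φ := isSmooth_series (hrapid t htT)
  have hφc : fcoeff φ = L2.coeff (u t) :=
    fcoeff_series (hrapid t htT).summable_norm (L2.hermitian_coeff _)
  -- The equation identifies u'(t) with integration against f(u) + Δu, taken for the smooth
  -- representative φ of u(t).
  set ψ : Torus d → ℝ := fun x => f (φ x) + laplacian φ x with hψ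
  have hfs : IsSmooth fun x => f (φ x) := hφs.comp hf
  have hψs : IsSmooth ψ := hfs.add hφs.laplacian
  have hsrc : sourceCoeff f u t = fcoeff fun x => f (φ x) :=
    fcoeff_congr_ae ((hrep t htT).mono fun x hx => by simp only [hx, hφ])
  have hψc : ∀ k, fcoeff ψ k = sourceCoeff f u t k + -(eigenvalue k : ℂ) * L2.coeff (u t) k :=
    fun k => by
      rw [fcoeff_add (integrable_continuous hfs.continuous)
        (integrable_continuous hφs.laplacian.continuous), hsrc, fcoeff_laplacian hφs, hφc]
  refine ⟨ψ, ?_, fun v => ?_⟩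
  · rw [← series_fcoeff hψs]
    refine holderBound_series (rapidDecay_fcoeff hψs) fun k => ?_
    have hl := eigenvalue_nonneg k
    have hwN : 0 ≤ (1 + eigenvalue k) ^ N := pow_nonneg (weight_pos k).le _
    rw [hψc]
    calc _ ≤ (‖sourceCoeff f u t k‖ + eigenvalue k * ‖L2.coeff (u t) k‖)
          * (1 + eigenvalue k) ^ N := by
          refine mul_le_mul_of_nonneg_right ((norm_add_le _ _).trans_eq ?_) hwN
          rw [norm_mul, norm_neg, Complex.norm_real, Real.norm_of_nonneg hl]
      _ ≤ ‖sourceCoeff f u t k‖ * (1 + eigenvalue k) ^ N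
          + ‖L2.coeff (u t) k‖ * (1 + eigenvalue k) ^ (N + 1) := by
          have : 0 ≤ ‖L2.coeff (u t) k‖ * (1 + eigenvalue k) ^ N :=
            mul_nonneg (norm_nonneg _) hwN
          rw [pow_succ]
          linarith
      _ ≤ 2 * K := by
          have h1 := hlow _ k (hK t htT k).2
          have h2 := (hK t htT k).1
          linarith
  · have h1 := ht v
    rw [H1.sum_inner_grad_right hφs (hU ▸ hrep t htT)] at h1
    have h2 : ∫ x, f (u t x) * H1.toL2 v x ∂torusMeasure d
        = ∫ x, f (φ x) * H1.toL2 v x ∂torusMeasure d := by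
      refine integral_congr_ae ?_
      filter_upwards [hrep t htT] with x hx
      rw [hx]
    have h3 : ∀ {χ : Torus d → ℝ}, IsSmooth χ →
        Integrable (fun x => χ x * H1.toL2 v x) (torusMeasure d) := fun hχ =>
      (integrable_L2_mul _ hχ.continuous).congr (ae_of_all _ fun _ => mul_comm _ _)
    simp only [hψ, add_mul]
    rw [integral_add (h3 hfs) (h3 hφs.laplacian)]
    linarith

end PeriodicRD

end

/-! ### The regularity theorem -/

theorem proposition3p2 (d : ℕ) (hd : 1 ≤ d) (f : ℝ → ℝ) (hf : ContDiff ℝ ∞ f)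
    (hfc : HasCompactSupport f) (T : ℝ) (hT : 0 < T) (γ : ℝ) (hγ : 0 ≤ γ)
    (hγd : 2 < γ → d ≤ 3) (B : ℝ) :
    ∃ C C' : ℝ≥0, ∀ (θ : H1 d) (u : ℝ → L2 d) (u' : ℝ → HNeg1 d),
      IsWeakSolution f T θ u u' → L2.hNorm γ (H1.toL2 θ) ≤ ENNReal.ofReal B →
      (∫⁻ t in Icc 0 T, L2.hNorm (γ + 1) (u t) ^ 2) + (⨆ t ∈ Icc 0 T, L2.hNorm γ (u t)) ≤ C ∧
      (∫⁻ t in Icc 0 T, HNeg1.hNorm (γ - 1) (u' t) ^ 2)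
        + essSup (fun t => HNeg1.hNorm (γ - 2) (u' t)) (volume.restrict (Icc 0 T)) ≤ C' ∧
      (∀ t₀ ∈ Icc 0 T,
        Tendsto (fun t => L2.hNorm γ (u t - u t₀)) (𝓝[Icc 0 T] t₀) (𝓝 0)) ∧
      (L2.IsSmooth (H1.toL2 θ) → ∀ b : ℝ, 0 < b → MemC1Holder T b u u') := by
  obtain ⟨C, C', h⟩ := exists_sobolev_bounds hf hfc hT hγ hγd B
  refine ⟨C, C', fun θ u u' hu hθ => ?_⟩
  obtain ⟨h₁, h₂, h₃⟩ := h θ u u' hu hθ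
  exact ⟨h₁, h₂, h₃, fun hs b _ => hu.memC1Holder hf hfc hT hs b⟩
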